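/- **Setting.** Let $n\ge 2$, let $S\subset\mathbb R^n$ be nonempty, compact and convex, $\tau>0$, and $S_\tau=S+\{v:\|v\|_2\le\tau\}$. Let $q\in[2,\infty]$, $\frac1p+\frac1q=1$, and let $\psi:\mathbb R^n\to\mathbb R$ be continuously differentiable and $1$-strongly convex with respect to $\|\cdot\|_p$, with Bregman divergence $B_\psi(x,y)=\psi(x)-\psi(y)-\langle\nabla\psi(y),x-y\rangle$ and Fenchel conjugate $\psi^*$. Let $\alpha\in(0,1]$, $B>0$, $\Delta\ge0$. In each round $t=1,\dots,T$ ($T\ge1$) an adversary, knowing the past, chooses a stochastic loss $l_t(x,\xi)$ and a noise function $\delta_t(x)$; then $\mathbf e_t$, uniform on the Euclidean unit sphere, and $\xi_t\sim\mathcal D$ are drawn independently of each other and of the past. Put $l_t(x)=\mathbb E_\xi[l_t(x,\xi)]$. Assume that for all $t$: $l_t(\cdot,\xi)$ is convex on $S_\tau$ for every $\xi$; $\mathbb E_\xi|l_t(x,\xi)|^{\alpha+1}\le B^{\alpha+1}$ and $|\delta_t(x)|\le\Delta$ for all $x\in S_\tau$; and one of the following holds. * (Lipschitz, $M\ge0$)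 $|l_t(x,\xi)-l_t(y,\xi)|\le M(\xi)\|x-y\|_2$ on $S_\tau$, with $\mathbb E_\xi[M(\xi)^{\alpha+1}]\le M^{\alpha+1}$. * (Smooth, $L\ge0$) $l_t(\cdot,\xi)$ is differentiable on $S_\tau$ and $\|\nabla l_t(x,\xi)-\nabla l_t(y,\xi)\|_2\le L(\xi)\|x-y\|_2$ on $S_\tau$, with $\mathbb E_\xi[L(\xi)^{\alpha+1}]\le L^{\alpha+1}$. **Algorithm.** $x_1=\arg\min_{x\in S}\psi(x)$, and for $t=1,\dots,T$: play $z_t=x_t+\tau\mathbf e_t$, observe $\phi_t=l_t(z_t,\xi_t)+\delta_t(z_t)$, set $g_t=\frac n\tau\phi_t\mathbf e_t$, $\hat g_t=\frac{g_t}{\|g_t\|_q}\min(\|g_t\|_q,\lambda)$, $y_{t+1}=\nabla\psi^*(\nabla\psi(x_t)-\mu\hat g_t)$, $x_{t+1}=\arg\min_{x\in S}B_\psi(x,y_{t+1})$. **Parameters.** For a fixed $x^*\in S$ let $R_1=\sqrt{2B_\psi(x^*,x_1)}$, $\mathcal D_\psi=\sup_{x,y\in S}\sqrt{2B_\psi(x,y)}$,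 $a_q=n^{\frac1q-\frac12}\min\{\sqrt{32\ln n-8},\sqrt{2q-1}\}$, $\sigma_q^{\alpha+1}=2^\alpha\left(\frac{na_qB}\tau\right)^{\alpha+1}+2^\alpha\left(\frac{na_q\Delta}\tau\right)^{\alpha+1}$, and take $$\mu=\left(\frac{R_1^2}{4T\sigma_q^{\alpha+1}\mathcal D_\psi^{1-\alpha}}\right)^{\frac1{\alpha+1}},\qquad \lambda=\frac{2\alpha\mathcal D_\psi}{(1-\alpha)\mu}\quad(\lambda=\infty,\text{ i.e. no clipping, for }\alpha=1).$$ **Theorem.** Say that the *expected average regret is at most $b$* if $\frac1T\,\mathbb E\big[\sum_{t=1}^T(l_t(z_t)-l_t(x^*))\big]\le b$ and, whenever $x^*$ is almost surely a minimiser of $\sum_t l_t$ over $S$ (for losses fixed in advance: whenever $x^*$ is a minimiser), also $\frac1T\,\mathbb E[\mathcal R_T]\le b$ for the pseudo-regret $\mathcal R_T=\sum_{t=1}^T l_t(z_t)-\min_{x\in S}\sum_{t=1}^T l_t(x)$. 1. The expected average regret is at most $$4M\tau+\Delta\frac{\sqrt n}{\tau}\mathcal D_\psi+4\,\frac{R_1^{\frac{2\alpha}{\alpha+1}}\mathcal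 D_\psi^{\frac{1-\alpha}{\alpha+1}}\,n\,a_q(\Delta+B)}{\tau\,T^{\frac{\alpha}{\alpha+1}}}$$ in the Lipschitz case, and at most the same expression with $2L\tau^2$ in place of $4M\tau$ in the smooth case. 2. Let $\Delta=0$ and $\varepsilon>0$. In the Lipschitz case with $M>0$ and $\tau=\frac{\varepsilon}{8M}$, the expected average regret is at most $\varepsilon$ for every number of iterations $T\ge T_M$, where $$T_M=\left(\frac{8M\cdot4R_1^{\frac{2\alpha}{\alpha+1}}\mathcal D_\psi^{\frac{1-\alpha}{\alpha+1}}na_qB}{\varepsilon^2}\right)^{\frac{\alpha+1}\alpha}\le 32^{\frac{\alpha+1}\alpha}\left(\frac{MBna_q\mathcal D_\psi}{\varepsilon^2}\right)^{\frac{\alpha+1}\alpha}.$$ In the smooth case with $L>0$ and $\tau=\sqrt{\frac{\varepsilon}{4L}}$, the same holds for every $T\ge T_L$, where $$T_L=\left(\frac{\sqrt{4L}\cdot4R_1^{\frac{2\alpha}{\alpha+1}}\mathcal D_\psi^{\frac{1-\alpha}{\alpha+1}}na_qB}{\varepsilon^{3/2}}\right)^{\frac{\alpha+1}\alpha}\le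 8^{\frac{\alpha+1}\alpha}\left(\frac{\sqrt L\,Bna_q\mathcal D_\psi}{\varepsilon^{3/2}}\right)^{\frac{\alpha+1}\alpha}.$$ -/

import Mathlib

open MeasureTheory ProbabilityTheory
open scoped ENNReal Pointwise

noncomputable section

/-- Euclidean space `ℝⁿ`. -/
abbrev Vec (n : ℕ) := EuclideanSpace ℝ (Fin n)

/-- The `ℓ_p`-norm on `ℝⁿ`, `1 ≤ p ≤ ∞`. -/
def lpNormVec {n : ℕ} (p : ℝ≥0∞) (x : Vec n) : ℝ := ‖WithLp.toLp p (x.ofLp)‖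

/-- The uniform distribution on the Euclidean unit sphere, as a measure on `ℝⁿ`. -/
def unifSphere (n : ℕ) : Measure (Vec n) :=
  (((volume : Measure (Vec n)).toSphere Set.univ)⁻¹ •
    (volume : Measure (Vec n)).toSphere).map Subtype.val

/-- The enlarged set `S_τ = S + τ · B`, with `B` the closed Euclidean unit ball. -/
def enlarge {n : ℕ} (S : Set (Vec n)) (τ : ℝ) : Set (Vec n) :=
  S + Metric.closedBall (0 : Vec n) τ

/-- A minimiser of `f` over `S` (an arbitrary point if there is none). -/
def argminOn {n : ℕ} (f : Vec n → ℝ) (S : Set (Vec n)) : Vec n :=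
  Classical.epsilon fun x => x ∈ S ∧ IsMinOn f S x

/-! ### Prox-functions -/

/-- A prox-function: continuously differentiable on `ℝⁿ` and `1`-strongly convex with respect to
the `ℓ_p`-norm. -/
structure IsProx {n : ℕ} (p : ℝ≥0∞) (ψ : Vec n → ℝ) : Prop where
  contDiff : ContDiff ℝ 1 ψ
  strongConvex : ∀ x y : Vec n, ∀ a b : ℝ, 0 ≤ a → 0 ≤ b → a + b = 1 →
    ψ (a • x + b • y) ≤ a * ψ x + b * ψ y - a * b / 2 * lpNormVec p (x - y) ^ 2

/-- The Fenchel conjugate. -/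
def fenchelConj {n : ℕ} (ψ : Vec n → ℝ) (y : Vec n) : ℝ :=
  ⨆ x : Vec n, (inner ℝ x y - ψ x)

/-- The Bregman divergence. -/
def bregman {n : ℕ} (ψ : Vec n → ℝ) (x y : Vec n) : ℝ :=
  ψ x - ψ y - inner ℝ (gradient ψ y) (x - y)

/-- The starting point of the algorithm. -/
def startPoint {n : ℕ} (ψ : Vec n → ℝ) (S : Set (Vec n)) : Vec n := argminOn ψ S

/-- `R₁ = √(2 B_ψ(u, x₁))`. -/
def proxDist {n : ℕ} (ψ : Vec n → ℝ) (S : Set (Vec n)) (u : Vec n) : ℝ :=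
  √(2 * bregman ψ u (startPoint ψ S))

/-- `D_ψ = sup_{x, y ∈ S} √(2 B_ψ(x, y))`. -/
def proxDiam {n : ℕ} (ψ : Vec n → ℝ) (S : Set (Vec n)) : ℝ :=
  sSup {r : ℝ | ∃ x ∈ S, ∃ y ∈ S, r = √(2 * bregman ψ x y)}

/-! ### The parameters of the algorithm -/

/-- `a_q = n^{1/q - 1/2} min {√(32 ln n - 8), √(2q - 1)}`, where `√(2q - 1) = ∞` for `q = ∞`. -/
def aConst (n : ℕ) (q : ℝ≥0∞) : ℝ :=
  (n : ℝ) ^ ((q⁻¹).toReal - 1 / 2) *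
    (if q = ∞ then √(32 * Real.log n - 8)
      else min (√(32 * Real.log n - 8)) (√(2 * q.toReal - 1)))

/-- `σ_q`, with
`σ_q^{α+1} = 2^α (n a_q B / τ)^{α+1} + 2^α (n a_q Δ / τ)^{α+1}`. -/
def sigmaConst (n : ℕ) (q : ℝ≥0∞) (α B Δ τ : ℝ) : ℝ :=
  ((2 : ℝ) ^ α * (n * aConst n q * B / τ) ^ (α + 1)
    + (2 : ℝ) ^ α * (n * aConst n q * Δ / τ) ^ (α + 1)) ^ (1 / (α + 1))

/-- `μ = (R² / (4 T σ^{α+1} D^{1-α}))^{1/(α+1)}`. -/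
def stepSize (α : ℝ) (T : ℕ) (R D σ : ℝ) : ℝ :=
  (R ^ 2 / (4 * T * σ ^ (α + 1) * D ^ (1 - α))) ^ (1 / (α + 1))

/-- `λ = 2 α D / ((1 - α) μ)`, an extended number: it is `∞` (no clipping) for `α = 1`. -/
def clipLevel (α D μ : ℝ) : ℝ≥0∞ :=
  ENNReal.ofReal (2 * α * D) / ENNReal.ofReal ((1 - α) * μ)

/-- Norm clipping `g / ‖g‖_q · min (‖g‖_q, λ)` (and `0` for `g = 0`). -/
def clipVec {n : ℕ} (q lam : ℝ≥0∞) (g : Vec n) : Vec n :=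
  ((min (ENNReal.ofReal (lpNormVec q g)) lam).toReal / lpNormVec q g) • g

/-! ### The environment -/

/-- What happened in the first `t` rounds: the sampled directions and the values of the loss noise
`ξ` (the points played are functions of these). -/
abbrev History (n : ℕ) (Ξ : Type*) (t : ℕ) := Fin t → Vec n × Ξ

/-- An environment: in round `t` (counted from `0`), knowing the past, the adversary chooses the
stochastic loss `l_t(x, ξ)` and the adversarial noise `δ_t(x)`. -/
structure Environment (n : ℕ) (Ξ : Type*) [MeasurableSpace Ξ] where
  loss : (t : ℕ) → History n Ξ t → Vec n → Ξ → ℝ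
  noise : (t : ℕ) → History n Ξ t → Vec n → ℝ
  measurable_loss : ∀ t, Measurable fun a : History n Ξ t × Vec n × Ξ => loss t a.1 a.2.1 a.2.2
  measurable_noise : ∀ t, Measurable fun a : History n Ξ t × Vec n => noise t a.1 a.2

namespace Environment

variable {n : ℕ} {Ξ : Type*} [MeasurableSpace Ξ]

/-- The loss function `l_t(x) = 𝔼_ξ [l_t(x, ξ)]`. -/
def meanLoss (A : Environment n Ξ) (𝒟 : Measure Ξ) (t : ℕ) (h : History n Ξ t) (x : Vec n) : ℝ :=
  ∫ s, A.loss t h x s ∂𝒟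

/-- Convexity: every `l_t(·, ξ)` is convex on `S_τ`. -/
def ConvexLoss (A : Environment n Ξ) (S : Set (Vec n)) (τ : ℝ) : Prop :=
  ∀ t h s, ConvexOn ℝ (enlarge S τ) fun x => A.loss t h x s

/-- Boundedness: `𝔼_ξ |l_t(x, ξ)|^{α+1} ≤ B^{α+1}` on `S_τ`. -/
def BoundedLoss (A : Environment n Ξ) (𝒟 : Measure Ξ) (S : Set (Vec n)) (τ α B : ℝ) : Prop :=
  ∀ t h, ∀ x ∈ enlarge S τ,
    Integrable (fun s => |A.loss t h x s| ^ (α + 1)) 𝒟 ∧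
      ∫ s, |A.loss t h x s| ^ (α + 1) ∂𝒟 ≤ B ^ (α + 1)

/-- Bounded adversarial noise: `|δ_t| ≤ Δ` on `S_τ`. -/
def BoundedNoise (A : Environment n Ξ) (S : Set (Vec n)) (τ Δ : ℝ) : Prop :=
  ∀ t h, ∀ x ∈ enlarge S τ, |A.noise t h x| ≤ Δ

/-- `l_t(·, ξ)` is `M(ξ)`-Lipschitz on `S_τ` with `𝔼 M(ξ)^{α+1} ≤ M^{α+1}`. -/
def LipschitzLoss (A : Environment n Ξ) (𝒟 : Measure Ξ) (S : Set (Vec n)) (τ α M : ℝ) : Prop :=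
  ∀ t h, ∃ m : Ξ → ℝ, (∀ s, 0 ≤ m s) ∧
    (∀ s, ∀ x ∈ enlarge S τ, ∀ y ∈ enlarge S τ,
      |A.loss t h x s - A.loss t h y s| ≤ m s * ‖x - y‖) ∧
    Integrable (fun s => m s ^ (α + 1)) 𝒟 ∧ ∫ s, m s ^ (α + 1) ∂𝒟 ≤ M ^ (α + 1)

/-- `l_t(·, ξ)` is differentiable on `S_τ` with an `L(ξ)`-Lipschitz gradient, and
`𝔼 L(ξ)^{α+1} ≤ L^{α+1}`. -/
def SmoothLoss (A : Environment n Ξ) (𝒟 : Measure Ξ) (S : Set (Vec n)) (τ α L : ℝ) : Prop :=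
  ∀ t h, ∃ m : Ξ → ℝ, (∀ s, 0 ≤ m s) ∧
    (∀ s, ∃ G : Vec n → Vec n,
      (∀ x ∈ enlarge S τ,
        HasGradientWithinAt (fun y => A.loss t h y s) (G x) (enlarge S τ) x) ∧
      ∀ x ∈ enlarge S τ, ∀ y ∈ enlarge S τ, ‖G x - G y‖ ≤ m s * ‖x - y‖) ∧
    Integrable (fun s => m s ^ (α + 1)) 𝒟 ∧ ∫ s, m s ^ (α + 1) ∂𝒟 ≤ L ^ (α + 1)

end Environment

/-! ### The algorithm -/

/-- The data `(e_t, ξ_t)` of the first `t` rounds of a path. -/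
def pastOf {n : ℕ} {Ξ : Type*} (w : ℕ → Vec n × Ξ) (t : ℕ) : History n Ξ t := fun i => w i

section Algorithm

variable {n : ℕ} {Ξ : Type*} [MeasurableSpace Ξ]

/-- The one-point estimate `g_t = (n / τ) φ_t(z_t, ξ_t) e_t` at `z_t = x_t + τ e_t`, where
`φ_t = l_t + δ_t`, for the current point `x` and the path `w` of the `(e_t, ξ_t)`. -/
def gradEst (A : Environment n Ξ) (τ : ℝ) (w : ℕ → Vec n × Ξ) (t : ℕ) (x : Vec n) : Vec n :=
  ((n : ℝ) / τ *
    (A.loss t (pastOf w t) (x + τ • (w t).1) (w t).2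
      + A.noise t (pastOf w t) (x + τ • (w t).1))) • (w t).1

/-- One mirror descent step from `x` with update vector `g` and stepsize `μ`:
`y = ∇ψ*(∇ψ(x) - μ g)`, followed by the Bregman projection of `y` onto `S`. -/
def mirrorStep (ψ : Vec n → ℝ) (S : Set (Vec n)) (μ : ℝ) (x g : Vec n) : Vec n :=
  argminOn (fun v => bregman ψ v (gradient (fenchelConj ψ) (gradient ψ x - μ • g))) S

/-- The points `x_t` of the clipping algorithm (`t` counted from `0`). -/
def iterX (A : Environment n Ξ) (ψ : Vec n → ℝ) (S : Set (Vec n)) (q : ℝ≥0∞) (τ μ : ℝ)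
    (lam : ℝ≥0∞) (w : ℕ → Vec n × Ξ) : ℕ → Vec n
  | 0 => startPoint ψ S
  | t + 1 =>
    mirrorStep ψ S μ (iterX A ψ S q τ μ lam w t)
      (clipVec q lam (gradEst A τ w t (iterX A ψ S q τ μ lam w t)))

/-- The points `z_t = x_t + τ e_t` played by the clipping algorithm. -/
def iterZ (A : Environment n Ξ) (ψ : Vec n → ℝ) (S : Set (Vec n)) (q : ℝ≥0∞) (τ μ : ℝ)
    (lam : ℝ≥0∞) (w : ℕ → Vec n × Ξ) (t : ℕ) : Vec n :=
  iterX A ψ S q τ μ lam w t + τ • (w t).1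

/-- The points played by the algorithm run for `T` rounds with the prescribed stepsize and clipping
level, computed from `R = R₁` and `D = D_ψ`. -/
def playedPoint (A : Environment n Ξ) (ψ : Vec n → ℝ) (S : Set (Vec n)) (q : ℝ≥0∞)
    (α B Δ τ : ℝ) (T : ℕ) (u : Vec n) (w : ℕ → Vec n × Ξ) (t : ℕ) : Vec n :=
  iterZ A ψ S q τ
    (stepSize α T (proxDist ψ S u) (proxDiam ψ S) (sigmaConst n q α B Δ τ))
    (clipLevel α (proxDiam ψ S)
      (stepSize α T (proxDist ψ S u) (proxDiam ψ S) (sigmaConst n q α B Δ τ)))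
    w t

/-- The total loss `∑_t l_t(x)` of a fixed point `x` along a path. -/
def totalLoss (A : Environment n Ξ) (𝒟 : Measure Ξ) (T : ℕ) (w : ℕ → Vec n × Ξ) (x : Vec n) : ℝ :=
  ∑ t ∈ Finset.range T, A.meanLoss 𝒟 t (pastOf w t) x

/-- The total loss `∑_t l_t(z_t)` of a sequence of points along a path. -/
def sequenceLoss (A : Environment n Ξ) (𝒟 : Measure Ξ) (T : ℕ) (w : ℕ → Vec n × Ξ)
    (z : ℕ → Vec n) : ℝ :=
  ∑ t ∈ Finset.range T, A.meanLoss 𝒟 t (pastOf w t) (z t)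

/-- The pseudo-regret `∑_t l_t(z_t) - min_{x ∈ S} ∑_t l_t(x)`. -/
def pseudoRegret (A : Environment n Ξ) (𝒟 : Measure Ξ) (S : Set (Vec n)) (T : ℕ)
    (w : ℕ → Vec n × Ξ) (z : ℕ → Vec n) : ℝ :=
  sequenceLoss A 𝒟 T w z - sInf (totalLoss A 𝒟 T w '' S)

end Algorithm

/-! ### Randomness and expected regret -/

/-- The pairs `(e_t, ξ_t)` are independent over `t`; in each round `e_t` is uniform on the unit
sphere and independent of `ξ_t`, which has the distribution `𝒟`. -/
structure IsSampling {n : ℕ} {Ξ Ω : Type*} [MeasurableSpace Ξ] [MeasurableSpace Ω]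
    (P : Measure Ω) (𝒟 : Measure Ξ) (e : ℕ → Ω → Vec n) (ξ : ℕ → Ω → Ξ) : Prop where
  measurable_e : ∀ t, Measurable (e t)
  measurable_ξ : ∀ t, Measurable (ξ t)
  law : ∀ t, P.map (fun ω => (e t ω, ξ t ω)) = (unifSphere n).prod 𝒟
  indep : iIndepFun (fun t ω => (e t ω, ξ t ω)) P

/-- The expected average regret of the random points `z` over `T` rounds is at most `b`:
first, against the fixed point `u`, whatever the environment does; second, as a bound on
`𝔼 [R_T] / T` for the pseudo-regret `R_T`, if `u` is almost surely a solution, that is, a minimiser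
of the total loss over `S` (for losses `l_t` chosen in advance this is just the condition that `u`
minimises `∑_t l_t` over `S`). -/
def AvgRegretLE {n : ℕ} {Ξ Ω : Type*} [MeasurableSpace Ξ] [MeasurableSpace Ω]
    (P : Measure Ω) (A : Environment n Ξ) (𝒟 : Measure Ξ) (S : Set (Vec n)) (T : ℕ)
    (w : Ω → ℕ → Vec n × Ξ) (z : Ω → ℕ → Vec n) (u : Vec n) (b : ℝ) : Prop :=
  (Integrable (fun ω => sequenceLoss A 𝒟 T (w ω) (z ω) - totalLoss A 𝒟 T (w ω) u) P ∧
    1 / (T : ℝ) * ∫ ω, (sequenceLoss A 𝒟 T (w ω) (z ω) - totalLoss A 𝒟 T (w ω) u) ∂P ≤ b) ∧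
  ((∀ᵐ ω ∂P, IsMinOn (totalLoss A 𝒟 T (w ω)) S u) →
    Integrable (fun ω => pseudoRegret A 𝒟 S T (w ω) (z ω)) P ∧
      1 / (T : ℝ) * ∫ ω, pseudoRegret A 𝒟 S T (w ω) (z ω) ∂P ≤ b)

end

/-! Write `D` and `R` for `proxDiam` and `proxDist`. Conditionally on the past, one round splits
into three parts: how well the one-point estimate `g` acts as a subgradient, how much clipping
loses, and the mirror descent regret.

Subgradient. For `f` convex in the direction `d = u - x`, the divergence theorem turns the sphere
average of `f(x + τθ)⟨θ, d⟩` into an average of the directional derivative over the ball, and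
convexity bounds that derivative by `f(y + d) - f(y)`. No gradient of `f` is needed:
`surface_integral_le` puts the derivative on a Lipschitz cutoff of the ball and lets the cutoff
sharpen. Averaging over `y` and `-y` leaves symmetric second differences only. Those at `x` have a
favourable sign by convexity, and those at `u` cost `b` (`IsRoundLoss.integral_sphere_inner_le`).
Playing `x + τθ` instead of `x` costs another `b`. Here `b = Mτ` for Lipschitz losses and `b =
Lτ²/2` for smooth ones. Adversarial noise adds `Δ√n D/τ`, because `E|⟨θ, v⟩| ≤ ‖v‖/√n`.

Moments. `E‖g‖_q^(α+1) ≤ σ^(α+1)` reduces to moments of `‖θ‖_q` on the sphere. Splitting a Gaussian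
integral into direction and radius gives `E θ_i^(2k) ≤ ((2k-1)/n)^k`. Comparison of `ℓ_q` with
`ℓ_{2k}` and Jensen's inequality then give `a_q`, with `k = ⌈ln n⌉` or `k = ⌈q/2⌉`
(`lpNormVec_moment_le_aConst`).

Clipping. The clipping bias paired with a vector of length at most `D`, plus the mirror descent term
`μ/2 ‖ĝ‖_q²`, is at most `D^(1-α) μ^α ‖g‖_q^(α+1)` (`clip_tradeoff`). After rescaling this is a
one-variable inequality at the threshold `2α/(1-α)`, so only the moment of order `α + 1` enters.

Assembly. Mirror descent with the clipped vectors telescopes to `R²/(2μ)`. The stepsize makes the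
`T` moment terms sum to `R²/(4μ)` (`stepSize_balance`). Independence of the current draw from the
past lets the one-round bounds be integrated over histories. The average regret is then at most `2b
+ Δ√n D/τ` plus three times the rate term (`avgRegretLE_playedPoint`). These constants are sharper
than those of the general bounds, and the iteration counts need the sharper ones. If `R = 0` the
stepsize vanishes and the iterates stay at the comparison point. -/

noncomputable section

/-! ### `ℓ_p`-norms on `ℝⁿ` -/

section LpNorm

variable {n : ℕ}

lemma lpNormVec_eq_sum {p : ℝ≥0∞} (hp : 0 < p.toReal) (x : Vec n) :
    lpNormVec p x = (∑ i, |x i| ^ p.toReal) ^ (1 / p.toReal) := by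
  simp [lpNormVec, PiLp.norm_eq_sum hp, Real.norm_eq_abs]

lemma lpNormVec_top (x : Vec n) : lpNormVec ∞ x = ⨆ i, |x i| := by
  simp [lpNormVec, PiLp.norm_eq_ciSup, Real.norm_eq_abs]

lemma lpNormVec_nonneg {p : ℝ≥0∞} (hp : 1 ≤ p) (x : Vec n) : 0 ≤ lpNormVec p x := by
  have : Fact (1 ≤ p) := ⟨hp⟩
  exact norm_nonneg _

lemma lpNormVec_smul {p : ℝ≥0∞} (hp : 1 ≤ p) (c : ℝ) (x : Vec n) :
    lpNormVec p (c • x) = |c| * lpNormVec p x := by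
  have : Fact (1 ≤ p) := ⟨hp⟩
  have : WithLp.toLp p (c • x).ofLp = c • WithLp.toLp p x.ofLp := rfl
  rw [lpNormVec, this, norm_smul, Real.norm_eq_abs, lpNormVec]

lemma abs_le_lpNormVec {p : ℝ≥0∞} (hp : 1 ≤ p) (x : Vec n) (i : Fin n) :
    |x i| ≤ lpNormVec p x := by
  have : Fact (1 ≤ p) := ⟨hp⟩
  exact PiLp.norm_apply_le (WithLp.toLp p x.ofLp) i

lemma continuous_lpNormVec {p : ℝ≥0∞} (hp : 1 ≤ p) :
    Continuous (lpNormVec p : Vec n → ℝ) := by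
  have : Fact (1 ≤ p) := ⟨hp⟩
  unfold lpNormVec
  fun_prop

/-- Hölder's inequality. -/
lemma inner_le_lpNormVec_mul_lpNormVec {p q : ℝ≥0∞} (hpq : p.HolderConjugate q) (x y : Vec n) :
    inner ℝ x y ≤ lpNormVec p x * lpNormVec q y := by
  have hinner : inner ℝ x y = ∑ i, x i * y i := by
    simp [PiLp.inner_apply, mul_comm]
  have key : ∀ x y : Vec n, ∑ i, x i * y i ≤ lpNormVec 1 x * lpNormVec ∞ y := by
    intro x y
    rw [lpNormVec_eq_sum (by simp)]
    simp only [ENNReal.toReal_one, Real.rpow_one, div_one]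
    rw [Finset.sum_mul]
    refine Finset.sum_le_sum fun i _ => ?_
    calc x i * y i ≤ |x i * y i| := le_abs_self _
      _ = |x i| * |y i| := abs_mul _ _
      _ ≤ _ := by
        gcongr
        exact abs_le_lpNormVec (by simp) y i
  rw [hinner]
  by_cases hq : q = ∞
  · subst hq
    have : p = 1 := by simpa using (ENNReal.holderConjugate_iff.1 hpq)
    subst this
    exact key x y
  by_cases hp : p = ∞
  · subst hp
    have : q = 1 := by simpa using (ENNReal.holderConjugate_iff.1 hpq)
    subst this
    rw [mul_comm]
    simpa [mul_comm] using key y x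
  have h := ENNReal.HolderConjugate.toReal_of_ne_top hp hq
  rw [lpNormVec_eq_sum h.pos, lpNormVec_eq_sum h.symm.pos]
  exact Real.inner_le_Lp_mul_Lq _ _ _ h

/-- Interpolation against the largest entry: in `|x_i|² = |x_i|^(2-p) |x_i|^p` the first factor is
at most `‖x‖_p^(2-p)`. Through this, strong convexity in `ℓ_p` also gives Euclidean strong
convexity. -/
lemma norm_le_lpNormVec {p : ℝ≥0∞} (hp : 1 ≤ p) (hp2 : p ≤ 2) (x : Vec n) :
    ‖x‖ ≤ lpNormVec p x := by
  have hptop : p ≠ ∞ := ne_top_of_le_ne_top (by simp) hp2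
  have hp1 : 1 ≤ p.toReal := by
    simpa using (ENNReal.toReal_le_toReal (by simp) hptop).2 hp
  have hp2' : p.toReal ≤ 2 := by
    simpa using (ENNReal.toReal_le_toReal hptop (by simp)).2 hp2
  have hN := lpNormVec_nonneg hp x
  have hsum : ∑ i, |x i| ^ p.toReal = lpNormVec p x ^ p.toReal := by
    rw [lpNormVec_eq_sum (by linarith), ← Real.rpow_mul (by positivity), one_div,
      inv_mul_cancel₀ (by linarith), Real.rpow_one]
  rw [EuclideanSpace.norm_eq]
  refine Real.sqrt_le_iff.2 ⟨hN, ?_⟩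
  have hsplit : ∀ y : ℝ, 0 ≤ y → y ^ 2 = y ^ (2 - p.toReal) * y ^ p.toReal := by
    intro y hy
    rw [← Real.rpow_add' hy (by norm_num), sub_add_cancel, Real.rpow_two]
  calc ∑ i, ‖x i‖ ^ 2 = ∑ i, |x i| ^ (2 - p.toReal) * |x i| ^ p.toReal := by
        refine Finset.sum_congr rfl fun i _ => ?_
        rw [← hsplit _ (abs_nonneg _), Real.norm_eq_abs]
    _ ≤ ∑ i, lpNormVec p x ^ (2 - p.toReal) * |x i| ^ p.toReal := by
        gcongr with i
        · exact abs_le_lpNormVec hp x i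
    _ = lpNormVec p x ^ 2 := by
        rw [← Finset.mul_sum, hsum, ← hsplit _ hN]

/-- Comparison of the `ℓ_q`-norm with the `ℓ_{2k}`-norm, for `q ≤ 2k`. -/
lemma lpNormVec_le_of_le_two_mul {q : ℝ≥0∞} (hq : 1 ≤ q) (hqtop : q ≠ ∞) {k : ℕ}
    (hqk : q.toReal ≤ 2 * k) (x : Vec n) :
    lpNormVec q x ≤ (n : ℝ) ^ (1 / q.toReal - 1 / (2 * k : ℝ)) *
      (∑ i, x i ^ (2 * k)) ^ (1 / (2 * k : ℝ)) := by
  have hq1 : 1 ≤ q.toReal := by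
    simpa using (ENNReal.toReal_le_toReal (by simp) hqtop).2 hq
  have hk : (0 : ℝ) < 2 * k := by linarith
  -- Power mean inequality for the numbers `|x i|^q` with exponent `2k/q ≥ 1`.
  have h := Real.rpow_sum_le_const_mul_sum_rpow Finset.univ (fun i => |x i| ^ q.toReal)
    (p := 2 * k / q.toReal) (by rw [le_div_iff₀ (by linarith)]; linarith)
  simp only [Finset.card_univ, Fintype.card_fin] at h
  have e1 : ∀ i, |(|x i| ^ q.toReal)| = |x i| ^ q.toReal := fun i =>
    abs_of_nonneg (by positivity)
  have e2 : ∀ i, (|x i| ^ q.toReal) ^ (2 * k / q.toReal) = x i ^ (2 * k) := fun i => by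
    rw [← Real.rpow_mul (abs_nonneg _), mul_div_cancel₀ _ (by linarith)]
    rw [show (2 * k : ℝ) = ((2 * k : ℕ) : ℝ) by push_cast; ring, Real.rpow_natCast,
      pow_mul, sq_abs, ← pow_mul]
  simp only [e1, e2] at h
  have hS : 0 ≤ ∑ i, x i ^ (2 * k) :=
    Finset.sum_nonneg fun i _ => by rw [pow_mul]; positivity
  rw [lpNormVec_eq_sum (by linarith)]
  have h2 := Real.rpow_le_rpow (by positivity) h (z := 1 / (2 * k : ℝ)) (by positivity)
  rw [← Real.rpow_mul (by positivity), Real.mul_rpow (by positivity) hS,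
    ← Real.rpow_mul (by positivity)] at h2
  have hq0 : q.toReal ≠ 0 := by linarith
  have hk0 : (k : ℝ) ≠ 0 := by linarith
  convert h2 using 2
  · field_simp
  · congr 1
    field_simp

/-- Comparison of the `ℓ_q`-norm with the `ℓ_{2k}`-norm, for arbitrary `q`. -/
lemma lpNormVec_le_rpow_inv_mul {q : ℝ≥0∞} (hq : 1 ≤ q) {k : ℕ} (hk : 1 ≤ k) (x : Vec n) :
    lpNormVec q x ≤ (n : ℝ) ^ (q⁻¹).toReal *
      (∑ i, x i ^ (2 * k)) ^ (1 / (2 * k : ℝ)) := by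
  have hS : ∀ i, 0 ≤ x i ^ (2 * k) := fun i => by rw [pow_mul]; positivity
  have hk0 : (0 : ℝ) < 2 * k := by positivity
  set m := (∑ i, x i ^ (2 * k)) ^ (1 / (2 * k : ℝ)) with hm
  have hm0 : 0 ≤ m := Real.rpow_nonneg (Finset.sum_nonneg fun i _ => hS i) _
  have hle : ∀ i, |x i| ≤ m := by
    intro i
    have h1 : |x i| ^ (2 * k) ≤ ∑ i, x i ^ (2 * k) := by
      rw [pow_mul, sq_abs, ← pow_mul]
      exact Finset.single_le_sum (fun i _ => hS i) (Finset.mem_univ i)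
    have h2 := Real.rpow_le_rpow (by positivity) h1 (z := 1 / (2 * k : ℝ)) (by positivity)
    rwa [← Real.rpow_natCast, ← Real.rpow_mul (abs_nonneg _), Nat.cast_mul, Nat.cast_ofNat,
      mul_one_div_cancel hk0.ne', Real.rpow_one] at h2
  by_cases hqt : q = ∞
  · subst hqt
    rw [lpNormVec_top]
    simp only [ENNReal.inv_top, ENNReal.toReal_zero, Real.rpow_zero, one_mul]
    exact Real.iSup_le hle hm0
  · have hq1 : 1 ≤ q.toReal := by
      simpa using (ENNReal.toReal_le_toReal (by simp) hqt).2 hq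
    rw [lpNormVec_eq_sum (by linarith), ENNReal.toReal_inv]
    calc (∑ i, |x i| ^ q.toReal) ^ (1 / q.toReal)
        ≤ (∑ _i : Fin n, m ^ q.toReal) ^ (1 / q.toReal) := by
          gcongr with i
          exact hle i
      _ = _ := by
        rw [Finset.sum_const, Finset.card_univ, Fintype.card_fin, nsmul_eq_mul,
          Real.mul_rpow (by positivity) (by positivity), ← Real.rpow_mul hm0,
          mul_one_div_cancel (by linarith), Real.rpow_one, one_div]

end LpNorm

/-! ### Prox-functions, Bregman divergences and mirror descent steps -/

section Prox

open Filter Topology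

variable {n : ℕ} {p : ℝ≥0∞} {ψ : Vec n → ℝ}

lemma IsProx.hasGradientAt (hψ : IsProx p ψ) (x : Vec n) :
    HasGradientAt ψ (gradient ψ x) x :=
  ((hψ.contDiff.differentiable (by norm_num)) x).hasGradientAt

lemma IsProx.continuous_gradient (hψ : IsProx p ψ) : Continuous (gradient ψ) := by
  have := hψ.contDiff.continuous_fderiv (by norm_num)
  unfold gradient
  exact (InnerProductSpace.toDual ℝ (Vec n)).symm.continuous.comp this

lemma IsProx.continuous_bregman (hψ : IsProx p ψ) :
    Continuous fun a : Vec n × Vec n => bregman ψ a.1 a.2 := by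
  have h1 := hψ.contDiff.continuous
  have h2 := hψ.continuous_gradient
  unfold bregman
  fun_prop

/-- The derivative of `f` along a line through a point where `f` has a gradient. -/
lemma HasGradientAt.hasDerivAt_line {f : Vec n → ℝ} {g x : Vec n} (h : HasGradientAt f g x)
    (d : Vec n) : HasDerivAt (fun s : ℝ => f (x + s • d)) (inner ℝ g d) 0 := by
  have h1 : HasFDerivAt f (InnerProductSpace.toDual ℝ (Vec n) g) (x + (0 : ℝ) • d) := by
    simpa using h.hasFDerivAt
  have h2 : HasDerivAt (fun s : ℝ => x + s • d) d 0 := by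
    simpa using ((hasDerivAt_id (0 : ℝ)).smul_const d).const_add x
  simpa [Function.comp_def] using h1.comp_hasDerivAt (0 : ℝ) h2

/-- The common limiting step behind the strong convexity inequality and the first-order optimality
condition: both bound right-hand difference quotients on `(0, 1)` only. -/
lemma HasDerivAt.le_of_forall_slope_le {φ : ℝ → ℝ} {φ' : ℝ} (h : HasDerivAt φ φ' 0)
    {b : ℝ → ℝ} (hb : ContinuousAt b 0)
    (hle : ∀ s ∈ Set.Ioo (0 : ℝ) 1, φ s - φ 0 ≤ s * b s) : φ' ≤ b 0 := by
  have h1 := h.tendsto_slope_zero_right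
  refine le_of_tendsto_of_tendsto h1 (hb.tendsto.mono_left nhdsWithin_le_nhds) ?_
  filter_upwards [Ioo_mem_nhdsGT (zero_lt_one' ℝ)] with s hs
  have := hle s hs
  rw [zero_add, smul_eq_mul, inv_mul_le_iff₀ hs.1]
  exact this

/-- Strong convexity on the segment from `x` to `y`, divided by the parameter `s`, in the limit `s →
0`. -/
lemma IsProx.half_sq_le_bregman (hψ : IsProx p ψ) (y x : Vec n) :
    lpNormVec p (x - y) ^ 2 / 2 ≤ bregman ψ y x := by
  have h := (hψ.hasGradientAt x).hasDerivAt_line (y - x)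
  have := h.le_of_forall_slope_le
    (b := fun s => ψ y - ψ x - (1 - s) / 2 * lpNormVec p (x - y) ^ 2) (by fun_prop) (by
      intro s hs
      have h1 := hψ.strongConvex x y (1 - s) s (by linarith [hs.2]) hs.1.le (by ring)
      have e : (1 - s) • x + s • y = x + s • (y - x) := by module
      rw [e] at h1
      simp only [zero_smul, add_zero]
      nlinarith)
  unfold bregman
  linarith

lemma IsProx.half_norm_sq_le_bregman (hψ : IsProx p ψ) (hp : 1 ≤ p) (hp2 : p ≤ 2) (y x : Vec n) :
    ‖x - y‖ ^ 2 / 2 ≤ bregman ψ y x := by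
  refine le_trans ?_ (hψ.half_sq_le_bregman y x)
  have := norm_le_lpNormVec hp hp2 (x - y)
  gcongr

lemma IsProx.bregman_nonneg (hψ : IsProx p ψ) (y x : Vec n) : 0 ≤ bregman ψ y x :=
  le_trans (by positivity) (hψ.half_sq_le_bregman y x)

/-- The gradient of a prox-function is onto. -/
lemma IsProx.exists_gradient_eq (hψ : IsProx p ψ) (hp : 1 ≤ p) (hp2 : p ≤ 2) (ζ : Vec n) :
    ∃ y, gradient ψ y = ζ := by
  have hcont : Continuous fun v => ψ v - inner ℝ ζ v := by
    have := hψ.contDiff.continuous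
    fun_prop
  -- Strong convexity at `0` gives quadratic growth, so the tilted function attains its minimum. The
  -- gradient there is `ζ`.
  have hlim : Tendsto (fun v => ψ v - inner ℝ ζ v) (cocompact (Vec n)) atTop := by
    have hquad : Tendsto (fun r : ℝ => ψ 0 + r * (r / 2 - ‖gradient ψ 0 - ζ‖)) atTop atTop := by
      refine tendsto_atTop_add_const_left _ _ ?_
      refine tendsto_id.atTop_mul_atTop₀ ?_
      exact tendsto_atTop_add_const_right _ _ (tendsto_id.atTop_div_const (by norm_num))
    refine tendsto_atTop_mono (fun v => ?_) (hquad.comp (tendsto_norm_cocompact_atTop (E := Vec n)))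
    have h1 := hψ.half_norm_sq_le_bregman hp hp2 v 0
    unfold bregman at h1
    have h2 := neg_le_of_abs_le (abs_real_inner_le_norm (gradient ψ 0 - ζ) v)
    rw [inner_sub_left] at h2
    simp only [zero_sub, norm_neg, sub_zero] at h1
    simp only [Function.comp]
    nlinarith
  obtain ⟨y, hy⟩ := hcont.exists_forall_le hlim
  refine ⟨y, ?_⟩
  have hmin : IsLocalMin (fun v => ψ v - inner ℝ ζ v) y := Eventually.of_forall hy
  have hd : HasFDerivAt (fun v => ψ v - inner ℝ ζ v)
      (InnerProductSpace.toDual ℝ (Vec n) (gradient ψ y) - innerSL ℝ ζ) y :=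
    (hψ.hasGradientAt y).hasFDerivAt.sub (innerSL ℝ ζ).hasFDerivAt
  have h0 := hmin.hasFDerivAt_eq_zero hd
  have h1 := congrArg (fun F => F (gradient ψ y - ζ)) h0
  simp only [sub_apply, InnerProductSpace.toDual_apply_apply,
    innerSL_apply_apply, zero_apply] at h1
  rw [← inner_sub_left] at h1
  exact sub_eq_zero.1 (inner_self_eq_zero.1 h1)

/-- The gradient of the Fenchel conjugate inverts the gradient. -/
lemma IsProx.gradient_fenchelConj (hψ : IsProx p ψ) (hp : 1 ≤ p) (hp2 : p ≤ 2) (y : Vec n) :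
    gradient (fenchelConj ψ) (gradient ψ y) = y := by
  -- Strong convexity of `ψ` at `y` becomes a quadratic upper bound on the conjugate around `∇ψ(y)`.
  -- The choice `v = y` gives the matching affine lower bound, and squeezing between them yields the
  -- derivative.
  have hup : ∀ ζ' v : Vec n, inner ℝ v ζ' - ψ v ≤ inner ℝ y (gradient ψ y) - ψ y +
      inner ℝ y (ζ' - gradient ψ y) + ‖ζ' - gradient ψ y‖ ^ 2 / 2 := by
    intro ζ' v
    have h1 := hψ.half_norm_sq_le_bregman hp hp2 v y
    unfold bregman at h1
    have h2 := real_inner_le_norm (v - y) (ζ' - gradient ψ y)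
    have h3 : ‖y - v‖ = ‖v - y‖ := norm_sub_rev _ _
    have h4 : inner ℝ v (gradient ψ y) = inner ℝ (gradient ψ y) v := real_inner_comm _ _
    have h5 : inner ℝ y (gradient ψ y) = inner ℝ (gradient ψ y) y := real_inner_comm _ _
    simp only [inner_sub_left, inner_sub_right] at *
    rw [h3] at h1
    nlinarith [sq_nonneg (‖v - y‖ - ‖ζ' - gradient ψ y‖)]
  have hbdd : ∀ ζ' : Vec n, BddAbove (Set.range fun v => inner ℝ v ζ' - ψ v) := fun ζ' =>
    ⟨_, by rintro _ ⟨v, rfl⟩; exact hup ζ' v⟩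
  have hval : fenchelConj ψ (gradient ψ y) = inner ℝ y (gradient ψ y) - ψ y := by
    refine le_antisymm (ciSup_le fun v => ?_) (le_ciSup (hbdd _) y)
    simpa using hup (gradient ψ y) v
  refine HasGradientAt.gradient ?_
  rw [hasGradientAt_iff_isLittleO, Asymptotics.isLittleO_iff]
  intro c hc
  filter_upwards [Metric.ball_mem_nhds (gradient ψ y) hc] with ζ' hζ'
  rw [hval]
  have h1 : inner ℝ y ζ' - ψ y ≤ fenchelConj ψ ζ' := le_ciSup (hbdd ζ') y
  have h2 : fenchelConj ψ ζ' ≤ _ := ciSup_le (hup ζ')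
  have h3 : ‖ζ' - gradient ψ y‖ < c := by simpa [dist_eq_norm] using hζ'
  have h4 : inner ℝ y ζ' = inner ℝ y (gradient ψ y) + inner ℝ y (ζ' - gradient ψ y) := by
    rw [inner_sub_right]; ring
  rw [Real.norm_eq_abs, abs_of_nonneg (by linarith)]
  nlinarith [norm_nonneg (ζ' - gradient ψ y)]

/-! ### Bregman projections, mirror steps and the diameter. -/

lemma argminOn_spec {f : Vec n → ℝ} {S : Set (Vec n)} (hS : S.Nonempty) (hc : IsCompact S)
    (hf : Continuous f) : argminOn f S ∈ S ∧ IsMinOn f S (argminOn f S) :=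
  Classical.epsilon_spec (p := fun x => x ∈ S ∧ IsMinOn f S x)
    (hc.exists_isMinOn hS hf.continuousOn)

lemma IsProx.startPoint_mem (hψ : IsProx p ψ) {S : Set (Vec n)} (hS : S.Nonempty)
    (hc : IsCompact S) : startPoint ψ S ∈ S :=
  (argminOn_spec hS hc hψ.contDiff.continuous).1

/-- The three-point identity. -/
lemma bregman_three_point (ψ : Vec n → ℝ) (u x y : Vec n) :
    inner ℝ (gradient ψ y - gradient ψ x) (u - y) =
      bregman ψ u x - bregman ψ u y - bregman ψ y x := by
  simp only [bregman, inner_sub_left, inner_sub_right]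
  ring

variable {S : Set (Vec n)}

/-- The dual point is a gradient `∇ψ(y)`, and `∇ψ*` recovers `y`. What remains is first-order
optimality of the Bregman projection along segments of `S`. In this form neither `y` nor the
conjugate is needed again. -/
lemma IsProx.mirrorStep_spec (hψ : IsProx p ψ) (hp : 1 ≤ p) (hp2 : p ≤ 2) (hS : S.Nonempty)
    (hc : IsCompact S) (hconv : Convex ℝ S) (μ : ℝ) (x g : Vec n) :
    mirrorStep ψ S μ x g ∈ S ∧ ∀ u ∈ S,
      0 ≤ inner ℝ (gradient ψ (mirrorStep ψ S μ x g) - (gradient ψ x - μ • g))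
        (u - mirrorStep ψ S μ x g) := by
  obtain ⟨y, hy⟩ := hψ.exists_gradient_eq hp hp2 (gradient ψ x - μ • g)
  have hstep : mirrorStep ψ S μ x g = argminOn (fun v => bregman ψ v y) S := by
    rw [mirrorStep, ← hy, hψ.gradient_fenchelConj hp hp2]
  have hcont : Continuous fun v => bregman ψ v y :=
    hψ.continuous_bregman.comp (Continuous.prodMk_left y)
  obtain ⟨ha, hmin⟩ := argminOn_spec hS hc hcont
  rw [← hstep] at ha hmin
  set a := mirrorStep ψ S μ x g
  refine ⟨ha, fun u hu => ?_⟩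
  rw [← hy]
  have hd1 := (hψ.hasGradientAt a).hasDerivAt_line (u - a)
  have := (hd1.neg).le_of_forall_slope_le (b := fun _ => - inner ℝ (gradient ψ y) (u - a))
    (by fun_prop) (by
      intro s hs
      have hmem : a + s • (u - a) ∈ S := hconv.add_smul_sub_mem ha hu ⟨hs.1.le, hs.2.le⟩
      have h1 : bregman ψ a y ≤ bregman ψ (a + s • (u - a)) y := hmin hmem
      have e : a + s • (u - a) - y = (a - y) + s • (u - a) := by abel
      unfold bregman at h1
      rw [e, inner_add_right, inner_smul_right] at h1
      simp only [Pi.neg_apply, zero_smul, add_zero]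
      linarith)
  rw [inner_sub_left]
  linarith

/-- Adding the Bregman lower bounds for `(a, b)` and `(b, a)` cancels the values of `ψ`. -/
lemma IsProx.norm_sq_le_inner_gradient (hψ : IsProx p ψ) (hp : 1 ≤ p) (hp2 : p ≤ 2)
    (a b : Vec n) : ‖a - b‖ ^ 2 ≤ inner ℝ (gradient ψ a - gradient ψ b) (a - b) := by
  have h1 := hψ.half_norm_sq_le_bregman hp hp2 a b
  have h2 := hψ.half_norm_sq_le_bregman hp hp2 b a
  rw [norm_sub_rev] at h1
  unfold bregman at h1 h2
  simp only [inner_sub_left, inner_sub_right] at *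
  linarith

/-- The mirror step is a nonexpansive function of the dual point. -/
lemma IsProx.norm_mirrorStep_sub_le (hψ : IsProx p ψ) (hp : 1 ≤ p) (hp2 : p ≤ 2)
    (hS : S.Nonempty) (hc : IsCompact S) (hconv : Convex ℝ S) (μ : ℝ) (x g x' g' : Vec n) :
    ‖mirrorStep ψ S μ x g - mirrorStep ψ S μ x' g'‖ ≤
      ‖(gradient ψ x - μ • g) - (gradient ψ x' - μ • g')‖ := by
  obtain ⟨ha, hav⟩ := hψ.mirrorStep_spec hp hp2 hS hc hconv μ x g
  obtain ⟨hb, hbv⟩ := hψ.mirrorStep_spec hp hp2 hS hc hconv μ x' g'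
  set a := mirrorStep ψ S μ x g
  set b := mirrorStep ψ S μ x' g'
  set ζ := gradient ψ x - μ • g
  set ζ' := gradient ψ x' - μ • g'
  have h1 := hav b hb
  have h2 := hbv a ha
  have h3 := hψ.norm_sq_le_inner_gradient hp hp2 a b
  have h4 := real_inner_le_norm (ζ - ζ') (a - b)
  have h5 : ‖a - b‖ * ‖a - b‖ ≤ ‖ζ - ζ'‖ * ‖a - b‖ := by
    simp only [inner_sub_left, inner_sub_right] at *
    nlinarith
  by_contra! hlt
  nlinarith [norm_nonneg (ζ - ζ'), norm_nonneg (a - b)]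

/-- The step is defined by choosing a minimiser. Its continuity is what makes the iterates
measurable functions of the path. -/
lemma IsProx.continuous_mirrorStep (hψ : IsProx p ψ) (hp : 1 ≤ p) (hp2 : p ≤ 2)
    (hS : S.Nonempty) (hc : IsCompact S) (hconv : Convex ℝ S) (μ : ℝ) :
    Continuous fun a : Vec n × Vec n => mirrorStep ψ S μ a.1 a.2 := by
  have hζ : Continuous fun a : Vec n × Vec n => gradient ψ a.1 - μ • a.2 := by
    have := hψ.continuous_gradient
    fun_prop
  rw [continuous_iff_continuousAt]
  intro a
  rw [ContinuousAt, tendsto_iff_norm_sub_tendsto_zero]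
  refine squeeze_zero (fun _ => norm_nonneg _)
    (fun b => hψ.norm_mirrorStep_sub_le hp hp2 hS hc hconv μ b.1 b.2 a.1 a.2) ?_
  exact tendsto_iff_norm_sub_tendsto_zero.1 (hζ.tendsto a)

/-- For the degenerate case `R₁ = 0`, in which the prescribed stepsize is `0`. -/
lemma IsProx.mirrorStep_zero (hψ : IsProx p ψ) (hp : 1 ≤ p) (hp2 : p ≤ 2)
    (hS : S.Nonempty) (hc : IsCompact S) (hconv : Convex ℝ S) {x : Vec n} (hx : x ∈ S)
    (g : Vec n) : mirrorStep ψ S 0 x g = x := by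
  obtain ⟨-, hav⟩ := hψ.mirrorStep_spec hp hp2 hS hc hconv 0 x g
  set a := mirrorStep ψ S 0 x g
  have h1 := hav x hx
  have h3 := hψ.norm_sq_le_inner_gradient hp hp2 a x
  rw [zero_smul, sub_zero, ← neg_sub a x, inner_neg_right] at h1
  have : ‖a - x‖ ^ 2 = 0 := le_antisymm (by linarith) (by positivity)
  exact sub_eq_zero.1 (norm_eq_zero.1 (pow_eq_zero_iff (by norm_num) |>.1 this))

/-- One step of mirror descent. -/
lemma IsProx.inner_le_of_mirrorStep (hψ : IsProx p ψ) {q : ℝ≥0∞} (hpq : p.HolderConjugate q)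
    (hp : 1 ≤ p) (hp2 : p ≤ 2) (hS : S.Nonempty) (hc : IsCompact S) (hconv : Convex ℝ S)
    {μ : ℝ} (hμ : 0 ≤ μ) (x g : Vec n) {u : Vec n} (hu : u ∈ S) :
    μ * inner ℝ g (x - u) ≤ bregman ψ u x - bregman ψ u (mirrorStep ψ S μ x g)
      + μ ^ 2 / 2 * lpNormVec q g ^ 2 := by
  obtain ⟨-, hav⟩ := hψ.mirrorStep_spec hp hp2 hS hc hconv μ x g
  set a := mirrorStep ψ S μ x g
  have h1 := hav u hu
  have h2 := bregman_three_point ψ u x a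
  have h3 := hψ.half_sq_le_bregman a x
  have h4 := inner_le_lpNormVec_mul_lpNormVec hpq (x - a) g
  have h5 : inner ℝ g (x - a) ≤ lpNormVec p (x - a) * lpNormVec q g := by
    rwa [real_inner_comm]
  have e1 : gradient ψ a - (gradient ψ x - μ • g) = (gradient ψ a - gradient ψ x) + μ • g := by
    abel
  rw [e1, inner_add_left, real_inner_smul_left, h2] at h1
  have e2 : inner ℝ g (x - u) = inner ℝ g (x - a) - inner ℝ g (u - a) := by
    rw [← inner_sub_right]; congr 1; abel
  rw [e2]
  -- Young's inequality for `μ ‖x - a‖_p ‖g‖_q`; the square of `‖x - a‖_p` is absorbed by the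
  -- divergence of `a` from `x`.
  nlinarith [sq_nonneg (lpNormVec p (x - a) - μ * lpNormVec q g),
    mul_le_mul_of_nonneg_left h5 hμ]

/-- A real supremum bounds its members only if the set is bounded above. Here this follows from
continuity of the divergence on the compact set `S × S`. -/
lemma IsProx.sqrt_bregman_le_proxDiam (hψ : IsProx p ψ) (hc : IsCompact S) {x y : Vec n}
    (hx : x ∈ S) (hy : y ∈ S) : √(2 * bregman ψ x y) ≤ proxDiam ψ S := by
  refine le_csSup ?_ ⟨x, hx, y, hy, rfl⟩
  have hcont : Continuous fun a : Vec n × Vec n => √(2 * bregman ψ a.1 a.2) :=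
    (hψ.continuous_bregman.const_mul 2 |>.congr fun _ => rfl).sqrt
  obtain ⟨C, hC⟩ := (hc.prod hc).bddAbove_image hcont.continuousOn
  refine ⟨C, ?_⟩
  rintro _ ⟨x, hx, y, hy, rfl⟩
  exact hC ⟨(x, y), ⟨hx, hy⟩, rfl⟩

lemma IsProx.lpNormVec_sub_le_proxDiam (hψ : IsProx p ψ) (hc : IsCompact S)
    {x y : Vec n} (hx : x ∈ S) (hy : y ∈ S) : lpNormVec p (x - y) ≤ proxDiam ψ S := by
  refine le_trans ?_ (hψ.sqrt_bregman_le_proxDiam hc hy hx)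
  refine Real.le_sqrt_of_sq_le ?_
  linarith [hψ.half_sq_le_bregman y x]

lemma proxDist_nonneg (ψ : Vec n → ℝ) (S : Set (Vec n)) (u : Vec n) : 0 ≤ proxDist ψ S u :=
  Real.sqrt_nonneg _

lemma IsProx.proxDist_sq (hψ : IsProx p ψ) (u : Vec n) :
    proxDist ψ S u ^ 2 = 2 * bregman ψ u (startPoint ψ S) :=
  Real.sq_sqrt (mul_nonneg (by norm_num) (hψ.bregman_nonneg _ _))

lemma IsProx.proxDist_le_proxDiam (hψ : IsProx p ψ) (hS : S.Nonempty) (hc : IsCompact S)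
    {u : Vec n} (hu : u ∈ S) : proxDist ψ S u ≤ proxDiam ψ S :=
  hψ.sqrt_bregman_le_proxDiam hc hu (hψ.startPoint_mem hS hc)

lemma IsProx.startPoint_eq_of_proxDist_eq_zero (hψ : IsProx p ψ) (hp : 1 ≤ p) (hp2 : p ≤ 2)
    {u : Vec n} (h : proxDist ψ S u = 0) : startPoint ψ S = u := by
  have h1 := hψ.proxDist_sq (S := S) u
  have h2 := hψ.half_norm_sq_le_bregman hp hp2 u (startPoint ψ S)
  rw [h] at h1
  have : ‖startPoint ψ S - u‖ ^ 2 = 0 := le_antisymm (by linarith) (by positivity)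
  exact sub_eq_zero.1 (norm_eq_zero.1 (pow_eq_zero_iff (by norm_num) |>.1 this))

end Prox

/-! ### The uniform distribution on the unit sphere -/

section Sphere

variable {n : ℕ}

lemma ae_norm_eq_one_unifSphere (n : ℕ) : ∀ᵐ θ ∂(unifSphere n), ‖θ‖ = 1 := by
  unfold unifSphere
  rw [ae_map_iff measurable_subtype_coe.aemeasurable
    (measurableSet_eq_fun (by fun_prop) (by fun_prop))]
  exact Filter.Eventually.of_forall fun x => by simp

lemma integral_unifSphere (g : Vec n → ℝ) :
    ∫ θ, g θ ∂(unifSphere n) =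
      ((volume : Measure (Vec n)).toSphere.real Set.univ)⁻¹ *
        ∫ θ, g θ ∂(volume : Measure (Vec n)).toSphere := by
  unfold unifSphere
  rw [(MeasurableEmbedding.subtype_coe Metric.isClosed_sphere.measurableSet).integral_map,
    integral_smul_measure, ENNReal.toReal_inv]
  rfl

/-- Both integrals are Gamma values, and the recursion is `Γ(s + 1) = s Γ(s)` at `s = (m + 1)/2`. -/
lemma integral_pow_mul_exp_neg_sq_succ (m : ℕ) :
    ∫ r in Set.Ioi (0 : ℝ), r ^ (m + 2) * Real.exp (-(1 / 2) * r ^ 2) =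
      (m + 1) * ∫ r in Set.Ioi (0 : ℝ), r ^ m * Real.exp (-(1 / 2) * r ^ 2) := by
  have h : ∀ m : ℕ, ∫ r in Set.Ioi (0 : ℝ), r ^ m * Real.exp (-(1 / 2) * r ^ 2) =
      (1 / 2 : ℝ) ^ (-((m : ℝ) + 1) / 2) * (1 / 2) * Real.Gamma (((m : ℝ) + 1) / 2) := by
    intro m
    have := integral_rpow_mul_exp_neg_mul_rpow (p := 2) (q := m) (b := 1 / 2) (by norm_num)
      (by linarith [(Nat.cast_nonneg m : (0 : ℝ) ≤ m)]) (by norm_num)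
    rw [← this]
    simp only [Real.rpow_natCast, Real.rpow_two]
  rw [h, h]
  push_cast
  rw [show ((m : ℝ) + 2 + 1) / 2 = ((m : ℝ) + 1) / 2 + 1 by ring,
    Real.Gamma_add_one (by positivity),
    show -((m : ℝ) + 2 + 1) / 2 = -((m : ℝ) + 1) / 2 + -1 by ring,
    Real.rpow_add (by norm_num), Real.rpow_neg_one]
  ring

/-- The Gaussian moments of a coordinate. -/
lemma integral_coord_pow_mul_exp_neg_sq_succ (i : Fin n) (k : ℕ) :
    ∫ y : Vec n, y i ^ (2 * (k + 1)) * Real.exp (-(1 / 2) * ‖y‖ ^ 2) =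
      (2 * k + 1) * ∫ y : Vec n, y i ^ (2 * k) * Real.exp (-(1 / 2) * ‖y‖ ^ 2) := by
  have h1d : ∀ k : ℕ, ∫ t : ℝ, t ^ (2 * k) * Real.exp (-(1 / 2) * t ^ 2) =
      2 * ∫ t in Set.Ioi (0 : ℝ), t ^ (2 * k) * Real.exp (-(1 / 2) * t ^ 2) := by
    intro k
    rw [← integral_comp_abs (f := fun t => t ^ (2 * k) * Real.exp (-(1 / 2) * t ^ 2))]
    simp only [pow_mul, sq_abs]
  -- The Gaussian weight factors over coordinates, and only the factor at `i` depends on `k`.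
  have hprod : ∀ k : ℕ, ∫ y : Vec n, y i ^ (2 * k) * Real.exp (-(1 / 2) * ‖y‖ ^ 2) =
      (∫ t : ℝ, t ^ (2 * k) * Real.exp (-(1 / 2) * t ^ 2)) *
        ∏ _j ∈ Finset.univ.erase i, ∫ t : ℝ, Real.exp (-(1 / 2) * t ^ 2) := by
    intro k
    rw [← (EuclideanSpace.volume_preserving_symm_measurableEquiv_toLp (Fin n)).symm.integral_comp
      (MeasurableEquiv.measurableEmbedding _)]
    have := integral_fintype_prod_volume_eq_prod (𝕜 := ℝ) (ι := Fin n) (E := fun _ => ℝ)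
      (fun j t => (if j = i then t ^ (2 * k) else 1) * Real.exp (-(1 / 2) * t ^ 2))
    rw [← Finset.mul_prod_erase _ _ (Finset.mem_univ i)] at this
    rw [Finset.prod_congr rfl (g := fun _ => ∫ t : ℝ, Real.exp (-(1 / 2) * t ^ 2))
      (fun j hj => by simp [Finset.ne_of_mem_erase hj])] at this
    simp only [if_true] at this
    rw [← this]
    congr 1
    ext x
    rw [Finset.prod_mul_distrib, ← Real.exp_sum, EuclideanSpace.norm_sq_eq, Finset.mul_sum]
    simp
  rw [hprod, hprod, h1d, h1d, show 2 * (k + 1) = 2 * k + 2 by ring,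
    integral_pow_mul_exp_neg_sq_succ]
  push_cast
  ring

lemma integral_norm_ball_pos :
    0 < ∫ y : Vec n, (Metric.ball (0 : Vec n) 1).indicator (1 : Vec n → ℝ) y := by
  rw [integral_indicator_one Metric.isOpen_ball.measurableSet]
  exact ENNReal.toReal_pos (Metric.measure_ball_pos _ _ one_pos).ne' measure_ball_lt_top.ne

variable [NeZero n]

instance : IsProbabilityMeasure (unifSphere n) := by
  unfold unifSphere
  have : IsProbabilityMeasure (((volume : Measure (Vec n)).toSphere Set.univ)⁻¹ •
      (volume : Measure (Vec n)).toSphere) := by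
    have : NeZero ((volume : Measure (Vec n)).toSphere) := ⟨Measure.toSphere_ne_zero _⟩
    infer_instance
  exact Measure.isProbabilityMeasure_map measurable_subtype_coe.aemeasurable

/-- Integration in polar coordinates, for functions of product form. -/
lemma integral_direction_mul_norm (g : Vec n → ℝ) (h : ℝ → ℝ) :
    ∫ y : Vec n, g (‖y‖⁻¹ • y) * h ‖y‖ =
      (∫ θ, g θ ∂(unifSphere n)) * ∫ y : Vec n, h ‖y‖ := by
  have key : ∀ g : Vec n → ℝ, ∫ y : Vec n, g (‖y‖⁻¹ • y) * h ‖y‖ =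
      (∫ θ, g θ ∂(volume : Measure (Vec n)).toSphere) *
        ∫ r : Set.Ioi (0 : ℝ), h r ∂(Measure.volumeIoiPow (Module.finrank ℝ (Vec n) - 1)) := by
    intro g
    rw [← integral_prod_mul (fun θ : Metric.sphere (0 : Vec n) 1 => g θ)
      (fun r : Set.Ioi (0 : ℝ) => h r)]
    rw [← (volume : Measure (Vec n)).measurePreserving_homeomorphUnitSphereProd.integral_comp
        (Homeomorph.measurableEmbedding _)]
    simp only [homeomorphUnitSphereProd_apply_fst_coe, homeomorphUnitSphereProd_apply_snd_coe]
    rw [integral_subtype_comap (measurableSet_singleton _).compl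
      (fun y : Vec n => g (‖y‖⁻¹ • y) * h ‖y‖), restrict_compl_singleton]
  -- The constant function identifies the radial factor; dividing by the total mass normalises the
  -- surface measure.
  have h1 := key (fun _ => 1)
  simp only [one_mul, integral_const, smul_eq_mul, mul_one] at h1
  have hpos : (volume : Measure (Vec n)).toSphere.real Set.univ ≠ 0 := by
    rw [measureReal_def, ENNReal.toReal_ne_zero]
    exact ⟨by rw [Measure.measure_univ_ne_zero]; exact Measure.toSphere_ne_zero _,
      measure_ne_top _ _⟩
  rw [key, h1, integral_unifSphere]
  field_simp

/-- The uniform distribution on the sphere is invariant under linear isometries. -/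
lemma integral_unifSphere_comp_isometry (L : Vec n ≃ₗᵢ[ℝ] Vec n) (g : Vec n → ℝ) :
    ∫ θ, g (L θ) ∂(unifSphere n) = ∫ θ, g θ ∂(unifSphere n) := by
  -- Any radial weight with nonzero integral would do. In polar coordinates the claim becomes
  -- invariance of Lebesgue measure under isometries.
  set h : ℝ → ℝ := (Set.Iio 1).indicator 1
  have hh : ∫ y : Vec n, h ‖y‖ ≠ 0 := by
    have : ∀ y : Vec n, h ‖y‖ = (Metric.ball (0 : Vec n) 1).indicator 1 y := by
      intro y
      simp [h, Set.indicator]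
    simp only [this]
    exact integral_norm_ball_pos.ne'
  have h1 := integral_direction_mul_norm g h
  have h2 := integral_direction_mul_norm (fun θ => g (L θ)) h
  rw [← L.measurePreserving.integral_comp L.toMeasurableEquiv.measurableEmbedding] at h1
  simp only [L.norm_map, ← L.map_smul] at h1
  exact mul_right_cancel₀ hh (h2.symm.trans h1)

lemma integral_unifSphere_neg (g : Vec n → ℝ) :
    ∫ θ, g (-θ) ∂(unifSphere n) = ∫ θ, g θ ∂(unifSphere n) :=
  integral_unifSphere_comp_isometry (LinearIsometryEquiv.neg ℝ) g

/-! ### Moments of the coordinates on the sphere -/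

lemma integral_pow_mul_exp_neg_sq_pos (m : ℕ) :
    0 < ∫ r in Set.Ioi (0 : ℝ), r ^ m * Real.exp (-(1 / 2) * r ^ 2) := by
  have := integral_rpow_mul_exp_neg_mul_rpow (p := 2) (q := m) (b := 1 / 2) (by norm_num)
      (by linarith [(Nat.cast_nonneg m : (0 : ℝ) ≤ m)]) (by norm_num)
  simp only [Real.rpow_natCast, Real.rpow_two] at this
  rw [this]
  have := Real.Gamma_pos_of_pos (s := ((m : ℝ) + 1) / 2) (by positivity)
  positivity

/-- The radial Gaussian moments. -/
lemma integral_norm_pow_mul_exp_neg_sq_succ (m : ℕ) :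
    ∫ y : Vec n, ‖y‖ ^ (m + 2) * Real.exp (-(1 / 2) * ‖y‖ ^ 2) =
      (n + m) * ∫ y : Vec n, ‖y‖ ^ m * Real.exp (-(1 / 2) * ‖y‖ ^ 2) := by
  rw [integral_fun_norm_addHaar volume (fun r => r ^ (m + 2) * Real.exp (-(1 / 2) * r ^ 2)),
    integral_fun_norm_addHaar volume (fun r => r ^ m * Real.exp (-(1 / 2) * r ^ 2))]
  simp only [finrank_euclideanSpace, Fintype.card_fin, smul_eq_mul, nsmul_eq_mul, ← mul_assoc,
    ← pow_add]
  have := integral_pow_mul_exp_neg_sq_succ (n - 1 + m)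
  rw [add_assoc] at this
  rw [this]
  have hn : ((n - 1 + m : ℕ) : ℝ) + 1 = n + m := by
    have : 1 ≤ n := NeZero.one_le
    push_cast [this]
    ring
  rw [hn]
  ring

lemma integral_norm_pow_mul_exp_neg_sq_pos (m : ℕ) :
    0 < ∫ y : Vec n, ‖y‖ ^ m * Real.exp (-(1 / 2) * ‖y‖ ^ 2) := by
  rw [integral_fun_norm_addHaar volume (fun r => r ^ m * Real.exp (-(1 / 2) * r ^ 2))]
  simp only [finrank_euclideanSpace, Fintype.card_fin, smul_eq_mul, nsmul_eq_mul, ← mul_assoc,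
    ← pow_add]
  have h1 := integral_pow_mul_exp_neg_sq_pos (n - 1 + m)
  have h2 : 0 < (volume : Measure (Vec n)).real (Metric.ball 0 1) :=
    ENNReal.toReal_pos (Metric.measure_ball_pos _ _ one_pos).ne' measure_ball_lt_top.ne
  have h3 : (0 : ℝ) < n := by exact_mod_cast NeZero.pos n
  positivity

/-- Even moments of a coordinate on the sphere. -/
lemma integral_coord_pow_unifSphere_le (i : Fin n) (k : ℕ) :
    ∫ θ, θ i ^ (2 * k) ∂(unifSphere n) ≤ ((2 * k - 1 : ℝ) / n) ^ k := by
  have hn : (0 : ℝ) < n := by exact_mod_cast NeZero.pos n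
  -- The Gaussian moment of a coordinate is its sphere moment times a radial moment. The recursions
  -- of the two Gaussian quantities, with factors `2k + 1` and `n + 2k`, give one for the sphere.
  have hpol : ∀ k : ℕ, (∫ θ, θ i ^ (2 * k) ∂(unifSphere n)) *
      (∫ y : Vec n, ‖y‖ ^ (2 * k) * Real.exp (-(1 / 2) * ‖y‖ ^ 2)) =
        ∫ y : Vec n, y i ^ (2 * k) * Real.exp (-(1 / 2) * ‖y‖ ^ 2) := by
    intro k
    rw [← integral_direction_mul_norm (fun θ => θ i ^ (2 * k))
      (fun r => r ^ (2 * k) * Real.exp (-(1 / 2) * r ^ 2))]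
    refine integral_congr_ae (Filter.Eventually.of_forall fun y => ?_)
    by_cases hy : y = 0
    · rcases Nat.eq_zero_or_pos k with rfl | hk
      · simp
      · simp [hy, hk.ne']
    · have : ‖y‖ ≠ 0 := norm_ne_zero_iff.2 hy
      simp only [PiLp.smul_apply, smul_eq_mul, mul_pow, inv_pow]
      field_simp
  have hnn : ∀ k : ℕ, 0 ≤ ∫ θ, θ i ^ (2 * k) ∂(unifSphere n) := fun k =>
    integral_nonneg fun θ => by simp only [pow_mul]; positivity
  have hrec : ∀ k : ℕ, ∫ θ, θ i ^ (2 * (k + 1)) ∂(unifSphere n) ≤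
      ((2 * k + 1 : ℝ) / n) * ∫ θ, θ i ^ (2 * k) ∂(unifSphere n) := by
    intro k
    have h1 := hpol (k + 1)
    rw [integral_coord_pow_mul_exp_neg_sq_succ, ← hpol k, show 2 * (k + 1) = 2 * k + 2 by ring,
      integral_norm_pow_mul_exp_neg_sq_succ, ← mul_assoc, ← mul_assoc] at h1
    have h2 := mul_right_cancel₀ (integral_norm_pow_mul_exp_neg_sq_pos (2 * k)).ne' h1
    rw [show 2 * (k + 1) = 2 * k + 2 by ring, div_mul_eq_mul_div, le_div_iff₀ hn, ← h2]
    have := hnn (k + 1)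
    rw [show 2 * (k + 1) = 2 * k + 2 by ring] at this
    gcongr
    simp
  -- With `k` fixed and `j` running up to `k`, every factor `(2j + 1)/n` of the product is at most
  -- `(2k - 1)/n`.
  have hbound : ∀ j k : ℕ, j ≤ k →
      ∫ θ, θ i ^ (2 * j) ∂(unifSphere n) ≤ ((2 * k - 1 : ℝ) / n) ^ j := by
    intro j k hjk
    induction j with
    | zero => simp
    | succ j ih =>
      have hjk' : (j : ℝ) + 1 ≤ k := by exact_mod_cast hjk
      have h0 : (0 : ℝ) ≤ (2 * j + 1) / n := by positivity
      calc _ ≤ ((2 * j + 1 : ℝ) / n) * ∫ θ, θ i ^ (2 * j) ∂(unifSphere n) := hrec j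
        _ ≤ ((2 * k - 1 : ℝ) / n) * ((2 * k - 1 : ℝ) / n) ^ j := by
          refine mul_le_mul ?_ (ih (by omega)) (hnn j) ?_
          · gcongr; linarith
          · exact h0.trans (by gcongr; linarith)
        _ = _ := by ring
  exact hbound k k le_rfl

lemma integrable_unifSphere_of_continuous {g : Vec n → ℝ} (hg : Continuous g) :
    Integrable g (unifSphere n) := by
  obtain ⟨C, hC⟩ := (isCompact_sphere (0 : Vec n) 1).exists_bound_of_continuousOn hg.continuousOn
  refine Integrable.of_bound hg.aestronglyMeasurable C ?_
  filter_upwards [ae_norm_eq_one_unifSphere n] with θ hθ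
  exact hC θ (by simpa using hθ)

/-- A reflection carries `v` to `‖v‖` times a coordinate vector, so by invariance this is the second
moment of one coordinate. -/
lemma integral_inner_sq_unifSphere_le (v : Vec n) :
    ∫ θ, (inner ℝ θ v) ^ 2 ∂(unifSphere n) ≤ ‖v‖ ^ 2 / n := by
  set i : Fin n := 0
  set w : Vec n := ‖v‖ • EuclideanSpace.single i (1 : ℝ)
  have hw : ‖v‖ = ‖w‖ := by simp [w, norm_smul]
  set L := (ℝ ∙ (v - w))ᗮ.reflection
  have hL : L v = w := Submodule.reflection_sub hw
  rw [← integral_unifSphere_comp_isometry L.symm]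
  have : ∀ θ : Vec n, (inner ℝ (L.symm θ) v) ^ 2 = ‖v‖ ^ 2 * θ i ^ (2 * 1) := by
    intro θ
    have h1 : inner ℝ (L.symm θ) v = inner ℝ θ (L v) := by
      rw [← L.inner_map_map, L.apply_symm_apply]
    rw [h1, hL]
    simp [w, inner_smul_right, EuclideanSpace.inner_single_right, mul_pow]
  simp only [this]
  rw [integral_const_mul]
  have := integral_coord_pow_unifSphere_le i 1
  norm_num at this
  rw [div_eq_mul_inv]
  gcongr

lemma integral_abs_inner_unifSphere_le (v : Vec n) :
    ∫ θ, |inner ℝ θ v| ∂(unifSphere n) ≤ ‖v‖ / √n := by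
  have hn : (0 : ℝ) < n := by exact_mod_cast NeZero.pos n
  have h1 : (∫ θ, |inner ℝ θ v| ∂(unifSphere n)) ^ 2 ≤
      ∫ θ, |inner ℝ θ v| ^ 2 ∂(unifSphere n) := by
    refine (convexOn_pow 2).map_integral_le (continuous_pow 2).continuousOn isClosed_Ici
      (Filter.Eventually.of_forall fun θ => Set.mem_Ici.2 (abs_nonneg _)) ?_ ?_
    · exact integrable_unifSphere_of_continuous (by fun_prop)
    · exact integrable_unifSphere_of_continuous (by simp only [Function.comp_def]; fun_prop)
  simp only [sq_abs] at h1
  have h2 := h1.trans (integral_inner_sq_unifSphere_le v)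
  refine abs_le_of_sq_le_sq' ?_ (by positivity) |>.2
  rw [div_pow, Real.sq_sqrt hn.le]
  exact h2

end Sphere

/-! ### Moments of the `ℓ_q`-norm on the sphere -/

section SphereNorm

variable {n : ℕ}

/-- Since `s ≤ 2 ≤ 2k`, the power `s/(2k)` is concave. Jensen's inequality then moves the
expectation onto `∑ θ_i^(2k)`, whose mean is at most `n ((2k-1)/n)^k`. -/
lemma lpNormVec_moment_le [NeZero n] {q : ℝ≥0∞} (hq : 1 ≤ q) {s : ℝ} (hs0 : 0 < s) (hs2 : s ≤ 2)
    {k : ℕ} (hk : 1 ≤ k) {C a : ℝ} (hC : 0 ≤ C)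
    (hle : ∀ x : Vec n, lpNormVec q x ≤ C * (∑ i, x i ^ (2 * k)) ^ (1 / (2 * k : ℝ)))
    (ha : C * ((n : ℝ) ^ (1 / (2 * k : ℝ)) * √((2 * k - 1) / n)) ≤ a) :
    ∫ θ, lpNormVec q θ ^ s ∂(unifSphere n) ≤ a ^ s := by
  have hn : (0 : ℝ) < n := by exact_mod_cast NeZero.pos n
  have hk1 : (1 : ℝ) ≤ k := by exact_mod_cast hk
  have hS : ∀ x : Vec n, 0 ≤ ∑ i, x i ^ (2 * k) := fun x =>
    Finset.sum_nonneg fun i _ => by rw [pow_mul]; positivity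
  have hcS : Continuous fun x : Vec n => ∑ i, x i ^ (2 * k) := by fun_prop
  have hr0 : 0 < s / (2 * k) := by positivity
  have hr1 : s / (2 * k) ≤ 1 := by
    rw [div_le_one (by positivity)]
    linarith
  have hint : Integrable (fun θ : Vec n => ∑ i, θ i ^ (2 * k)) (unifSphere n) :=
    integrable_unifSphere_of_continuous hcS
  have hcr : Continuous fun θ : Vec n => (∑ i, θ i ^ (2 * k)) ^ (s / (2 * k)) :=
    hcS.rpow_const fun _ => Or.inr hr0.le
  have hjensen : ∫ θ : Vec n, (∑ i, θ i ^ (2 * k)) ^ (s / (2 * k)) ∂(unifSphere n) ≤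
      (∫ θ : Vec n, ∑ i, θ i ^ (2 * k) ∂(unifSphere n)) ^ (s / (2 * k)) :=
    (Real.concaveOn_rpow hr0.le hr1).le_map_integral
      (Real.continuous_rpow_const hr0.le).continuousOn isClosed_Ici
      (Filter.Eventually.of_forall fun θ => Set.mem_Ici.2 (hS θ)) hint
      (integrable_unifSphere_of_continuous hcr)
  have hmean : ∫ θ : Vec n, ∑ i, θ i ^ (2 * k) ∂(unifSphere n) ≤ n * ((2 * k - 1) / n) ^ k := by
    rw [integral_finsetSum _ fun i _ => integrable_unifSphere_of_continuous (by fun_prop)]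
    calc _ ≤ ∑ _i : Fin n, ((2 * k - 1 : ℝ) / n) ^ k :=
          Finset.sum_le_sum fun i _ => integral_coord_pow_unifSphere_le i k
      _ = _ := by simp
  have hq0 : (0 : ℝ) ≤ (2 * k - 1) / n := div_nonneg (by linarith) hn.le
  have hval : (n * ((2 * k - 1 : ℝ) / n) ^ k) ^ (s / (2 * k)) =
      ((n : ℝ) ^ (1 / (2 * k : ℝ)) * √((2 * k - 1) / n)) ^ s := by
    have hk0 : (k : ℝ) ≠ 0 := by positivity
    rw [Real.mul_rpow hn.le (by positivity), Real.mul_rpow (by positivity) (by positivity),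
      Real.sqrt_eq_rpow, ← Real.rpow_mul hn.le, ← Real.rpow_mul hq0, ← Real.rpow_natCast,
      ← Real.rpow_mul hq0]
    congr 2 <;> field_simp
  calc ∫ θ, lpNormVec q θ ^ s ∂(unifSphere n)
      ≤ ∫ θ : Vec n, C ^ s * (∑ i, θ i ^ (2 * k)) ^ (s / (2 * k)) ∂(unifSphere n) := by
        refine integral_mono (integrable_unifSphere_of_continuous ?_)
          (integrable_unifSphere_of_continuous (continuous_const.mul hcr)) fun θ => ?_
        · exact (continuous_lpNormVec hq).rpow_const fun _ => Or.inr hs0.le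
        · have := Real.rpow_le_rpow (lpNormVec_nonneg hq θ) (hle θ) hs0.le
          rwa [Real.mul_rpow hC (Real.rpow_nonneg (hS θ) _), ← Real.rpow_mul (hS θ),
            one_div_mul_eq_div] at this
    _ = C ^ s * ∫ θ : Vec n, (∑ i, θ i ^ (2 * k)) ^ (s / (2 * k)) ∂(unifSphere n) :=
        integral_const_mul _ _
    _ ≤ C ^ s * (n * ((2 * k - 1) / n) ^ k) ^ (s / (2 * k)) := by
        gcongr
        refine hjensen.trans ?_
        gcongr
        exact integral_nonneg fun θ => hS θ
    _ = (C * ((n : ℝ) ^ (1 / (2 * k : ℝ)) * √((2 * k - 1) / n))) ^ s := by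
        rw [hval, Real.mul_rpow hC (by positivity)]
    _ ≤ a ^ s := by gcongr

lemma log_two_le_log {n : ℕ} (hn : 2 ≤ n) : 0.69 < Real.log n := by
  have h1 : Real.log 2 ≤ Real.log n := Real.log_le_log (by norm_num) (by exact_mod_cast hn)
  linarith [Real.log_two_gt_d9]

lemma aConst_pos (hn : 2 ≤ n) {q : ℝ≥0∞} (hq : 2 ≤ q) : 0 < aConst n q := by
  have h := log_two_le_log hn
  have hn0 : (0 : ℝ) < n := by positivity
  have h1 : 0 < √(32 * Real.log n - 8) := Real.sqrt_pos.2 (by linarith)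
  unfold aConst
  refine mul_pos (by positivity) ?_
  split_ifs with hqt
  · exact h1
  · have hq2 : 2 ≤ q.toReal := by
      simpa using (ENNReal.toReal_le_toReal (by simp) hqt).2 hq
    exact lt_min h1 (Real.sqrt_pos.2 (by linarith))

/-- The moments of the dual norm on the Euclidean sphere. -/
lemma lpNormVec_moment_le_aConst (hn : 2 ≤ n) {q : ℝ≥0∞} (hq : 2 ≤ q) {s : ℝ} (hs0 : 0 < s)
    (hs2 : s ≤ 2) : ∫ θ, lpNormVec q θ ^ s ∂(unifSphere n) ≤ aConst n q ^ s := by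
  have : NeZero n := ⟨by omega⟩
  have hn0 : (0 : ℝ) < n := by positivity
  have hlog := log_two_le_log hn
  have hq1 : 1 ≤ q := le_trans (by norm_num) hq
  have hsq : ∀ x y : ℝ, (n : ℝ) ^ (x - 1 / 2) * √y = (n : ℝ) ^ x * √(y / n) := by
    intro x y
    rw [Real.sqrt_div' _ hn0.le, Real.rpow_sub hn0, ← Real.sqrt_eq_rpow]
    ring
  have hA : ∫ θ, lpNormVec q θ ^ s ∂(unifSphere n) ≤
      ((n : ℝ) ^ ((q⁻¹).toReal - 1 / 2) * √(32 * Real.log n - 8)) ^ s := by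
    -- This choice makes `n^(1/(2k)) ≤ √e`, and `e(2k - 1) ≤ e(2 ln n + 1) ≤ 32 ln n - 8` for `n ≥
    -- 2`.
    set k := ⌈Real.log n⌉₊
    have hk : 1 ≤ k := Nat.one_le_iff_ne_zero.2 (Nat.ceil_pos.2 (by linarith)).ne'
    have hk1 : (1 : ℝ) ≤ k := by exact_mod_cast hk
    have hk2 : Real.log n ≤ k := Nat.le_ceil _
    have hk3 : (k : ℝ) < Real.log n + 1 := Nat.ceil_lt_add_one (by linarith)
    refine lpNormVec_moment_le hq1 hs0 hs2 hk (by positivity)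
      (fun x => lpNormVec_le_rpow_inv_mul hq1 hk x) ?_
    rw [hsq]
    gcongr
    have h1 : (n : ℝ) ^ (1 / (2 * k : ℝ)) ≤ √(Real.exp 1) := by
      rw [Real.rpow_def_of_pos hn0, ← Real.exp_half]
      gcongr
      rw [mul_one_div, div_le_div_iff₀ (by positivity) (by norm_num)]
      linarith
    calc (n : ℝ) ^ (1 / (2 * k : ℝ)) * √((2 * k - 1) / n)
        ≤ √(Real.exp 1) * √((2 * k - 1) / n) := by gcongr
      _ = √(Real.exp 1 * ((2 * k - 1) / n)) := by rw [Real.sqrt_mul (by positivity)]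
      _ ≤ _ := by
        refine Real.sqrt_le_sqrt ?_
        rw [← mul_div_assoc]
        gcongr
        nlinarith [Real.exp_one_lt_d9, Real.exp_pos 1]
  by_cases hqt : q = ∞
  · simpa [aConst, hqt] using hA
  have hq2 : 2 ≤ q.toReal := by
    simpa using (ENNReal.toReal_le_toReal (by simp) hqt).2 hq
  have hB : ∫ θ, lpNormVec q θ ^ s ∂(unifSphere n) ≤
      ((n : ℝ) ^ ((q⁻¹).toReal - 1 / 2) * √(2 * q.toReal - 1)) ^ s := by
    -- The smallest `k` with `q ≤ 2k`. Then `2k - 1 < q + 1 ≤ 2q - 1` because `q ≥ 2`.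
    set k := ⌈q.toReal / 2⌉₊
    have hk : 1 ≤ k := Nat.one_le_iff_ne_zero.2 (Nat.ceil_pos.2 (by linarith)).ne'
    have hk2 : q.toReal / 2 ≤ k := Nat.le_ceil _
    have hk3 : (k : ℝ) < q.toReal / 2 + 1 := Nat.ceil_lt_add_one (by linarith)
    refine lpNormVec_moment_le hq1 hs0 hs2 hk (by positivity)
      (fun x => lpNormVec_le_of_le_two_mul hq1 hqt (by linarith) x) ?_
    rw [hsq, ← mul_assoc, ← Real.rpow_add hn0, sub_add_cancel, ENNReal.toReal_inv, one_div]
    gcongr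
    linarith
  rw [aConst, if_neg hqt]
  rcases min_choice (√(32 * Real.log n - 8)) (√(2 * q.toReal - 1)) with h | h <;> rw [h]
  · exact hA
  · exact hB

end SphereNorm

/-! ### Differentiation under translations of a weight -/

section Surface

open Filter Topology

variable {n : ℕ}

/-- Integration by parts by difference quotients: translation invariance moves the shift from the
weight `η` to `f`, and convexity bounds `(f(y + sd) - f(y))/s` by the full increment. As `s → 0`
only the Lipschitz weight is differentiated, so `f` need not be differentiable. -/
lemma integral_mul_deriv_le_of_convex_along {f η D : Vec n → ℝ} {d : Vec n} {B τ : ℝ} {K : NNReal}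
    (hf : Measurable f) (hB : ∀ y, |f y| ≤ B)
    (hconv : ∀ y, ‖y‖ ≤ τ → ∀ s ∈ Set.Ioo (0 : ℝ) 1,
      f (y + s • d) ≤ (1 - s) * f y + s * f (y + d))
    (hη0 : ∀ y, 0 ≤ η y) (hηL : LipschitzWith K η) (hηs : ∀ y, τ ≤ ‖y‖ → η y = 0)
    (hD : ∀ᵐ y, HasDerivAt (fun s : ℝ => η (y - s • d)) (D y) 0) :
    ∫ y, f y * D y ≤ ∫ y, η y * (f (y + d) - f y) := by
  have hB0 : 0 ≤ B := (abs_nonneg _).trans (hB 0)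
  have hηc : HasCompactSupport η := by
    refine HasCompactSupport.of_support_subset_isCompact (isCompact_closedBall (0 : Vec n) τ) ?_
    intro y hy
    by_contra h
    exact hy (hηs y (by simpa using (le_of_lt (by simpa using h))))
  have hηi : Integrable η := hηL.continuous.integrable_of_hasCompactSupport hηc
  have hmul : ∀ {φ g : Vec n → ℝ}, Measurable φ → (∀ y, |φ y| ≤ B) → Integrable g →
      Integrable fun y => φ y * g y := fun hm hb hg =>
    hg.bdd_mul hm.aestronglyMeasurable (Eventually.of_forall hb)
  have hshift : ∀ v : Vec n, Integrable fun y => η y * f (y + v) := fun v => by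
    simpa only [mul_comm, Function.comp_apply] using
      hmul (hf.comp (measurable_add_const v)) (fun y => hB _) hηi
  have hle : ∀ s ∈ Set.Ioo (0 : ℝ) 1,
      ∫ y, f y * (s⁻¹ * (η (y - s • d) - η y)) ≤ ∫ y, η y * (f (y + d) - f y) := by
    intro s hs
    have h1 : ∫ y, f y * η (y - s • d) = ∫ y, η y * f (y + s • d) := by
      rw [← integral_add_right_eq_self _ (s • d)]
      simp only [add_sub_cancel_right, mul_comm]
    have hi1 : Integrable fun y => f y * η (y - s • d) :=
      hmul hf hB (hηi.comp_sub_right (s • d))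
    have hi2 : Integrable fun y => f y * η y := hmul hf hB hηi
    have h2 : ∫ y, f y * (s⁻¹ * (η (y - s • d) - η y)) =
        s⁻¹ * ∫ y, η y * (f (y + s • d) - f y) := by
      rw [← integral_const_mul]
      have e1 : ∫ y, f y * (s⁻¹ * (η (y - s • d) - η y)) =
          s⁻¹ * ((∫ y, f y * η (y - s • d)) - ∫ y, f y * η y) := by
        rw [← integral_sub hi1 hi2, ← integral_const_mul]
        congr 1
        ext y
        ring
      have e2 : ∫ y, s⁻¹ * (η y * (f (y + s • d) - f y)) =
          s⁻¹ * ((∫ y, η y * f (y + s • d)) - ∫ y, f y * η y) := by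
        rw [integral_const_mul, ← integral_sub (hshift _) hi2]
        congr 2
        ext y
        ring
      rw [e1, e2, h1]
    rw [h2, inv_mul_le_iff₀ hs.1, ← integral_const_mul]
    have hmi : ∀ v, Integrable fun y => η y * (f (y + v) - f y) := fun v => by
      have := (hshift v).sub hi2
      refine this.congr (Eventually.of_forall fun y => ?_)
      simp only [Pi.sub_apply]
      ring
    refine integral_mono (hmi _) ((hmi d).const_mul s) fun y => ?_
    rcases le_or_gt ‖y‖ τ with hy | hy
    · have := hconv y hy s hs
      have h3 := mul_le_mul_of_nonneg_left this (hη0 y)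
      dsimp only
      linarith
    · simp [hηs y hy.le]
  refine le_of_tendsto (f := fun s : ℝ => ∫ y, f y * (s⁻¹ * (η (y - s • d) - η y)))
    (x := 𝓝[>] 0) ?_ (by filter_upwards [Ioo_mem_nhdsGT (zero_lt_one' ℝ)] with s hs using hle s hs)
  -- The quotients of `η` are bounded by `K‖d‖` and supported in a fixed ball.
  refine tendsto_integral_filter_of_dominated_convergence
    ((Metric.closedBall (0 : Vec n) (τ + ‖d‖)).indicator fun _ => B * (K * ‖d‖)) ?_ ?_ ?_ ?_
  · refine Eventually.of_forall fun s => ?_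
    have := hηL.continuous
    exact (hf.mul (Continuous.measurable (by fun_prop))).aestronglyMeasurable
  · filter_upwards [Ioo_mem_nhdsGT (zero_lt_one' ℝ)] with s hs
    refine Eventually.of_forall fun y => ?_
    by_cases hy : y ∈ Metric.closedBall (0 : Vec n) (τ + ‖d‖)
    · rw [Set.indicator_of_mem hy, norm_mul, norm_mul, Real.norm_eq_abs, Real.norm_eq_abs,
        abs_of_pos (inv_pos.2 hs.1)]
      refine mul_le_mul (hB y) ?_ (mul_nonneg (inv_nonneg.2 hs.1.le) (norm_nonneg _)) hB0
      have := hηL.norm_sub_le (y - s • d) y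
      rw [sub_sub_cancel_left, norm_neg, norm_smul, Real.norm_of_nonneg hs.1.le] at this
      rw [inv_mul_le_iff₀ hs.1]
      linarith
    · have hy' : τ + ‖d‖ < ‖y‖ := by simpa using hy
      have h1 : η y = 0 := hηs y (by linarith [norm_nonneg d])
      have h2 : η (y - s • d) = 0 := by
        refine hηs _ ?_
        have h3 := norm_sub_norm_le y (s • d)
        rw [norm_smul, Real.norm_of_nonneg hs.1.le] at h3
        nlinarith [norm_nonneg d, hs.2]
      rw [Set.indicator_of_notMem hy, h1, h2]
      simp
  · exact (integrable_indicator_iff measurableSet_closedBall).2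
      (integrableOn_const measure_closedBall_lt_top.ne)
  · filter_upwards [hD] with y hy
    have := hy.tendsto_slope_zero_right
    simp only [zero_add, zero_smul, sub_zero, smul_eq_mul] at this
    exact this.const_mul _

/-- A Lipschitz approximation of the indicator of a ball. -/
def ballCutoff (τ ε : ℝ) (y : Vec n) : ℝ := max 0 (min 1 ((τ - ‖y‖) / ε))

lemma ballCutoff_nonneg (τ ε : ℝ) (y : Vec n) : 0 ≤ ballCutoff τ ε y := le_max_left _ _

lemma ballCutoff_le_one (τ ε : ℝ) (y : Vec n) : ballCutoff τ ε y ≤ 1 :=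
  max_le zero_le_one (min_le_left _ _)

lemma ballCutoff_eq_zero {τ ε : ℝ} (hε : 0 < ε) {y : Vec n} (hy : τ ≤ ‖y‖) :
    ballCutoff τ ε y = 0 := by
  refine max_eq_left ((min_le_right _ _).trans ?_)
  exact div_nonpos_of_nonpos_of_nonneg (by linarith) hε.le

lemma ballCutoff_eq_one {τ ε : ℝ} (hε : 0 < ε) {y : Vec n} (hy : ‖y‖ ≤ τ - ε) :
    ballCutoff τ ε y = 1 := by
  have : 1 ≤ (τ - ‖y‖) / ε := by rw [le_div_iff₀ hε]; linarith
  rw [ballCutoff, min_eq_left this, max_eq_right zero_le_one]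

lemma ballCutoff_eq_div {τ ε : ℝ} (hε : 0 < ε) {y : Vec n} (hy : ‖y‖ ≤ τ) (hy' : τ - ε ≤ ‖y‖) :
    ballCutoff τ ε y = (τ - ‖y‖) / ε := by
  have h1 : (τ - ‖y‖) / ε ≤ 1 := by rw [div_le_one hε]; linarith
  rw [ballCutoff, min_eq_right h1, max_eq_right (div_nonneg (by linarith) hε.le)]

lemma lipschitzWith_ballCutoff {τ ε : ℝ} (hε : 0 < ε) :
    LipschitzWith (Real.toNNReal ε⁻¹) (ballCutoff τ ε : Vec n → ℝ) := by
  have h : LipschitzWith (Real.toNNReal ε⁻¹) fun y : Vec n => (τ - ‖y‖) / ε := by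
    refine LipschitzWith.of_dist_le' fun x y => ?_
    rw [Real.dist_eq, ← sub_div, abs_div, abs_of_pos hε, div_eq_inv_mul, dist_eq_norm]
    gcongr
    rw [sub_sub_sub_cancel_left, norm_sub_rev]
    exact abs_norm_sub_norm_le _ _
  have := (h.const_min 1).const_max 0
  exact this

lemma integrable_ballCutoff {τ ε : ℝ} (hε : 0 < ε) :
    Integrable (ballCutoff τ ε : Vec n → ℝ) := by
  refine (lipschitzWith_ballCutoff hε).continuous.integrable_of_hasCompactSupport ?_
  refine HasCompactSupport.of_support_subset_isCompact (isCompact_closedBall (0 : Vec n) τ) ?_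
  intro y hy
  by_contra h
  exact hy (ballCutoff_eq_zero hε (by simpa using (le_of_lt (by simpa using h))))

lemma hasDerivAt_norm_sub_smul {y : Vec n} (hy : y ≠ 0) (d : Vec n) :
    HasDerivAt (fun s : ℝ => ‖y - s • d‖) (-(inner ℝ y d / ‖y‖)) 0 := by
  have h1 : HasDerivAt (fun s : ℝ => y - s • d) (-d) 0 := by
    simpa using ((hasDerivAt_id (0 : ℝ)).smul_const d).const_sub y
  have h2 := h1.norm_sq.sqrt (by simpa using hy)
  simp only [Real.sqrt_sq (norm_nonneg _), zero_smul, sub_zero, inner_neg_right] at h2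
  convert h2 using 1
  have : ‖y‖ ≠ 0 := norm_ne_zero_iff.2 hy
  field_simp

/-- Off two spheres, which are null sets, the cutoff is locally `1`, affine in the norm, or `0`. The
derivative lives on a shell of width `ε` and tends to surface measure. -/
lemma hasDerivAt_ballCutoff {τ ε : ℝ} (hε : 0 < ε) (hετ : ε < τ) {y : Vec n} (hy1 : ‖y‖ ≠ τ)
    (hy2 : ‖y‖ ≠ τ - ε) (d : Vec n) :
    HasDerivAt (fun s : ℝ => ballCutoff τ ε (y - s • d))
      ((Set.Ioo (τ - ε) τ).indicator 1 ‖y‖ * (inner ℝ y d / ‖y‖ / ε)) 0 := by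
  have hc : Tendsto (fun s : ℝ => ‖y - s • d‖) (𝓝 0) (𝓝 ‖y‖) := by
    have : Continuous fun s : ℝ => ‖y - s • d‖ := by fun_prop
    simpa using this.tendsto 0
  rcases lt_or_gt_of_ne hy1 with h1 | h1
  · rcases lt_or_gt_of_ne hy2 with h2 | h2
    · rw [Set.indicator_of_notMem (by simp [h2.le]), zero_mul]
      refine (hasDerivAt_const (0 : ℝ) (1 : ℝ)).congr_of_eventuallyEq ?_
      filter_upwards [hc.eventually_lt_const h2] with s hs
      exact ballCutoff_eq_one hε hs.le
    · rw [Set.indicator_of_mem (by exact ⟨h2, h1⟩), Pi.one_apply, one_mul]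
      have hy0 : y ≠ 0 := by
        rintro rfl
        rw [norm_zero] at h2
        linarith
      have h3 := ((hasDerivAt_norm_sub_smul hy0 d).const_sub τ).div_const ε
      rw [neg_neg] at h3
      refine h3.congr_of_eventuallyEq ?_
      filter_upwards [hc.eventually_lt_const h1, hc.eventually_const_lt h2] with s hs hs'
      exact ballCutoff_eq_div hε hs.le hs'.le
  · rw [Set.indicator_of_notMem (by simp [h1.le]), zero_mul]
    refine (hasDerivAt_const (0 : ℝ) (0 : ℝ)).congr_of_eventuallyEq ?_
    filter_upwards [hc.eventually_const_lt h1] with s hs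
    exact ballCutoff_eq_zero hε hs.le

variable [NeZero n]

lemma measureReal_shell {τ ε : ℝ} (hε : 0 < ε) (hετ : ε < τ) :
    ∫ y : Vec n, (Set.Ioo (τ - ε) τ).indicator (1 : ℝ → ℝ) ‖y‖ =
      (τ ^ n - (τ - ε) ^ n) * (volume : Measure (Vec n)).real (Metric.ball 0 1) := by
  have e : ∀ y : Vec n, (Set.Ioo (τ - ε) τ).indicator (1 : ℝ → ℝ) ‖y‖ =
      (Metric.ball (0 : Vec n) τ \ Metric.closedBall 0 (τ - ε)).indicator 1 y := by
    intro y
    simp only [Set.indicator, Set.mem_Ioo, Set.mem_sdiff, Metric.mem_ball, dist_zero_right,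
      Metric.mem_closedBall, not_le, and_comm]
    rfl
  simp only [e]
  rw [integral_indicator_one (measurableSet_ball.diff measurableSet_closedBall),
    measureReal_sdiff (Metric.closedBall_subset_ball (by linarith)) measurableSet_closedBall
      measure_ball_lt_top.ne]
  simp only [measureReal_def]
  rw [Measure.addHaar_closedBall _ _ (by linarith), Measure.addHaar_ball _ _ (by linarith)]
  rw [ENNReal.toReal_mul, ENNReal.toReal_mul, ENNReal.toReal_ofReal (pow_nonneg (by linarith) _),
    ENNReal.toReal_ofReal (pow_nonneg (by linarith) _)]
  simp [sub_mul]

/-- The surface integral of a function that is convex in the direction `d` is at most the increment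
of its solid integral. -/
lemma surface_integral_le {f : Vec n → ℝ} {d : Vec n} {B C τ : ℝ} (hτ : 0 < τ)
    (hf : Measurable f) (hB : ∀ y, |f y| ≤ B)
    (hconv : ∀ y, ‖y‖ ≤ τ → ∀ s ∈ Set.Ioo (0 : ℝ) 1,
      f (y + s • d) ≤ (1 - s) * f y + s * f (y + d))
    (hray : ∀ θ : Vec n, ‖θ‖ = 1 → ∀ r ∈ Set.Icc 0 τ, |f (τ • θ) - f (r • θ)| ≤ C * (τ - r)) :
    (volume : Measure (Vec n)).real (Metric.ball 0 1) * (n * τ ^ (n - 1)) *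
        ∫ θ, f (τ • θ) * inner ℝ θ d ∂(unifSphere n) ≤
      ∫ y in Metric.ball (0 : Vec n) τ, (f (y + d) - f y) := by
  have hB0 : 0 ≤ B := (abs_nonneg _).trans (hB 0)
  set v := (volume : Measure (Vec n)).real (Metric.ball 0 1)
  set g : Vec n → ℝ := fun θ => f (τ • θ) * inner ℝ θ d with hg
  set I := ∫ y in Metric.ball (0 : Vec n) τ, (f (y + d) - f y)
  have hgi : Integrable g (unifSphere n) := by
    refine Integrable.of_bound (C := B * ‖d‖) ?_ ?_
    · exact ((hf.comp (measurable_const_smul τ)).mul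
        (Continuous.measurable (by fun_prop))).aestronglyMeasurable
    · filter_upwards [ae_norm_eq_one_unifSphere n] with θ hθ
      rw [norm_mul]
      have h1 := norm_inner_le_norm (𝕜 := ℝ) θ d
      rw [hθ, one_mul] at h1
      exact mul_le_mul (hB _) h1 (norm_nonneg _) hB0
  -- The inequality at positive shell width. The term `C ε ‖d‖` pays for replacing `f` on the shell
  -- by its radial projection to the sphere, the last term for replacing the cutoff by the indicator
  -- of the ball. Both vanish as `ε → 0`.
  have hineq : ∀ ε ∈ Set.Ioo (0 : ℝ) τ,
      v * ((τ ^ n - (τ - ε) ^ n) / ε) * ((∫ θ, g θ ∂(unifSphere n)) - C * ε * ‖d‖) ≤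
        I + 2 * B * (v * (τ ^ n - (τ - ε) ^ n)) := by
    rintro ε ⟨hε, hετ⟩
    set sh : ℝ → ℝ := (Set.Ioo (τ - ε) τ).indicator 1 with hsh
    have hsh_int : Integrable fun y : Vec n => sh ‖y‖ := by
      have : (fun y : Vec n => sh ‖y‖) =
          (((fun y : Vec n => ‖y‖) ⁻¹' Set.Ioo (τ - ε) τ)).indicator fun _ => (1 : ℝ) := by
        ext y; simp [sh, Set.indicator]
      rw [this, integrable_indicator_iff (measurableSet_Ioo.preimage measurable_norm)]
      refine integrableOn_const (ne_top_of_le_ne_top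
        (measure_closedBall_lt_top (x := (0 : Vec n)) (r := τ)).ne (measure_mono ?_))
      intro y hy
      simpa using hy.2.le
    have hsh0 : ∀ r, 0 ≤ sh r := fun r => Set.indicator_nonneg (fun _ _ => zero_le_one) r
    have hsh_vol := measureReal_shell (n := n) hε hετ
    have hsh_vol' : ∫ y : Vec n, sh ‖y‖ = v * (τ ^ n - (τ - ε) ^ n) := by
      rw [hsh_vol, mul_comm]
    have hnull : ∀ r : ℝ, r ≠ 0 → ∀ᵐ y : Vec n, ‖y‖ ≠ r := by
      intro r hr
      have h0 : (volume : Measure (Vec n)) (Metric.sphere 0 r) = 0 :=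
        Measure.addHaar_sphere_of_ne_zero _ _ hr
      filter_upwards [compl_mem_ae_iff.2 h0] with y hy
      simpa using hy
    have h1 := integral_mul_deriv_le_of_convex_along (η := ballCutoff τ ε)
      (D := fun y => sh ‖y‖ * (inner ℝ y d / ‖y‖ / ε)) hf hB hconv (ballCutoff_nonneg τ ε)
      (lipschitzWith_ballCutoff hε) (fun y hy => ballCutoff_eq_zero hε hy) (by
        filter_upwards [hnull τ hτ.ne', hnull (τ - ε) (by linarith)] with y hy1 hy2
        exact hasDerivAt_ballCutoff hε hετ hy1 hy2 d)
    have hdir : ∀ y : Vec n, |inner ℝ y d / ‖y‖| ≤ ‖d‖ := by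
      intro y
      rw [abs_div, abs_norm]
      exact div_le_of_le_mul₀ (norm_nonneg _) (norm_nonneg _)
        ((abs_real_inner_le_norm y d).trans_eq (mul_comm _ _))
    -- the shell integral
    have h2 : v * ((τ ^ n - (τ - ε) ^ n) / ε) * ((∫ θ, g θ ∂(unifSphere n)) - C * ε * ‖d‖) ≤
        ∫ y, f y * (sh ‖y‖ * (inner ℝ y d / ‖y‖ / ε)) := by
      have e1 : v * ((τ ^ n - (τ - ε) ^ n) / ε) *
          ((∫ θ, g θ ∂(unifSphere n)) - C * ε * ‖d‖) =
          ∫ y : Vec n, ((g (‖y‖⁻¹ • y) - C * ε * ‖d‖) / ε) * sh ‖y‖ := by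
        rw [integral_direction_mul_norm (fun θ => (g θ - C * ε * ‖d‖) / ε) sh, hsh_vol,
          integral_div, integral_sub hgi (integrable_const _)]
        simp
        ring
      rw [e1]
      have hgm : Measurable g := (hf.comp (measurable_const_smul τ)).mul
        (Continuous.measurable (by fun_prop))
      have hiA : Integrable fun y : Vec n =>
          ((g (‖y‖⁻¹ • y) - C * ε * ‖d‖) / ε) * sh ‖y‖ := by
        refine hsh_int.bdd_mul (c := (B * ‖d‖ + |C * ε * ‖d‖|) / ε) ?_ ?_
        · exact (((hgm.comp (measurable_norm.inv.smul measurable_id)).sub_const _).div_const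
            _).aestronglyMeasurable
        · refine Eventually.of_forall fun y => ?_
          rw [Real.norm_eq_abs, abs_div, abs_of_pos hε]
          gcongr
          refine (abs_sub _ _).trans ?_
          gcongr
          rw [hg]
          dsimp only
          rw [abs_mul, real_inner_smul_left, ← div_eq_inv_mul]
          exact mul_le_mul (hB _) (hdir y) (abs_nonneg _) hB0
      have hiB : Integrable fun y : Vec n => f y * (sh ‖y‖ * (inner ℝ y d / ‖y‖ / ε)) := by
        have : Integrable fun y : Vec n => (f y * (inner ℝ y d / ‖y‖ / ε)) * sh ‖y‖ := by
          refine hsh_int.bdd_mul (c := B * (‖d‖ / ε)) ?_ ?_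
          · exact (hf.mul ((((Continuous.measurable (by fun_prop)).div
              measurable_norm)).div_const _)).aestronglyMeasurable
          · refine Eventually.of_forall fun y => ?_
            rw [Real.norm_eq_abs, abs_mul, abs_div, abs_of_pos hε]
            gcongr
            · exact hB y
            · exact hdir y
        refine this.congr (Eventually.of_forall fun y => ?_)
        dsimp only
        ring
      refine integral_mono hiA hiB fun y => ?_
      by_cases hy : ‖y‖ ∈ Set.Ioo (τ - ε) τ
      · have hy0 : ‖y‖ ≠ 0 := by linarith [hy.1]
        have hθ : ‖(‖y‖⁻¹ • y)‖ = 1 := by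
          rw [norm_smul, norm_inv, norm_norm, inv_mul_cancel₀ hy0]
        have h4 := hray _ hθ ‖y‖ ⟨norm_nonneg _, hy.2.le⟩
        rw [smul_inv_smul₀ hy0] at h4
        have hC : 0 ≤ C := by
          have := (abs_nonneg _).trans h4
          exact nonneg_of_mul_nonneg_left this (by linarith [hy.2])
        have h5 : |f (τ • ‖y‖⁻¹ • y) - f y| ≤ C * ε :=
          h4.trans (mul_le_mul_of_nonneg_left (by linarith [hy.1]) hC)
        have h6 : (f (τ • ‖y‖⁻¹ • y) - f y) * (inner ℝ y d / ‖y‖) ≤ C * ε * ‖d‖ := by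
          refine (le_abs_self _).trans ?_
          rw [abs_mul]
          exact mul_le_mul h5 (hdir y) (abs_nonneg _) (by positivity)
        have h7 : sh ‖y‖ = 1 := Set.indicator_of_mem hy _
        simp only [hg, h7, real_inner_smul_left, ← div_eq_inv_mul]
        have e2 : f y * (1 * (inner ℝ y d / ‖y‖ / ε)) * ε = f y * (inner ℝ y d / ‖y‖) := by
          field_simp
        rw [mul_one, div_le_iff₀ hε, e2]
        linarith
      · have h7 : sh ‖y‖ = 0 := Set.indicator_of_notMem hy _
        simp [h7]
    have h3 : ∫ y, ballCutoff τ ε y * (f (y + d) - f y) ≤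
        I + 2 * B * (v * (τ ^ n - (τ - ε) ^ n)) := by
      have hm : Measurable fun y => f (y + d) - f y :=
        (hf.comp (measurable_add_const d)).sub hf
      have hΔ : ∀ y, |f (y + d) - f y| ≤ 2 * B := fun y =>
        (abs_sub _ _).trans (by linarith [hB (y + d), hB y])
      have hiη : Integrable fun y => ballCutoff τ ε y * (f (y + d) - f y) := by
        have := (integrable_ballCutoff (n := n) (τ := τ) hε).bdd_mul (c := 2 * B)
          hm.aestronglyMeasurable (Eventually.of_forall hΔ)
        simpa only [mul_comm] using this
      have hiI : IntegrableOn (fun y => f (y + d) - f y) (Metric.ball 0 τ) :=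
        IntegrableOn.of_bound measure_ball_lt_top hm.aestronglyMeasurable (2 * B)
          (Eventually.of_forall hΔ)
      have hI : I = ∫ y, (Metric.ball 0 τ).indicator (fun y => f (y + d) - f y) y :=
        (integral_indicator measurableSet_ball).symm
      rw [← hsh_vol', ← integral_const_mul, hI,
        ← integral_add ((integrable_indicator_iff measurableSet_ball).2 hiI)
          (hsh_int.const_mul _)]
      refine integral_mono hiη (((integrable_indicator_iff measurableSet_ball).2 hiI).add
        (hsh_int.const_mul _)) fun y => ?_
      have h8 := abs_le.1 (hΔ y)
      rcases lt_or_ge ‖y‖ τ with hy | hy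
      · rw [Set.indicator_of_mem (by simpa using hy)]
        rcases le_or_gt ‖y‖ (τ - ε) with hy' | hy'
        · rw [ballCutoff_eq_one hε hy', one_mul]
          have := hsh0 ‖y‖
          have := mul_nonneg (mul_nonneg (by norm_num : (0 : ℝ) ≤ 2) hB0) this
          linarith
        · have h7 : sh ‖y‖ = 1 := Set.indicator_of_mem (Set.mem_Ioo.2 ⟨hy', hy⟩) _
          rw [h7]
          have h9 := ballCutoff_le_one τ ε y
          have h10 := ballCutoff_nonneg τ ε y
          nlinarith
      · rw [ballCutoff_eq_zero hε hy, zero_mul,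
          Set.indicator_of_notMem (by simpa using hy), zero_add]
        exact mul_nonneg (by positivity) (hsh0 _)
    exact (h2.trans h1).trans h3
  -- Shell volume over width tends to the surface area, up to the volume `v` of the unit ball.
  have hq : Tendsto (fun ε : ℝ => (τ ^ n - (τ - ε) ^ n) / ε) (𝓝[>] 0) (𝓝 (n * τ ^ (n - 1))) := by
    have h1 : HasDerivAt (fun ε : ℝ => τ ^ n - (τ - ε) ^ n) (n * τ ^ (n - 1)) 0 := by
      have h2 := (((hasDerivAt_id (0 : ℝ)).const_sub τ).pow n).const_sub (τ ^ n)
      simpa using h2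
    have := h1.tendsto_slope_zero_right
    simp only [zero_add, sub_zero, sub_self, smul_eq_mul] at this
    refine this.congr fun ε => ?_
    ring
  have hid : Tendsto (fun ε : ℝ => ε) (𝓝[>] 0) (𝓝 0) := tendsto_id.mono_left nhdsWithin_le_nhds
  have hl := (hq.const_mul v).mul
    ((((hid.const_mul C).mul_const ‖d‖).const_sub (∫ θ, g θ ∂(unifSphere n))))
  have hv : Tendsto (fun ε : ℝ => τ ^ n - (τ - ε) ^ n) (𝓝[>] 0) (𝓝 0) := by
    have : Continuous fun ε : ℝ => τ ^ n - (τ - ε) ^ n := by fun_prop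
    simpa using (this.tendsto 0).mono_left nhdsWithin_le_nhds
  have hr := ((hv.const_mul v).const_mul (2 * B)).const_add I
  simp only [mul_zero, zero_mul, sub_zero, add_zero] at hl hr
  refine le_of_tendsto_of_tendsto hl hr ?_
  filter_upwards [Ioo_mem_nhdsGT hτ] with ε hε using hineq ε hε

end Surface

/-! ### Losses that can be optimised from one-point evaluations -/

section RoundLoss

variable {n : ℕ}

/-- What the analysis uses of a single loss function: it is convex and bounded on `S_τ`, its
symmetric second differences of size `τ` around the points of `S` are at most `2b`, and it is
Lipschitz along the radii of the balls of radius `τ` around the points of `S`. -/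
structure IsRoundLoss (S : Set (Vec n)) (τ B b : ℝ) (f : Vec n → ℝ) : Prop where
  measurable : Measurable f
  convexOn : ConvexOn ℝ (enlarge S τ) f
  abs_le : ∀ x ∈ enlarge S τ, |f x| ≤ B
  second_diff : ∀ x ∈ S, ∀ v : Vec n, ‖v‖ ≤ τ → f (x + v) + f (x - v) ≤ 2 * (f x + b)
  radial : ∃ C, ∀ x ∈ S, ∀ θ : Vec n, ‖θ‖ = 1 → ∀ r ∈ Set.Icc 0 τ,
    |f (x + τ • θ) - f (x + r • θ)| ≤ C * (τ - r)

variable {S : Set (Vec n)} {τ B b : ℝ}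

lemma add_mem_enlarge {x v : Vec n} (hx : x ∈ S) (hv : ‖v‖ ≤ τ) : x + v ∈ enlarge S τ :=
  Set.add_mem_add hx (by simpa using hv)

lemma sub_mem_enlarge {x v : Vec n} (hx : x ∈ S) (hv : ‖v‖ ≤ τ) : x - v ∈ enlarge S τ := by
  rw [sub_eq_add_neg]
  exact add_mem_enlarge hx (by simpa using hv)

lemma mem_enlarge {x : Vec n} (hτ : 0 ≤ τ) (hx : x ∈ S) : x ∈ enlarge S τ := by
  simpa using add_mem_enlarge (v := 0) hx (by simpa using hτ)

lemma add_smul_mem_enlarge {x θ : Vec n} {r : ℝ} (hx : x ∈ S) (hθ : ‖θ‖ = 1)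
    (hr : r ∈ Set.Icc 0 τ) : x + r • θ ∈ enlarge S τ :=
  add_mem_enlarge hx (by rw [norm_smul, hθ, mul_one, Real.norm_of_nonneg hr.1]; exact hr.2)

lemma measurableSet_enlarge (hc : IsCompact S) : MeasurableSet (enlarge S τ) :=
  (hc.add (isCompact_closedBall 0 τ)).measurableSet

lemma convex_enlarge (hconv : Convex ℝ S) : Convex ℝ (enlarge S τ) :=
  hconv.add (convex_closedBall 0 τ)

namespace IsRoundLoss

variable {f : Vec n → ℝ}

lemma two_mul_le (hf : IsRoundLoss S τ B b f) {x v : Vec n} (hx : x ∈ S) (hv : ‖v‖ ≤ τ) :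
    2 * f x ≤ f (x + v) + f (x - v) := by
  have h := hf.convexOn.2 (add_mem_enlarge hx hv) (sub_mem_enlarge hx hv)
    (by norm_num : (0 : ℝ) ≤ 1 / 2) (by norm_num : (0 : ℝ) ≤ 1 / 2) (by norm_num)
  have e : (1 / 2 : ℝ) • (x + v) + (1 / 2 : ℝ) • (x - v) = x := by module
  rw [e] at h
  simp only [smul_eq_mul] at h
  linarith

lemma ae_add_smul_mem (hτ : 0 ≤ τ) {x : Vec n} (hx : x ∈ S) :
    ∀ᵐ θ ∂(unifSphere n), x + τ • θ ∈ enlarge S τ := by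
  filter_upwards [ae_norm_eq_one_unifSphere n] with θ hθ
  exact add_smul_mem_enlarge hx hθ ⟨hτ, le_rfl⟩

variable [NeZero n]

lemma integrable_sphere (hf : IsRoundLoss S τ B b f) (hτ : 0 ≤ τ) {x : Vec n} (hx : x ∈ S) :
    Integrable (fun θ => f (x + τ • θ)) (unifSphere n) := by
  refine Integrable.of_bound (C := B)
    (hf.measurable.comp (by fun_prop)).aestronglyMeasurable ?_
  filter_upwards [ae_add_smul_mem hτ hx] with θ hθ
  exact hf.abs_le _ hθ

/-- The mean of the loss over a sphere. -/
lemma integral_sphere_le (hf : IsRoundLoss S τ B b f) (hτ : 0 ≤ τ) {x : Vec n} (hx : x ∈ S) :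
    ∫ θ, f (x + τ • θ) ∂(unifSphere n) ≤ f x + b := by
  -- By symmetry the mean is half the mean of a symmetric sum, which the second difference controls.
  have h1 : ∫ θ, f (x - τ • θ) ∂(unifSphere n) = ∫ θ, f (x + τ • θ) ∂(unifSphere n) := by
    rw [← integral_unifSphere_neg]
    simp [sub_eq_add_neg]
  have hi2 : Integrable (fun θ => f (x - τ • θ)) (unifSphere n) := by
    refine Integrable.of_bound (C := B)
      (hf.measurable.comp (by fun_prop)).aestronglyMeasurable ?_
    filter_upwards [ae_norm_eq_one_unifSphere n] with θ hθ
    refine hf.abs_le _ (sub_mem_enlarge hx ?_)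
    rw [norm_smul, hθ, mul_one, Real.norm_of_nonneg hτ]
  have h2 : ∫ θ, (f (x + τ • θ) + f (x - τ • θ)) ∂(unifSphere n) ≤ 2 * (f x + b) := by
    calc _ ≤ ∫ _θ, 2 * (f x + b) ∂(unifSphere n) := by
          refine integral_mono_ae ((hf.integrable_sphere hτ hx).add hi2) (integrable_const _) ?_
          filter_upwards [ae_norm_eq_one_unifSphere n] with θ hθ
          refine hf.second_diff x hx (τ • θ) ?_
          rw [norm_smul, hθ, mul_one, Real.norm_of_nonneg hτ]
      _ = _ := by simp
  rw [integral_add (hf.integrable_sphere hτ hx) hi2, h1] at h2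
  linarith

/-- The one-point gradient estimate is an approximate subgradient. -/
lemma integral_sphere_inner_le (hf : IsRoundLoss S τ B b f) (hτ : 0 < τ) (hB : 0 ≤ B)
    (hc : IsCompact S) {x u : Vec n} (hx : x ∈ S) (hu : u ∈ S) :
    n / τ * ∫ θ, f (x + τ • θ) * inner ℝ θ (u - x) ∂(unifSphere n) ≤ f u - f x + b := by
  -- Bounds on `f` hold only on `S_τ`, while the surface inequality asks for a globally bounded
  -- function. Every point at which convexity is used lies in `S_τ`.
  set F : Vec n → ℝ := (enlarge S τ).indicator f
  have hFf : ∀ y ∈ enlarge S τ, F y = f y := fun y hy => Set.indicator_of_mem hy f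
  have hFm : Measurable F := hf.measurable.indicator (measurableSet_enlarge hc)
  have hFB : ∀ y, |F y| ≤ B := by
    intro y
    by_cases hy : y ∈ enlarge S τ
    · rw [hFf y hy]; exact hf.abs_le y hy
    · simpa [F, Set.indicator_of_notMem hy] using hB
  obtain ⟨C, hC⟩ := hf.radial
  have hsurf := surface_integral_le (f := fun y => F (x + y)) (d := u - x) (B := B) (C := C) hτ
    (hFm.comp (measurable_const_add x)) (fun y => hFB _) (by
      intro y hy s hs
      have h1 := add_mem_enlarge hx hy
      have h2 := add_mem_enlarge hu hy
      have e1 : x + (y + s • (u - x)) = (1 - s) • (x + y) + s • (u + y) := by module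
      have e2 : x + (y + (u - x)) = u + y := by abel
      have h0 : (0 : ℝ) ≤ 1 - s := by linarith [hs.2]
      rw [e1, e2, hFf _ h1, hFf _ h2,
        hFf _ (hf.convexOn.1 h1 h2 h0 hs.1.le (by ring))]
      exact hf.convexOn.2 h1 h2 h0 hs.1.le (by ring)) (by
      intro θ hθ r hr
      rw [hFf _ (add_smul_mem_enlarge hx hθ hr),
        hFf _ (add_smul_mem_enlarge hx hθ ⟨hτ.le, le_rfl⟩)]
      exact hC x hx θ hθ r hr)
  set v := (volume : Measure (Vec n)).real (Metric.ball 0 1)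
  have hv : 0 < v :=
    ENNReal.toReal_pos (Metric.measure_ball_pos _ _ one_pos).ne' measure_ball_lt_top.ne
  have hball : (volume : Measure (Vec n)).real (Metric.ball 0 τ) = v * τ ^ n := by
    rw [measureReal_def, Measure.addHaar_ball _ _ hτ.le, ENNReal.toReal_mul,
      ENNReal.toReal_ofReal (by positivity), finrank_euclideanSpace, Fintype.card_fin, mul_comm]
    rfl
  set H : Vec n → ℝ := fun y => F (x + (y + (u - x))) - F (x + y) with hH
  have hHm : Measurable H :=
    (hFm.comp (by fun_prop)).sub (hFm.comp (measurable_const_add x))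
  have hHb : ∀ y, ‖H y‖ ≤ 2 * B := fun y =>
    (abs_sub _ _).trans (by linarith [hFB (x + (y + (u - x))), hFB (x + y)])
  have hHi : IntegrableOn H (Metric.ball 0 τ) :=
    IntegrableOn.of_bound measure_ball_lt_top hHm.aestronglyMeasurable _
      (Filter.Eventually.of_forall hHb)
  have hHi' : IntegrableOn (fun y => H (-y)) (Metric.ball 0 τ) :=
    IntegrableOn.of_bound measure_ball_lt_top (hHm.comp measurable_neg).aestronglyMeasurable _
      (Filter.Eventually.of_forall fun y => hHb _)
  have hneg : ∫ y in Metric.ball (0 : Vec n) τ, H (-y) = ∫ y in Metric.ball (0 : Vec n) τ, H y := by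
    have := (Measure.measurePreserving_neg (volume : Measure (Vec n))).setIntegral_preimage_emb
      (MeasurableEquiv.neg (Vec n)).measurableEmbedding H (Metric.ball 0 τ)
    rw [← this]
    congr 2
    ext y
    simp
  -- Pairing `y` with `-y` gives symmetric sums at `u`, at most `2(f u + b)`, minus symmetric sums
  -- at `x`, at least `2 f x`. The bias thus occurs at `u` alone.
  have hle : ∫ y in Metric.ball (0 : Vec n) τ, (H y + H (-y)) ≤
      v * τ ^ n * (2 * (f u - f x + b)) := by
    calc _ ≤ ∫ _y in Metric.ball (0 : Vec n) τ, 2 * (f u - f x + b) := by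
          refine setIntegral_mono_on (hHi.add hHi') (integrableOn_const measure_ball_lt_top.ne)
            measurableSet_ball fun y hy => ?_
          have hy' : ‖y‖ ≤ τ := by simpa using (le_of_lt (by simpa using hy))
          have e1 : x + (y + (u - x)) = u + y := by abel
          have e2 : x + (-y + (u - x)) = u - y := by abel
          simp only [hH]
          rw [e1, e2, ← sub_eq_add_neg x y, hFf _ (add_mem_enlarge hx hy'),
            hFf _ (add_mem_enlarge hu hy'), hFf _ (sub_mem_enlarge hx hy'),
            hFf _ (sub_mem_enlarge hu hy')]
          linarith [hf.second_diff u hu y hy', hf.two_mul_le hx hy']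
      _ = _ := by rw [setIntegral_const, hball, smul_eq_mul]
  rw [integral_add hHi hHi', hneg] at hle
  have hsphere : ∫ θ, F (x + τ • θ) * inner ℝ θ (u - x) ∂(unifSphere n) =
      ∫ θ, f (x + τ • θ) * inner ℝ θ (u - x) ∂(unifSphere n) := by
    refine integral_congr_ae ?_
    filter_upwards [ae_add_smul_mem hτ.le hx] with θ hθ
    rw [hFf _ hθ]
  rw [hsphere] at hsurf
  have hτn : τ ^ n = τ ^ (n - 1) * τ := by
    rw [← pow_succ, Nat.sub_add_cancel NeZero.one_le]
  have hpos : 0 < v * τ ^ n := by positivity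
  refine le_of_mul_le_mul_left ?_ hpos
  calc v * τ ^ n * (n / τ * ∫ θ, f (x + τ • θ) * inner ℝ θ (u - x) ∂(unifSphere n))
      = v * (n * τ ^ (n - 1)) * ∫ θ, f (x + τ • θ) * inner ℝ θ (u - x) ∂(unifSphere n) := by
        rw [hτn]; field_simp
    _ ≤ _ := hsurf
    _ ≤ _ := by linarith

end IsRoundLoss

end RoundLoss

/-! ### Mean losses -/

section MeanLoss

variable {n : ℕ}

/-- Jensen's inequality for `t ↦ t^r`. Measurability of `m` is not assumed; it is recovered by
taking the `r`-th root of `m^r`. -/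
lemma integrable_and_integral_le_of_rpow {X : Type*} [MeasurableSpace X] {μ : Measure X}
    [IsProbabilityMeasure μ] {m : X → ℝ} (hm0 : ∀ s, 0 ≤ m s) {r c : ℝ} (hr : 1 ≤ r) (hc : 0 ≤ c)
    (hi : Integrable (fun s => m s ^ r) μ) (hle : ∫ s, m s ^ r ∂μ ≤ c ^ r) :
    Integrable m μ ∧ ∫ s, m s ∂μ ≤ c := by
  have hr0 : 0 < r := by linarith
  have hroot : ∀ s, (m s ^ r) ^ r⁻¹ = m s := fun s => Real.rpow_rpow_inv (hm0 s) hr0.ne'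
  have hmeas : AEStronglyMeasurable m μ := by
    have := (hi.aestronglyMeasurable.aemeasurable.pow_const r⁻¹).aestronglyMeasurable
    simpa only [hroot] using this
  have hint : Integrable m μ := by
    refine Integrable.mono' (hi.add (integrable_const 1)) hmeas
      (Filter.Eventually.of_forall fun s => ?_)
    rw [Real.norm_of_nonneg (hm0 s), Pi.add_apply]
    rcases le_or_gt (m s) 1 with h | h
    · have := Real.rpow_nonneg (hm0 s) r
      linarith
    · have := Real.rpow_le_rpow_of_exponent_le h.le hr
      rw [Real.rpow_one] at this
      linarith
  refine ⟨hint, ?_⟩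
  have h1 : (∫ s, m s ∂μ) ^ r ≤ ∫ s, m s ^ r ∂μ :=
    (convexOn_rpow hr).map_integral_le
      (Real.continuous_rpow_const hr0.le).continuousOn isClosed_Ici
      (Filter.Eventually.of_forall fun s => Set.mem_Ici.2 (hm0 s)) hint hi
  exact (Real.rpow_le_rpow_iff (integral_nonneg hm0) hc hr0).1 (h1.trans hle)

lemma HasGradientWithinAt.hasDerivWithinAt_line {K : Set (Vec n)} {l : Vec n → ℝ} {g : Vec n}
    {x v : Vec n} {s : ℝ} {I : Set ℝ} (h : HasGradientWithinAt l g K (x + s • v))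
    (hI : ∀ s ∈ I, x + s • v ∈ K) :
    HasDerivWithinAt (fun s : ℝ => l (x + s • v)) (inner ℝ g v) I s := by
  have h2 : HasDerivWithinAt (fun s : ℝ => x + s • v) v I s := by
    simpa using (((hasDerivAt_id s).smul_const v).const_add x).hasDerivWithinAt
  simpa [Function.comp_def] using
    h.hasFDerivWithinAt.comp_hasDerivWithinAt s h2 hI

/-- Restriction to a segment reduces this to a one-sided derivative of a convex function on `[0,
1]`, so boundary points of `K` are allowed. -/
lemma ConvexOn.add_inner_le {K : Set (Vec n)} {l : Vec n → ℝ} (hl : ConvexOn ℝ K l) {g x y : Vec n}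
    (hg : HasGradientWithinAt l g K x) (hx : x ∈ K) (hy : y ∈ K) :
    l x + inner ℝ g (y - x) ≤ l y := by
  have hmem : ∀ s ∈ Set.Icc (0 : ℝ) 1, x + s • (y - x) ∈ K := fun s hs =>
    hl.1.add_smul_sub_mem hx hy hs
  have hd : HasDerivWithinAt (fun s : ℝ => l (x + s • (y - x))) (inner ℝ g (y - x))
      (Set.Icc 0 1) 0 :=
    HasGradientWithinAt.hasDerivWithinAt_line (K := K) (by simpa using hg) hmem
  have hc : ConvexOn ℝ (Set.Icc (0 : ℝ) 1) fun s : ℝ => l (x + s • (y - x)) := by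
    refine ⟨convex_Icc 0 1, fun s hs t ht a b ha hb hab => ?_⟩
    have := hl.2 (hmem s hs) (hmem t ht) ha hb hab
    have e : a • (x + s • (y - x)) + b • (x + t • (y - x)) =
        x + (a • s + b • t) • (y - x) := by
      obtain rfl : a = 1 - b := by linarith
      simp only [smul_eq_mul]
      module
    rwa [e] at this
  have := hc.le_slope_of_hasDerivWithinAt (by simp) (by simp) zero_lt_one hd
  simp [slope_def_field] at this
  linarith

/-- The second difference of a function with Lipschitz gradient. -/
lemma second_diff_le_of_lipschitz_gradient {K : Set (Vec n)} {l : Vec n → ℝ} {G : Vec n → Vec n}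
    {m : ℝ} (hK : Convex ℝ K) (hG : ∀ x ∈ K, HasGradientWithinAt l (G x) K x)
    (hL : ∀ x ∈ K, ∀ y ∈ K, ‖G x - G y‖ ≤ m * ‖x - y‖) {x v : Vec n} (hp : x + v ∈ K)
    (hm : x - v ∈ K) : l (x + v) + l (x - v) - 2 * l x ≤ m * ‖v‖ ^ 2 := by
  have hx : x ∈ K := by
    have := hK hp hm (by norm_num : (0 : ℝ) ≤ 1 / 2) (by norm_num : (0 : ℝ) ≤ 1 / 2) (by norm_num)
    have e : (1 / 2 : ℝ) • (x + v) + (1 / 2 : ℝ) • (x - v) = x := by module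
    rwa [e] at this
  have hmp : ∀ s ∈ Set.Icc (0 : ℝ) 1, x + s • v ∈ K := fun s hs => hK.add_smul_mem hx hp hs
  have hmm : ∀ s ∈ Set.Icc (0 : ℝ) 1, x + s • -v ∈ K := fun s hs =>
    hK.add_smul_mem hx (by rwa [← sub_eq_add_neg]) hs
  -- The points `x ± s v` are `2s‖v‖` apart, so the quadratic term makes the derivative nonpositive.
  set φ : ℝ → ℝ := fun s => l (x + s • v) + l (x + s • -v) - m * ‖v‖ ^ 2 * s ^ 2
  have hd : ∀ s ∈ Set.Icc (0 : ℝ) 1, HasDerivWithinAt φ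
      (inner ℝ (G (x + s • v)) v + inner ℝ (G (x + s • -v)) (-v) - m * ‖v‖ ^ 2 * (2 * s))
      (Set.Icc 0 1) s := by
    intro s hs
    have h1 := (hG _ (hmp s hs)).hasDerivWithinAt_line hmp
    have h2 := (hG _ (hmm s hs)).hasDerivWithinAt_line hmm
    have h3 : HasDerivWithinAt (fun s : ℝ => m * ‖v‖ ^ 2 * s ^ 2) (m * ‖v‖ ^ 2 * (2 * s))
        (Set.Icc 0 1) s := by
      simpa using ((hasDerivAt_pow 2 s).const_mul (m * ‖v‖ ^ 2)).hasDerivWithinAt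
    exact (h1.add h2).sub h3
  have hanti : AntitoneOn φ (Set.Icc 0 1) := by
    refine antitoneOn_of_hasDerivWithinAt_nonpos (convex_Icc 0 1)
      (fun s hs => (hd s hs).continuousWithinAt)
      (fun s hs => (hd s (interior_subset hs)).mono interior_subset) fun s hs => ?_
    have hs' := interior_subset hs
    have h1 := hL _ (hmp s hs') _ (hmm s hs')
    have e : x + s • v - (x + s • -v) = (2 * s) • v := by module
    rw [e, norm_smul, Real.norm_of_nonneg (by linarith [hs'.1])] at h1
    have h2 := real_inner_le_norm (G (x + s • v) - G (x + s • -v)) v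
    rw [inner_sub_left] at h2
    rw [inner_neg_right]
    nlinarith [norm_nonneg v]
  have h01 := hanti (by simp : (0 : ℝ) ∈ Set.Icc 0 1) (by simp : (1 : ℝ) ∈ Set.Icc 0 1) zero_le_one
  simp only [φ, one_smul, zero_smul, add_zero, ← sub_eq_add_neg] at h01
  linarith

/-! ### Passing from stochastic losses to their means. -/

namespace Environment

variable {Ξ : Type*} [MeasurableSpace Ξ] {A : Environment n Ξ} {𝒟 : Measure Ξ}
  {S : Set (Vec n)} {τ α B : ℝ}

lemma measurable_loss_right (A : Environment n Ξ) (t : ℕ) (h : History n Ξ t) :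
    Measurable fun a : Vec n × Ξ => A.loss t h a.1 a.2 :=
  (A.measurable_loss t).comp (measurable_prodMk_left (x := h))

lemma measurable_noise_right (A : Environment n Ξ) (t : ℕ) (h : History n Ξ t) :
    Measurable (A.noise t h) :=
  (A.measurable_noise t).comp (measurable_prodMk_left (x := h))

lemma measurable_meanLoss [SFinite 𝒟] (A : Environment n Ξ) (t : ℕ) :
    Measurable fun a : History n Ξ t × Vec n => A.meanLoss 𝒟 t a.1 a.2 := by
  have : Measurable fun a : (History n Ξ t × Vec n) × Ξ => A.loss t a.1.1 a.1.2 a.2 :=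
    (A.measurable_loss t).comp (by fun_prop : Measurable
      fun a : (History n Ξ t × Vec n) × Ξ => (a.1.1, a.1.2, a.2))
  exact (this.stronglyMeasurable.integral_prod_right' (ν := 𝒟)).measurable

variable [IsProbabilityMeasure 𝒟]

lemma BoundedLoss.integrable (hbdd : A.BoundedLoss 𝒟 S τ α B) (hα : 0 ≤ α) (hB : 0 ≤ B) (t : ℕ)
    (h : History n Ξ t) {x : Vec n} (hx : x ∈ enlarge S τ) : Integrable (A.loss t h x) 𝒟 := by
  obtain ⟨h1, h2⟩ := hbdd t h x hx
  have h3 := (integrable_and_integral_le_of_rpow (fun s => abs_nonneg _) (by linarith) hB h1 h2).1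
  exact (integrable_norm_iff ((A.measurable_loss_right t h).comp
    measurable_prodMk_left).aestronglyMeasurable).1 h3

lemma BoundedLoss.integral_abs_le (hbdd : A.BoundedLoss 𝒟 S τ α B) (hα : 0 ≤ α) (hB : 0 ≤ B)
    (t : ℕ) (h : History n Ξ t) {x : Vec n} (hx : x ∈ enlarge S τ) :
    ∫ s, |A.loss t h x s| ∂𝒟 ≤ B := by
  obtain ⟨h1, h2⟩ := hbdd t h x hx
  exact (integrable_and_integral_le_of_rpow (fun s => abs_nonneg _) (by linarith) hB h1 h2).2

lemma BoundedLoss.abs_meanLoss_le (hbdd : A.BoundedLoss 𝒟 S τ α B) (hα : 0 ≤ α) (hB : 0 ≤ B)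
    (t : ℕ) (h : History n Ξ t) {x : Vec n} (hx : x ∈ enlarge S τ) :
    |A.meanLoss 𝒟 t h x| ≤ B :=
  abs_integral_le_integral_abs.trans (hbdd.integral_abs_le hα hB t h hx)

lemma ConvexLoss.meanLoss (hconv : A.ConvexLoss S τ) (hbdd : A.BoundedLoss 𝒟 S τ α B)
    (hα : 0 ≤ α) (hB : 0 ≤ B) (hS : Convex ℝ S) (t : ℕ) (h : History n Ξ t) :
    ConvexOn ℝ (enlarge S τ) (A.meanLoss 𝒟 t h) := by
  have hK := convex_enlarge (τ := τ) hS
  refine ⟨hK, fun x hx y hy a b ha hb hab => ?_⟩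
  have hi := fun {z} hz => hbdd.integrable hα hB t h (x := z) hz
  have hix : Integrable (fun s => a • A.loss t h x s) 𝒟 := (hi hx).smul a
  have hiy : Integrable (fun s => b • A.loss t h y s) 𝒟 := (hi hy).smul b
  unfold Environment.meanLoss
  rw [← integral_smul, ← integral_smul, ← integral_add hix hiy]
  exact integral_mono (hi (hK hx hy ha hb hab)) (hix.add hiy)
    fun s => (hconv t h s).2 hx hy ha hb hab

/-- The mean loss is `M`-Lipschitz, so its second differences are at most `2M‖v‖`, and `M` serves as
the radial constant. -/
lemma LipschitzLoss.isRoundLoss (hconv : A.ConvexLoss S τ) (hbdd : A.BoundedLoss 𝒟 S τ α B)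
    (hα : 0 ≤ α) (hB : 0 ≤ B) (hS : Convex ℝ S) (hτ : 0 ≤ τ) {M : ℝ} (hM : 0 ≤ M)
    (hLip : A.LipschitzLoss 𝒟 S τ α M) (t : ℕ) (h : History n Ξ t) :
    IsRoundLoss S τ B (M * τ) (A.meanLoss 𝒟 t h) := by
  obtain ⟨m, hm0, hm, hmi, hmle⟩ := hLip t h
  obtain ⟨hmi', hmle'⟩ := integrable_and_integral_le_of_rpow hm0 (by linarith) hM hmi hmle
  have hi := fun {z} hz => hbdd.integrable hα hB t h (x := z) hz
  have hL : ∀ x ∈ enlarge S τ, ∀ y ∈ enlarge S τ,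
      |A.meanLoss 𝒟 t h x - A.meanLoss 𝒟 t h y| ≤ M * ‖x - y‖ := by
    intro x hx y hy
    unfold meanLoss
    rw [← integral_sub (hi hx) (hi hy)]
    calc _ ≤ ∫ s, |A.loss t h x s - A.loss t h y s| ∂𝒟 := abs_integral_le_integral_abs
      _ ≤ ∫ s, m s * ‖x - y‖ ∂𝒟 :=
          integral_mono ((hi hx).sub (hi hy)).abs (hmi'.mul_const _) fun s => hm s x hx y hy
      _ = (∫ s, m s ∂𝒟) * ‖x - y‖ := integral_mul_const _ _
      _ ≤ _ := by gcongr
  refine ⟨(measurable_meanLoss A t).comp measurable_prodMk_left,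
    hconv.meanLoss hbdd hα hB hS t h, fun x hx => hbdd.abs_meanLoss_le hα hB t h hx, ?_, M, ?_⟩
  · intro x hx v hv
    have h1 := (abs_le.1 (hL _ (add_mem_enlarge hx hv) x (mem_enlarge hτ hx))).2
    have h2 := (abs_le.1 (hL _ (sub_mem_enlarge hx hv) x (mem_enlarge hτ hx))).2
    simp only [add_sub_cancel_left, sub_sub_cancel_left, norm_neg] at h1 h2
    have h3 := mul_le_mul_of_nonneg_left hv hM
    linarith
  · intro x hx θ hθ r hr
    have h1 := hL _ (add_smul_mem_enlarge hx hθ ⟨hτ, le_rfl⟩) _ (add_smul_mem_enlarge hx hθ hr)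
    rwa [add_sub_add_left_eq_sub, ← sub_smul, norm_smul, hθ, mul_one,
      Real.norm_of_nonneg (by linarith [hr.2])] at h1

/-- Second differences come from the Lipschitz gradient. With no Lipschitz constant assumed, the
radial bound needs an argument up to the boundary of `S_τ`. Its constant is irrelevant later,
because it drops out in the limit of thin shells. -/
lemma SmoothLoss.isRoundLoss (hconv : A.ConvexLoss S τ) (hbdd : A.BoundedLoss 𝒟 S τ α B)
    (hα : 0 ≤ α) (hB : 0 ≤ B) (hS : Convex ℝ S) (hτ : 0 < τ) {L : ℝ} (hL : 0 ≤ L)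
    (hsm : A.SmoothLoss 𝒟 S τ α L) (t : ℕ) (h : History n Ξ t) :
    IsRoundLoss S τ B (L * τ ^ 2 / 2) (A.meanLoss 𝒟 t h) := by
  obtain ⟨m, hm0, hG, hmi, hmle⟩ := hsm t h
  choose G hG1 hG2 using hG
  obtain ⟨hmi', hmle'⟩ := integrable_and_integral_le_of_rpow hm0 (by linarith) hL hmi hmle
  have hK := convex_enlarge (τ := τ) hS
  have hi := fun {z} hz => hbdd.integrable hα hB t h (x := z) hz
  have habs := fun {z} hz => hbdd.abs_meanLoss_le hα hB t h (x := z) hz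
  have hcm := hconv.meanLoss hbdd hα hB hS t h
  refine ⟨(measurable_meanLoss A t).comp measurable_prodMk_left, hcm, fun x hx => habs hx, ?_,
    2 * B / τ + L * τ, ?_⟩
  · intro x hx v hv
    have hxK := mem_enlarge hτ.le hx
    have hp := add_mem_enlarge hx hv
    have hm := sub_mem_enlarge hx hv
    have h1 : ∫ s, (A.loss t h (x + v) s + A.loss t h (x - v) s - 2 * A.loss t h x s) ∂𝒟 ≤
        ∫ s, m s * ‖v‖ ^ 2 ∂𝒟 :=
      integral_mono (((hi hp).add (hi hm)).sub ((hi hxK).const_mul 2)) (hmi'.mul_const _) fun s =>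
        second_diff_le_of_lipschitz_gradient hK (hG1 s) (hG2 s) hp hm
    have hia : Integrable (fun s => A.loss t h (x + v) s + A.loss t h (x - v) s) 𝒟 :=
      (hi hp).add (hi hm)
    rw [integral_sub hia ((hi hxK).const_mul 2), integral_add (hi hp) (hi hm),
      integral_const_mul, integral_mul_const] at h1
    have h2 : (∫ s, m s ∂𝒟) * ‖v‖ ^ 2 ≤ L * τ ^ 2 := by
      gcongr
    unfold meanLoss
    linarith
  · intro x hx θ hθ r hr
    have hxK := mem_enlarge hτ.le hx
    have hz := add_smul_mem_enlarge hx hθ ⟨hτ.le, le_rfl⟩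
    have hy := add_smul_mem_enlarge hx hθ hr
    have hr' : 0 ≤ τ - r := by linarith [hr.2]
    -- Convexity on the segment from `x` to `x + τθ`, with both end values bounded by `B`.
    have hdown : A.meanLoss 𝒟 t h (x + r • θ) - A.meanLoss 𝒟 t h (x + τ • θ) ≤
        (2 * B / τ + L * τ) * (τ - r) := by
      have h1 : 0 ≤ (τ - r) / τ := by positivity
      have h2 : 0 ≤ r / τ := div_nonneg hr.1 hτ.le
      have h3 := hcm.2 hxK hz h1 h2 (by field_simp; ring)
      have e : ((τ - r) / τ) • x + (r / τ) • (x + τ • θ) = x + r • θ := by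
        rw [smul_add, ← add_assoc, ← add_smul, smul_smul]
        congr 1
        · rw [← add_div, sub_add_cancel, div_self hτ.ne', one_smul]
        · rw [div_mul_cancel₀ _ hτ.ne']
      rw [e] at h3
      simp only [smul_eq_mul] at h3
      have h4 := abs_le.1 (habs hxK)
      have h5 := abs_le.1 (habs hz)
      have e2 : r / τ = 1 - (τ - r) / τ := by field_simp; ring
      rw [e2] at h3
      have h6 : (2 * B / τ) * (τ - r) = (τ - r) / τ * (2 * B) := by ring
      have h7 : (τ - r) / τ * (A.meanLoss 𝒟 t h x - A.meanLoss 𝒟 t h (x + τ • θ)) ≤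
          (τ - r) / τ * (2 * B) := mul_le_mul_of_nonneg_left (by linarith) h1
      have h8 : 0 ≤ L * τ * (τ - r) := by positivity
      linarith
    have hup : A.meanLoss 𝒟 t h (x + τ • θ) - A.meanLoss 𝒟 t h (x + r • θ) ≤
        (2 * B / τ + L * τ) * (τ - r) := by
      -- The increment is at most the outer slope times `τ - r`. The outer slope exceeds the slope
      -- at `x` by at most `m s * τ`, and by convexity the slope at `x` is at most the chord slope.
      have hpt : ∀ s, A.loss t h (x + τ • θ) s - A.loss t h (x + r • θ) s ≤
          (τ - r) * ((A.loss t h (x + τ • θ) s - A.loss t h x s) / τ + m s * τ) := by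
        intro s
        have h1 := (hconv t h s).add_inner_le (hG1 s _ hz) hz hy
        have h2 := (hconv t h s).add_inner_le (hG1 s _ hxK) hxK hz
        have h3 := hG2 s _ hz _ hxK
        rw [add_sub_add_left_eq_sub, ← sub_smul, inner_smul_right] at h1
        rw [add_sub_cancel_left, inner_smul_right] at h2
        rw [add_sub_cancel_left, norm_smul, hθ, mul_one, Real.norm_of_nonneg hτ.le] at h3
        have h4 := real_inner_le_norm (G s (x + τ • θ) - G s x) θ
        rw [inner_sub_left, hθ, mul_one] at h4
        have h5 : inner ℝ (G s x) θ ≤ (A.loss t h (x + τ • θ) s - A.loss t h x s) / τ := by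
          rw [le_div_iff₀ hτ]; linarith
        have h6 := mul_le_mul_of_nonneg_left (h4.trans h3) hr'
        have h7 := mul_le_mul_of_nonneg_left h5 hr'
        nlinarith
      have h1 : ∫ s, (A.loss t h (x + τ • θ) s - A.loss t h (x + r • θ) s) ∂𝒟 ≤
          ∫ s, (τ - r) * ((A.loss t h (x + τ • θ) s - A.loss t h x s) / τ + m s * τ) ∂𝒟 :=
        integral_mono ((hi hz).sub (hi hy))
          (((((hi hz).sub (hi hxK)).div_const τ).add (hmi'.mul_const τ)).const_mul (τ - r)) hpt
      have hid : Integrable (fun s => (A.loss t h (x + τ • θ) s - A.loss t h x s) / τ) 𝒟 :=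
        ((hi hz).sub (hi hxK)).div_const τ
      rw [integral_sub (hi hz) (hi hy), integral_const_mul,
        integral_add hid (hmi'.mul_const τ), integral_div,
        integral_sub (hi hz) (hi hxK), integral_mul_const] at h1
      refine h1.trans ?_
      rw [mul_comm]
      have h4 := abs_le.1 (habs hxK)
      have h5 := abs_le.1 (habs hz)
      unfold meanLoss at h4 h5
      gcongr
      linarith
    exact abs_le.2 ⟨by linarith, hup⟩

end Environment

end MeanLoss

/-! ### Clipping -/

section Clip

/-- Bernoulli's inequality for each factor: `2^(1-α) ≤ 2 - α` and `(α/(1-α))^(1-α) ≤ 2α`. The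
product `(2 - α)·2α` equals `2 - 2(1-α)²`. -/
lemma clip_ratio_rpow_le_two {α : ℝ} (h0 : 0 < α) (h1 : α < 1) :
    (2 * α / (1 - α)) ^ (1 - α) ≤ 2 := by
  have h1' : 0 < 1 - α := by linarith
  have ha : (α / (1 - α)) ^ (1 - α) ≤ 2 * α := by
    have := rpow_one_add_le_one_add_mul_self (s := α / (1 - α) - 1) (p := 1 - α)
      (by linarith [div_nonneg h0.le h1'.le]) h1'.le (by linarith)
    rw [add_sub_cancel] at this
    refine this.trans_eq ?_
    field_simp
    ring
  have hb : (2 : ℝ) ^ (1 - α) ≤ 2 - α := by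
    have := rpow_one_add_le_one_add_mul_self (s := 1) (p := 1 - α) (by norm_num) h1'.le
      (by linarith)
    norm_num at this
    linarith
  rw [mul_div_assoc, Real.mul_rpow (by norm_num) (by positivity)]
  calc (2 : ℝ) ^ (1 - α) * (α / (1 - α)) ^ (1 - α) ≤ (2 - α) * (2 * α) :=
        mul_le_mul hb ha (by positivity) (by linarith)
    _ ≤ 2 := by nlinarith [sq_nonneg (1 - α)]

lemma half_sq_le_rpow {α x : ℝ} (h0 : 0 < α) (h1 : α < 1) (hx : 0 ≤ x)
    (hxκ : x ≤ 2 * α / (1 - α)) : x ^ 2 / 2 ≤ x ^ (α + 1) := by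
  have h1' : 0 < 1 - α := by linarith
  have h2 : x ^ (1 - α) ≤ 2 :=
    (Real.rpow_le_rpow hx hxκ h1'.le).trans (clip_ratio_rpow_le_two h0 h1)
  have h3 : x ^ 2 = x ^ (α + 1) * x ^ (1 - α) := by
    rw [← Real.rpow_add' hx (by linarith), ← Real.rpow_two]
    congr 1
    ring
  have h4 : 0 ≤ x ^ (α + 1) := by positivity
  nlinarith

/-- Above the threshold `κ` the left side is affine in `x`, so a tangent line of the convex power
suffices: at `κ` if `κ > 2`, at `1` if `κ ≤ 2` and `x < 1`. If `κ ≤ 2` and `x ≥ 1`, the left side is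
at most `x`. -/
lemma clipped_le_rpow {α x : ℝ} (h0 : 0 < α) (h1 : α < 1) (hxκ : 2 * α / (1 - α) < x) :
    (2 * α / (1 - α)) ^ 2 / 2 + (x - 2 * α / (1 - α)) ≤ x ^ (α + 1) := by
  have h1' : 0 < 1 - α := by linarith
  set κ := 2 * α / (1 - α) with hκ
  have hκ0 : 0 < κ := by positivity
  have hx : 0 < x := hκ0.trans hxκ
  have hκα : κ * (1 - α) = 2 * α := by rw [hκ]; field_simp
  rcases le_or_gt κ 2 with hκ2 | hκ2
  · rcases le_or_gt 1 x with hx1 | hx1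
    · have := Real.rpow_le_rpow_of_exponent_le hx1 (by linarith : (1 : ℝ) ≤ α + 1)
      rw [Real.rpow_one] at this
      nlinarith
    · have := one_add_mul_self_le_rpow_one_add (s := x - 1) (p := α + 1) (by linarith)
        (by linarith)
      rw [add_sub_cancel] at this
      nlinarith
  · have h2 := half_sq_le_rpow h0 h1 hκ0.le le_rfl
    have h3 := one_add_mul_self_le_rpow_one_add (s := x / κ - 1) (p := α + 1)
      (by linarith [div_nonneg hx.le hκ0.le]) (by linarith)
    rw [add_sub_cancel] at h3
    have h4 : x ^ (α + 1) = κ ^ (α + 1) * (x / κ) ^ (α + 1) := by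
      rw [← Real.mul_rpow hκ0.le (by positivity), mul_div_cancel₀ _ hκ0.ne']
    have h5 : κ ≤ κ ^ (α + 1) := by
      have := Real.rpow_le_rpow_of_exponent_le (by linarith : 1 ≤ κ) (by linarith : (1 : ℝ) ≤ α + 1)
      rwa [Real.rpow_one] at this
    have h6 : 0 ≤ x / κ - 1 := by rw [sub_nonneg, le_div_iff₀ hκ0]; linarith
    have h7 : κ * (x / κ - 1) = x - κ := by field_simp
    calc κ ^ 2 / 2 + (x - κ) ≤ κ ^ (α + 1) + κ ^ (α + 1) * (x / κ - 1) := by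
          rw [← h7]; gcongr
      _ ≤ κ ^ (α + 1) * (1 + (α + 1) * (x / κ - 1)) := by
          have := mul_nonneg h0.le (mul_nonneg (hκ0.le.trans h5) h6)
          linarith
      _ ≤ x ^ (α + 1) := by rw [h4]; gcongr

/-- The trade-off between the second moment of the clipped norm and the clipping bias. -/
lemma clip_tradeoff {α μ D s : ℝ} (h0 : 0 < α) (h1 : α ≤ 1) (hμ : 0 < μ) (hD : 0 < D)
    (hs : 0 ≤ s) :
    μ / 2 * (min (ENNReal.ofReal s) (clipLevel α D μ)).toReal ^ 2 +
      D * (s - (min (ENNReal.ofReal s) (clipLevel α D μ)).toReal) ≤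
        D ^ (1 - α) * μ ^ α * s ^ (α + 1) := by
  rcases h1.eq_or_lt with rfl | h1
  -- For `α = 1` the quotient is a positive number over `0`, which is `∞` in `ℝ≥0∞`. Nothing is
  -- clipped and there is no bias.
  · have : clipLevel 1 D μ = ∞ := by
      rw [clipLevel, sub_self, zero_mul, ENNReal.ofReal_zero, ENNReal.div_zero]
      simpa using hD
    rw [this, min_eq_left le_top, ENNReal.toReal_ofReal hs, sub_self, sub_self, Real.rpow_zero,
      Real.rpow_one, one_add_one_eq_two, Real.rpow_two]
    nlinarith [mul_nonneg hμ.le (sq_nonneg s)]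
  have h1' : 0 < 1 - α := by linarith
  set c := D / μ
  have hc : 0 < c := by positivity
  have hcl : clipLevel α D μ = ENNReal.ofReal (c * (2 * α / (1 - α))) := by
    rw [clipLevel, ← ENNReal.ofReal_div_of_pos (by positivity)]
    congr 1
    simp only [c]
    field_simp
  have hmin : (min (ENNReal.ofReal s) (clipLevel α D μ)).toReal =
      min s (c * (2 * α / (1 - α))) := by
    rw [hcl, ← ENNReal.ofReal_min, ENNReal.toReal_ofReal (le_min hs (by positivity))]
  rw [hmin]
  -- In units of `D/μ` the clipping level is `2α/(1-α)` and both sides scale by `D²/μ`, leaving the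
  -- one-variable inequalities.
  obtain ⟨x, hx⟩ : ∃ x, s = c * x := ⟨s / c, by field_simp⟩
  have hx0 : 0 ≤ x := by
    rw [hx] at hs
    exact nonneg_of_mul_nonneg_right hs hc
  have hscale : D ^ (1 - α) * μ ^ α * s ^ (α + 1) = D ^ 2 / μ * x ^ (α + 1) := by
    rw [hx, Real.mul_rpow hc.le hx0, Real.div_rpow hD.le hμ.le]
    have e1 : D ^ (1 - α) * D ^ (α + 1) = D ^ 2 := by
      rw [← Real.rpow_add hD, ← Real.rpow_two]; congr 1; ring
    have e2 : μ ^ (α + 1) = μ ^ α * μ := by rw [Real.rpow_add hμ, Real.rpow_one]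
    rw [e2, ← e1]
    have : 0 < μ ^ α := by positivity
    field_simp
  have hcD : μ * c ^ 2 = D ^ 2 / μ := by simp only [c]; field_simp
  have hcD' : D * c = D ^ 2 / μ := by simp only [c]; field_simp
  have hDμ : 0 < D ^ 2 / μ := by positivity
  rw [hscale, hx]
  rcases le_or_gt x (2 * α / (1 - α)) with h | h
  · rw [min_eq_left (by gcongr)]
    have := half_sq_le_rpow h0 h1 hx0 h
    calc μ / 2 * (c * x) ^ 2 + D * (c * x - c * x) = μ * c ^ 2 * (x ^ 2 / 2) := by ring
      _ ≤ _ := by rw [hcD]; gcongr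
  · rw [min_eq_right (by gcongr)]
    have := clipped_le_rpow h0 h1 h
    set κ := 2 * α / (1 - α)
    calc μ / 2 * (c * κ) ^ 2 + D * (c * x - c * κ)
        = μ * c ^ 2 * (κ ^ 2 / 2) + D * c * (x - κ) := by ring
      _ = D ^ 2 / μ * (κ ^ 2 / 2 + (x - κ)) := by rw [hcD, hcD']; ring
      _ ≤ _ := by gcongr

variable {n : ℕ}

/-- Clipping multiplies `g` by a scalar in `[0, 1]`, so the bias has norm exactly `s - m`. Hölder's
inequality then reduces the claim to `clip_tradeoff`. -/
lemma inner_sub_clipVec_add_le {p q : ℝ≥0∞} (hpq : p.HolderConjugate q) (hq : 1 ≤ q)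
    {α μ D : ℝ} (h0 : 0 < α) (h1 : α ≤ 1) (hμ : 0 < μ) (hD : 0 < D) (g v : Vec n)
    (hv : lpNormVec p v ≤ D) :
    inner ℝ (g - clipVec q (clipLevel α D μ) g) v +
      μ / 2 * lpNormVec q (clipVec q (clipLevel α D μ) g) ^ 2 ≤
        D ^ (1 - α) * μ ^ α * lpNormVec q g ^ (α + 1) := by
  set s := lpNormVec q g with hs
  have hs0 : 0 ≤ s := lpNormVec_nonneg hq g
  refine le_trans ?_ (clip_tradeoff h0 h1 hμ hD hs0)
  set m := (min (ENNReal.ofReal s) (clipLevel α D μ)).toReal with hm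
  have hm0 : 0 ≤ m := ENNReal.toReal_nonneg
  have hms : m ≤ s := by
    have := ENNReal.toReal_mono ENNReal.ofReal_ne_top
      (min_le_left (ENNReal.ofReal s) (clipLevel α D μ))
    rwa [ENNReal.toReal_ofReal hs0] at this
  have hclip : clipVec q (clipLevel α D μ) g = (m / s) • g := rfl
  have hratio : m / s * s = m := by
    rcases hs0.eq_or_lt with h | h
    · rw [← h] at hms ⊢
      linarith
    · field_simp
  have hle1 : m / s ≤ 1 := div_le_one_of_le₀ hms hs0
  have hn1 : lpNormVec q (clipVec q (clipLevel α D μ) g) = m := by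
    rw [hclip, lpNormVec_smul hq, abs_of_nonneg (by positivity), hratio]
  have hn2 : lpNormVec q (g - clipVec q (clipLevel α D μ) g) = s - m := by
    have : g - clipVec q (clipLevel α D μ) g = (1 - m / s) • g := by
      rw [hclip, sub_smul, one_smul]
    rw [this, lpNormVec_smul hq, abs_of_nonneg (by linarith), sub_mul, one_mul, hratio]
  have hin : inner ℝ (g - clipVec q (clipLevel α D μ) g) v ≤ D * (s - m) := by
    rw [real_inner_comm, ← hn2]
    refine (inner_le_lpNormVec_mul_lpNormVec hpq _ _).trans ?_
    have := lpNormVec_nonneg hq (g - clipVec q (clipLevel α D μ) g)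
    gcongr
  rw [hn1]
  linarith

end Clip

/-! ### The parameters of the algorithm -/

section Parameters

lemma sigmaConst_rpow {n : ℕ} {q : ℝ≥0∞} {α B Δ τ : ℝ} (hα : 0 < α) (ha : 0 ≤ aConst n q)
    (hB : 0 ≤ B) (hΔ : 0 ≤ Δ) (hτ : 0 < τ) :
    sigmaConst n q α B Δ τ ^ (α + 1) =
      (2 : ℝ) ^ α * (n * aConst n q * B / τ) ^ (α + 1)
        + (2 : ℝ) ^ α * (n * aConst n q * Δ / τ) ^ (α + 1) := by
  rw [sigmaConst, ← Real.rpow_mul (by positivity), one_div_mul_cancel (by linarith), Real.rpow_one]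

lemma sigmaConst_pos {n : ℕ} (hn : 0 < n) {q : ℝ≥0∞} {α B Δ τ : ℝ} (ha : 0 < aConst n q)
    (hB : 0 < B) (hΔ : 0 ≤ Δ) (hτ : 0 < τ) : 0 < sigmaConst n q α B Δ τ := by
  have : (0 : ℝ) < n := by exact_mod_cast hn
  unfold sigmaConst
  positivity

/-- Powers with exponent at least `1` are superadditive, so the two terms merge into one containing
`Δ + B`. -/
lemma sigmaConst_le {n : ℕ} {q : ℝ≥0∞} {α B Δ τ : ℝ} (hα : 0 < α) (ha : 0 ≤ aConst n q)
    (hB : 0 ≤ B) (hΔ : 0 ≤ Δ) (hτ : 0 < τ) :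
    sigmaConst n q α B Δ τ ≤ (2 : ℝ) ^ (α / (α + 1)) * (n * aConst n q * (Δ + B) / τ) := by
  have h := Real.add_rpow_le_rpow_add (a := n * aConst n q * B / τ) (b := n * aConst n q * Δ / τ)
    (p := α + 1) (by positivity) (by positivity) (by linarith)
  unfold sigmaConst
  rw [← mul_add]
  calc _ ≤ ((2 : ℝ) ^ α * (n * aConst n q * B / τ + n * aConst n q * Δ / τ) ^ (α + 1))
        ^ (1 / (α + 1)) := by gcongr
    _ = (2 : ℝ) ^ (α / (α + 1)) * (n * aConst n q * B / τ + n * aConst n q * Δ / τ) := by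
        rw [Real.mul_rpow (by positivity) (by positivity), ← Real.rpow_mul (by norm_num),
          ← Real.rpow_mul (by positivity), mul_one_div_cancel (by linarith), Real.rpow_one,
          mul_one_div]
    _ = _ := by ring

lemma stepSize_pos {α R D σ : ℝ} {T : ℕ} (hT : 1 ≤ T) (hR : 0 < R) (hD : 0 < D) (hσ : 0 < σ) :
    0 < stepSize α T R D σ := by
  have : (0 : ℝ) < T := by exact_mod_cast hT
  unfold stepSize
  positivity

/-- The defining property of the stepsize: the accumulated moment terms equal half of the mirror
descent term `R²/(2μ)`. -/
lemma stepSize_balance {α R D σ : ℝ} {T : ℕ} (hα : 0 < α) (hT : 1 ≤ T) (hR : 0 < R) (hD : 0 < D)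
    (hσ : 0 < σ) :
    T * (D ^ (1 - α) * stepSize α T R D σ ^ α * σ ^ (α + 1)) = R ^ 2 / (4 * stepSize α T R D σ) := by
  have hT' : (0 : ℝ) < T := by exact_mod_cast hT
  have hμ := stepSize_pos (α := α) hT hR hD hσ
  have h1 : stepSize α T R D σ ^ α * stepSize α T R D σ =
      R ^ 2 / (4 * T * σ ^ (α + 1) * D ^ (1 - α)) := by
    rw [← Real.rpow_add_one hμ.ne', stepSize, ← Real.rpow_mul (by positivity),
      one_div_mul_cancel (by linarith), Real.rpow_one]
  have hσ' : 0 < σ ^ (α + 1) := by positivity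
  have hD' : 0 < D ^ (1 - α) := by positivity
  rw [eq_div_iff (by positivity)]
  calc _ = 4 * T * D ^ (1 - α) * σ ^ (α + 1) * (stepSize α T R D σ ^ α * stepSize α T R D σ) := by
        ring
    _ = R ^ 2 := by rw [h1]; field_simp

lemma sq_div_stepSize {α R D σ : ℝ} {T : ℕ} (hα : 0 < α) (hT : 1 ≤ T) (hR : 0 < R) (hD : 0 < D)
    (hσ : 0 < σ) :
    R ^ 2 / stepSize α T R D σ = (4 : ℝ) ^ (1 / (α + 1)) * σ * (T : ℝ) ^ (1 / (α + 1)) *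
      (R ^ (2 * α / (α + 1)) * D ^ ((1 - α) / (α + 1))) := by
  have hT' : (0 : ℝ) < T := by exact_mod_cast hT
  have hα1 : α + 1 ≠ 0 := by linarith
  have hRR : R ^ 2 = R ^ (2 * α / (α + 1)) * R ^ (2 * (1 / (α + 1))) := by
    rw [← Real.rpow_add hR, ← Real.rpow_two]
    congr 1
    field_simp
  have hden : stepSize α T R D σ = R ^ (2 * (1 / (α + 1))) /
      ((4 : ℝ) ^ (1 / (α + 1)) * (T : ℝ) ^ (1 / (α + 1)) * σ * D ^ ((1 - α) / (α + 1))) := by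
    rw [stepSize, Real.div_rpow (by positivity) (by positivity), Real.mul_rpow (by positivity)
      (by positivity), Real.mul_rpow (by positivity) (by positivity),
      Real.mul_rpow (by positivity) (by positivity), ← Real.rpow_mul hσ.le,
      mul_one_div_cancel hα1, Real.rpow_one, ← Real.rpow_mul hD.le, mul_one_div, ← Real.rpow_two,
      ← Real.rpow_mul hR.le]
  have h1 : 0 < R ^ (2 * (1 / (α + 1))) := by positivity
  have h2 : 0 < (4 : ℝ) ^ (1 / (α + 1)) := by positivity
  have h3 : 0 < (T : ℝ) ^ (1 / (α + 1)) := by positivity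
  have h4 : 0 < D ^ ((1 - α) / (α + 1)) := by positivity
  rw [hRR, hden]
  field_simp

/-- The regret of the mirror descent steps with the prescribed stepsize. -/
lemma mirror_regret_le {n : ℕ} (hn : 0 < n) {q : ℝ≥0∞} {α B Δ τ R D : ℝ} {T : ℕ} (hα : 0 < α)
    (hT : 1 ≤ T) (ha : 0 < aConst n q) (hB : 0 < B) (hΔ : 0 ≤ Δ) (hτ : 0 < τ) (hR : 0 < R)
    (hD : 0 < D) :
    1 / (T : ℝ) * (3 / 4 * (R ^ 2 / stepSize α T R D (sigmaConst n q α B Δ τ))) ≤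
      3 * (R ^ (2 * α / (α + 1)) * D ^ ((1 - α) / (α + 1)) * n * aConst n q * (Δ + B))
        / (τ * (T : ℝ) ^ (α / (α + 1))) := by
  have hT' : (0 : ℝ) < T := by exact_mod_cast hT
  have hα1 : α + 1 ≠ 0 := by linarith
  have hσ := sigmaConst_pos (α := α) hn ha hB hΔ hτ
  rw [sq_div_stepSize hα hT hR hD hσ]
  have hσle := sigmaConst_le hα ha.le hB.le hΔ hτ
  set σ := sigmaConst n q α B Δ τ
  set K := R ^ (2 * α / (α + 1)) * D ^ ((1 - α) / (α + 1))
  have hK : 0 < K := by positivity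
  have hT2 : (T : ℝ) ^ (1 / (α + 1)) * (T : ℝ) ^ (α / (α + 1)) = T := by
    rw [← Real.rpow_add hT', ← add_div, add_comm 1 α, div_self hα1, Real.rpow_one]
  -- Together with the factor `3/4` this produces the constant `3`.
  have hc : (4 : ℝ) ^ (1 / (α + 1)) * (2 : ℝ) ^ (α / (α + 1)) ≤ 4 := by
    calc (4 : ℝ) ^ (1 / (α + 1)) * (2 : ℝ) ^ (α / (α + 1))
        ≤ (4 : ℝ) ^ (1 / (α + 1)) * (4 : ℝ) ^ (α / (α + 1)) := by gcongr; norm_num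
      _ = 4 := by
        rw [← Real.rpow_add (by norm_num), ← add_div, add_comm 1 α, div_self hα1, Real.rpow_one]
  have h4σ : (4 : ℝ) ^ (1 / (α + 1)) * σ ≤ 4 * (n * aConst n q * (Δ + B) / τ) := by
    calc (4 : ℝ) ^ (1 / (α + 1)) * σ
        ≤ (4 : ℝ) ^ (1 / (α + 1)) *
            ((2 : ℝ) ^ (α / (α + 1)) * (n * aConst n q * (Δ + B) / τ)) := by gcongr
      _ = (4 : ℝ) ^ (1 / (α + 1)) * (2 : ℝ) ^ (α / (α + 1)) *
            (n * aConst n q * (Δ + B) / τ) := by ring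
      _ ≤ _ := by gcongr
  have hTβ : 0 < (T : ℝ) ^ (α / (α + 1)) := by positivity
  have hTβ' : 0 < (T : ℝ) ^ (1 / (α + 1)) := by positivity
  have hTinv : 1 / (T : ℝ) * (T : ℝ) ^ (1 / (α + 1)) = 1 / (T : ℝ) ^ (α / (α + 1)) := by
    rw [div_mul_eq_mul_div, one_mul, div_eq_div_iff hT'.ne' hTβ.ne', hT2, one_mul]
  calc _ = 3 / 4 * ((4 : ℝ) ^ (1 / (α + 1)) * σ) * K * (1 / (T : ℝ) * (T : ℝ) ^ (1 / (α + 1))) := by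
        ring
    _ ≤ 3 / 4 * (4 * (n * aConst n q * (Δ + B) / τ)) * K *
          (1 / (T : ℝ) * (T : ℝ) ^ (1 / (α + 1))) := by gcongr
    _ = _ := by
      rw [hTinv]
      field_simp

end Parameters

/-! ### The expected behaviour of a single round -/

section Round

/-- Used twice: for direction and loss noise within a round, and for the past and the current draw.
-/
lemma integrable_prod_of_forall_integral_abs_le {X Y : Type*} [MeasurableSpace X]
    [MeasurableSpace Y] {μ : Measure X} {ν : Measure Y} [SFinite μ] [SFinite ν]
    {F : X × Y → ℝ} (hF : Measurable F) {c : X → ℝ} (hc : Integrable c μ)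
    (hi : ∀ᵐ x ∂μ, Integrable (fun y => F (x, y)) ν)
    (hle : ∀ᵐ x ∂μ, ∫ y, |F (x, y)| ∂ν ≤ c x) :
    Integrable F (μ.prod ν) ∧ ∫ a, |F a| ∂(μ.prod ν) ≤ ∫ x, c x ∂μ := by
  have hm : AEStronglyMeasurable (fun x => ∫ y, |F (x, y)| ∂ν) μ :=
    (hF.abs.stronglyMeasurable.integral_prod_right' (ν := ν)).aestronglyMeasurable
  have hm' : Integrable (fun x => ∫ y, |F (x, y)| ∂ν) μ := by
    refine hc.mono' hm ?_
    filter_upwards [hle] with x hx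
    rwa [Real.norm_of_nonneg (integral_nonneg fun y => abs_nonneg _)]
  have hint : Integrable F (μ.prod ν) :=
    (integrable_prod_iff hF.aestronglyMeasurable).2 ⟨hi, hm'⟩
  refine ⟨hint, ?_⟩
  rw [integral_prod _ hint.abs]
  exact integral_mono_ae hm' hc hle

/-- With `s = α + 1` this is the source of the factors `2^α` in `sigmaConst`. -/
lemma abs_add_rpow_le {s : ℝ} (hs : 1 ≤ s) (a b : ℝ) :
    |a + b| ^ s ≤ (2 : ℝ) ^ (s - 1) * (|a| ^ s + |b| ^ s) := by
  have h := Real.rpow_sum_le_const_mul_sum_rpow Finset.univ ![a, b] hs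
  simp only [Fin.sum_univ_two, Finset.card_univ, Fintype.card_fin, Matrix.cons_val_zero,
    Matrix.cons_val_one] at h
  refine le_trans ?_ h
  have := abs_add_le a b
  gcongr

variable {n : ℕ} {Ξ : Type*} [MeasurableSpace Ξ]

/-- The one-point estimate in round `t`, as a function of the current randomness. -/
def roundGrad (A : Environment n Ξ) (τ : ℝ) (t : ℕ) (h : History n Ξ t) (x : Vec n)
    (a : Vec n × Ξ) : Vec n :=
  ((n : ℝ) / τ * (A.loss t h (x + τ • a.1) a.2 + A.noise t h (x + τ • a.1))) • a.1

lemma measurable_roundGrad (A : Environment n Ξ) (τ : ℝ) (t : ℕ) :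
    Measurable fun b : (History n Ξ t × Vec n) × (Vec n × Ξ) => roundGrad A τ t b.1.1 b.1.2 b.2 := by
  have h1 : Measurable fun b : (History n Ξ t × Vec n) × (Vec n × Ξ) =>
      A.loss t b.1.1 (b.1.2 + τ • b.2.1) b.2.2 :=
    (A.measurable_loss t).comp (by fun_prop : Measurable
      fun b : (History n Ξ t × Vec n) × (Vec n × Ξ) => (b.1.1, b.1.2 + τ • b.2.1, b.2.2))
  have h2 : Measurable fun b : (History n Ξ t × Vec n) × (Vec n × Ξ) =>
      A.noise t b.1.1 (b.1.2 + τ • b.2.1) :=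
    (A.measurable_noise t).comp (by fun_prop : Measurable
      fun b : (History n Ξ t × Vec n) × (Vec n × Ξ) => (b.1.1, b.1.2 + τ • b.2.1))
  unfold roundGrad
  exact ((h1.add h2).const_mul _).smul (by fun_prop)

/-- A bound on the part of the regret in round `t` that is not controlled by mirror descent. -/
def roundExcess (A : Environment n Ξ) (𝒟 : Measure Ξ) (q : ℝ≥0∞) (τ α κ : ℝ) (u : Vec n) (t : ℕ)
    (h : History n Ξ t) (x : Vec n) (a : Vec n × Ξ) : ℝ :=
  A.meanLoss 𝒟 t h (x + τ • a.1) - A.meanLoss 𝒟 t h u - inner ℝ (roundGrad A τ t h x a) (x - u)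
    + κ * lpNormVec q (roundGrad A τ t h x a) ^ (α + 1)

lemma measurable_roundExcess (A : Environment n Ξ) (𝒟 : Measure Ξ) [SFinite 𝒟] {q : ℝ≥0∞}
    (hq : 1 ≤ q) (τ α κ : ℝ) (u : Vec n) (t : ℕ) :
    Measurable fun b : (History n Ξ t × Vec n) × (Vec n × Ξ) =>
      roundExcess A 𝒟 q τ α κ u t b.1.1 b.1.2 b.2 := by
  have h1 : Measurable fun b : (History n Ξ t × Vec n) × (Vec n × Ξ) =>
      A.meanLoss 𝒟 t b.1.1 (b.1.2 + τ • b.2.1) :=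
    (A.measurable_meanLoss t).comp (by fun_prop : Measurable
      fun b : (History n Ξ t × Vec n) × (Vec n × Ξ) => (b.1.1, b.1.2 + τ • b.2.1))
  have h2 : Measurable fun b : (History n Ξ t × Vec n) × (Vec n × Ξ) =>
      A.meanLoss 𝒟 t b.1.1 u :=
    (A.measurable_meanLoss t).comp (by fun_prop : Measurable
      fun b : (History n Ξ t × Vec n) × (Vec n × Ξ) => (b.1.1, u))
  have h3 := measurable_roundGrad A τ t
  unfold roundExcess
  refine ((h1.sub h2).sub (h3.inner (by fun_prop))).add ?_
  exact (((continuous_lpNormVec hq).measurable.comp h3).pow_const _).const_mul _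

variable {A : Environment n Ξ} {𝒟 : Measure Ξ} [IsProbabilityMeasure 𝒟] {S : Set (Vec n)}
  {τ α B Δ b : ℝ}

/-- The moments of the one-point estimate. -/
lemma integral_lpNormVec_roundGrad_le (hn : 2 ≤ n) {q : ℝ≥0∞} (hq : 2 ≤ q) (hα0 : 0 < α)
    (hα1 : α ≤ 1) (hB : 0 < B) (hΔ : 0 ≤ Δ) (hτ : 0 < τ) (hbdd : A.BoundedLoss 𝒟 S τ α B)
    (hnoise : A.BoundedNoise S τ Δ) (t : ℕ) (h : History n Ξ t) {x : Vec n} (hx : x ∈ S) :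
    Integrable (fun a => lpNormVec q (roundGrad A τ t h x a) ^ (α + 1))
        ((unifSphere n).prod 𝒟) ∧
      ∫ a, lpNormVec q (roundGrad A τ t h x a) ^ (α + 1) ∂((unifSphere n).prod 𝒟) ≤
        sigmaConst n q α B Δ τ ^ (α + 1) := by
  have : NeZero n := ⟨by omega⟩
  have hn0 : (0 : ℝ) < n := by positivity
  have hq1 : 1 ≤ q := le_trans (by norm_num) hq
  have hg : ∀ a, 0 ≤ lpNormVec q (roundGrad A τ t h x a) ^ (α + 1) := fun a =>
    Real.rpow_nonneg (lpNormVec_nonneg hq1 _) _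
  have hmeas : Measurable fun a => lpNormVec q (roundGrad A τ t h x a) ^ (α + 1) :=
    ((continuous_lpNormVec hq1).measurable.comp
      ((measurable_roundGrad A τ t).comp (measurable_prodMk_left (x := (h, x))))).pow_const _
  set c : ℝ := (n / τ) ^ (α + 1) * ((2 : ℝ) ^ α * (B ^ (α + 1) + Δ ^ (α + 1)))
  have hpt : ∀ θ : Vec n, x + τ • θ ∈ enlarge S τ → ∀ s,
      lpNormVec q (roundGrad A τ t h x (θ, s)) ^ (α + 1) ≤
        (n / τ) ^ (α + 1) * lpNormVec q θ ^ (α + 1) *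
          ((2 : ℝ) ^ α * (|A.loss t h (x + τ • θ) s| ^ (α + 1) + Δ ^ (α + 1))) := by
    intro θ hθ s
    have h1 := abs_add_rpow_le (s := α + 1) (by linarith) (A.loss t h (x + τ • θ) s)
      (A.noise t h (x + τ • θ))
    rw [add_sub_cancel_right] at h1
    have h2 : |A.noise t h (x + τ • θ)| ^ (α + 1) ≤ Δ ^ (α + 1) :=
      Real.rpow_le_rpow (abs_nonneg _) (hnoise t h _ hθ) (by linarith)
    have hθ0 := lpNormVec_nonneg hq1 θ
    rw [roundGrad, lpNormVec_smul hq1, abs_mul, abs_of_pos (by positivity : (0 : ℝ) < n / τ),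
      Real.mul_rpow (by positivity) hθ0, Real.mul_rpow (by positivity) (by positivity)]
    calc _ = (n / τ) ^ (α + 1) * lpNormVec q θ ^ (α + 1) *
          |A.loss t h (x + τ • θ) s + A.noise t h (x + τ • θ)| ^ (α + 1) := by ring
      _ ≤ (n / τ) ^ (α + 1) * lpNormVec q θ ^ (α + 1) * ((2 : ℝ) ^ α *
          (|A.loss t h (x + τ • θ) s| ^ (α + 1) + |A.noise t h (x + τ • θ)| ^ (α + 1))) := by
            gcongr
      _ ≤ _ := by gcongr
  have hbound : ∀ θ : Vec n, x + τ • θ ∈ enlarge S τ → Integrable (fun s =>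
      (n / τ) ^ (α + 1) * lpNormVec q θ ^ (α + 1) *
          ((2 : ℝ) ^ α * (|A.loss t h (x + τ • θ) s| ^ (α + 1) + Δ ^ (α + 1)))) 𝒟 := fun θ hθ =>
    (((hbdd t h _ hθ).1.add (integrable_const _)).const_mul _).const_mul _
  have hcint : Integrable (fun θ : Vec n => c * lpNormVec q θ ^ (α + 1)) (unifSphere n) :=
    integrable_unifSphere_of_continuous
      (((continuous_lpNormVec hq1).rpow_const fun _ => Or.inr (by linarith)).const_mul c)
  obtain ⟨h1, h2⟩ := integrable_prod_of_forall_integral_abs_le (μ := unifSphere n) (ν := 𝒟)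
    hmeas hcint (by
      filter_upwards [IsRoundLoss.ae_add_smul_mem hτ.le hx] with θ hθ
      refine (hbound θ hθ).mono' (hmeas.comp measurable_prodMk_left).aestronglyMeasurable ?_
      refine Filter.Eventually.of_forall fun s => ?_
      rw [Real.norm_of_nonneg (hg _)]
      exact hpt θ hθ s) (by
      filter_upwards [IsRoundLoss.ae_add_smul_mem hτ.le hx] with θ hθ
      have hθ0 := lpNormVec_nonneg hq1 θ
      calc ∫ s, |lpNormVec q (roundGrad A τ t h x (θ, s)) ^ (α + 1)| ∂𝒟
          ≤ ∫ s, (n / τ) ^ (α + 1) * lpNormVec q θ ^ (α + 1) *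
            ((2 : ℝ) ^ α * (|A.loss t h (x + τ • θ) s| ^ (α + 1) + Δ ^ (α + 1))) ∂𝒟 := by
            refine integral_mono_of_nonneg (Filter.Eventually.of_forall fun s => abs_nonneg _)
              (hbound θ hθ) (Filter.Eventually.of_forall fun s => ?_)
            dsimp only
            rw [abs_of_nonneg (hg _)]
            exact hpt θ hθ s
        _ = (n / τ) ^ (α + 1) * lpNormVec q θ ^ (α + 1) *
            ((2 : ℝ) ^ α * ((∫ s, |A.loss t h (x + τ • θ) s| ^ (α + 1) ∂𝒟) + Δ ^ (α + 1))) := by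
            rw [integral_const_mul, integral_const_mul,
              integral_add (hbdd t h _ hθ).1 (integrable_const _)]
            simp
        _ ≤ (n / τ) ^ (α + 1) * lpNormVec q θ ^ (α + 1) *
            ((2 : ℝ) ^ α * (B ^ (α + 1) + Δ ^ (α + 1))) := by
            gcongr
            exact (hbdd t h _ hθ).2
        _ = c * lpNormVec q θ ^ (α + 1) := by simp only [c]; ring)
  refine ⟨h1, ?_⟩
  simp only [abs_of_nonneg (hg _)] at h2
  refine h2.trans ?_
  rw [integral_const_mul]
  have ha := aConst_pos hn hq
  calc c * ∫ θ, lpNormVec q θ ^ (α + 1) ∂(unifSphere n) ≤ c * aConst n q ^ (α + 1) := by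
        gcongr
        exact lpNormVec_moment_le_aConst hn hq (by linarith) (by linarith)
    _ = _ := by
        rw [sigmaConst_rpow hα0 ha.le hB.le hΔ hτ]
        have e : ∀ C : ℝ, 0 ≤ C → (n * aConst n q * C / τ) ^ (α + 1) =
            (n / τ) ^ (α + 1) * aConst n q ^ (α + 1) * C ^ (α + 1) := by
          intro C hC
          rw [← Real.mul_rpow (by positivity) ha.le, ← Real.mul_rpow (by positivity) hC]
          congr 1
          ring
        rw [e B hB.le, e Δ hΔ]
        ring

/-- The bias of the one-point estimate. -/
lemma integral_inner_roundGrad (hn : 2 ≤ n) (hα : 0 ≤ α) (hB : 0 ≤ B) (hΔ : 0 ≤ Δ) (hτ : 0 < τ)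
    (hc : IsCompact S) (hbdd : A.BoundedLoss 𝒟 S τ α B) (hnoise : A.BoundedNoise S τ Δ) (t : ℕ)
    (h : History n Ξ t) (hf : IsRoundLoss S τ B b (A.meanLoss 𝒟 t h)) {x u : Vec n} (hx : x ∈ S)
    (hu : u ∈ S) {D : ℝ} (hD : ‖u - x‖ ≤ D) :
    Integrable (fun a => inner ℝ (roundGrad A τ t h x a) (x - u)) ((unifSphere n).prod 𝒟) ∧
      ∫ a, |inner ℝ (roundGrad A τ t h x a) (x - u)| ∂((unifSphere n).prod 𝒟) ≤
        n / τ * (B + Δ) * D ∧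
      - ∫ a, inner ℝ (roundGrad A τ t h x a) (x - u) ∂((unifSphere n).prod 𝒟) ≤
        A.meanLoss 𝒟 t h u - A.meanLoss 𝒟 t h x + b + Δ * √n / τ * D := by
  have : NeZero n := ⟨by omega⟩
  have hn0 : (0 : ℝ) < n := by positivity
  have hD0 : 0 ≤ D := (norm_nonneg _).trans hD
  have hmeas : Measurable fun a => inner ℝ (roundGrad A τ t h x a) (x - u) :=
    ((measurable_roundGrad A τ t).comp (measurable_prodMk_left (x := (h, x)))).inner
      measurable_const
  have heq : ∀ θ s, inner ℝ (roundGrad A τ t h x (θ, s)) (x - u) =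
      n / τ * inner ℝ θ (x - u) * (A.loss t h (x + τ • θ) s + A.noise t h (x + τ • θ)) := by
    intro θ s
    rw [roundGrad, real_inner_smul_left]
    ring
  have hli : ∀ θ : Vec n, x + τ • θ ∈ enlarge S τ →
      Integrable (fun s => A.loss t h (x + τ • θ) s + A.noise t h (x + τ • θ)) 𝒟 := fun θ hθ =>
    (hbdd.integrable hα hB t h hθ).add (integrable_const _)
  obtain ⟨h1, h2⟩ := integrable_prod_of_forall_integral_abs_le (μ := unifSphere n) (ν := 𝒟)
    (c := fun _ => n / τ * (B + Δ) * D) hmeas (integrable_const _) (by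
      filter_upwards [IsRoundLoss.ae_add_smul_mem hτ.le hx] with θ hθ
      simp only [heq]
      exact (hli θ hθ).const_mul _) (by
      filter_upwards [IsRoundLoss.ae_add_smul_mem hτ.le hx, ae_norm_eq_one_unifSphere n]
        with θ hθ hθ1
      simp only [heq, abs_mul]
      rw [integral_const_mul]
      have h3 : ∫ s, |A.loss t h (x + τ • θ) s + A.noise t h (x + τ • θ)| ∂𝒟 ≤ B + Δ := by
        calc _ ≤ ∫ s, (|A.loss t h (x + τ • θ) s| + Δ) ∂𝒟 :=
              integral_mono (hli θ hθ).abs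
                ((hbdd.integrable hα hB t h hθ).abs.add (integrable_const _)) fun s =>
                (abs_add_le _ _).trans (add_le_add_right (hnoise t h _ hθ) _)
          _ = (∫ s, |A.loss t h (x + τ • θ) s| ∂𝒟) + Δ := by
              rw [integral_add (hbdd.integrable hα hB t h hθ).abs (integrable_const _)]
              simp
          _ ≤ _ := by
              gcongr
              exact hbdd.integral_abs_le hα hB t h hθ
      have h4 : |inner ℝ θ (x - u)| ≤ D := by
        refine (abs_real_inner_le_norm _ _).trans ?_
        rwa [hθ1, one_mul, norm_sub_rev]
      rw [abs_of_pos (by positivity : (0 : ℝ) < n / τ)]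
      calc _ ≤ n / τ * D * (B + Δ) := by gcongr
        _ = _ := by ring)
  refine ⟨h1, by simpa using h2, ?_⟩
  have hinner : ∀ᵐ θ ∂(unifSphere n), |inner ℝ θ (u - x)| ≤ ‖u - x‖ := by
    filter_upwards [ae_norm_eq_one_unifSphere n] with θ hθ
    simpa [hθ] using abs_real_inner_le_norm θ (u - x)
  have hfi : Integrable (fun θ => A.meanLoss 𝒟 t h (x + τ • θ) * inner ℝ θ (u - x))
      (unifSphere n) := by
    refine (hf.integrable_sphere hτ.le hx).mul_bdd (c := ‖u - x‖)
      (Continuous.aestronglyMeasurable (by fun_prop)) hinner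
  have hni : Integrable (fun θ => A.noise t h (x + τ • θ) * inner ℝ θ (u - x))
      (unifSphere n) := by
    have : Integrable (fun θ => A.noise t h (x + τ • θ)) (unifSphere n) := by
      refine Integrable.of_bound (C := Δ)
        ((A.measurable_noise_right t h).comp (by fun_prop)).aestronglyMeasurable ?_
      filter_upwards [IsRoundLoss.ae_add_smul_mem hτ.le hx] with θ hθ
      exact hnoise t h _ hθ
    exact this.mul_bdd (c := ‖u - x‖) (Continuous.aestronglyMeasurable (by fun_prop)) hinner
  have hval : - ∫ a, inner ℝ (roundGrad A τ t h x a) (x - u) ∂((unifSphere n).prod 𝒟) =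
      n / τ * ∫ θ, A.meanLoss 𝒟 t h (x + τ • θ) * inner ℝ θ (u - x) ∂(unifSphere n) +
      n / τ * ∫ θ, A.noise t h (x + τ • θ) * inner ℝ θ (u - x) ∂(unifSphere n) := by
    rw [integral_prod _ h1, ← integral_neg, ← integral_const_mul, ← integral_const_mul,
      ← integral_add (hfi.const_mul _) (hni.const_mul _)]
    refine integral_congr_ae ?_
    filter_upwards [IsRoundLoss.ae_add_smul_mem hτ.le hx] with θ hθ
    simp only [heq]
    rw [integral_const_mul, integral_add (hbdd.integrable hα hB t h hθ) (integrable_const _),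
      ← neg_sub u x, inner_neg_right]
    simp only [integral_const, probReal_univ, one_smul, Environment.meanLoss]
    ring
  -- The mean of `|⟨θ, u - x⟩|` is smaller than its maximum by `√n`, which turns the factor `n/τ`
  -- into `√n/τ`.
  have hnb : ∫ θ, A.noise t h (x + τ • θ) * inner ℝ θ (u - x) ∂(unifSphere n) ≤
      Δ * (D / √n) := by
    calc _ ≤ ∫ θ, Δ * |inner ℝ θ (u - x)| ∂(unifSphere n) := by
          refine integral_mono_ae hni ((integrable_unifSphere_of_continuous
            (by fun_prop)).const_mul _) ?_
          filter_upwards [IsRoundLoss.ae_add_smul_mem hτ.le hx] with θ hθ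
          refine (le_abs_self _).trans ?_
          rw [abs_mul]
          gcongr
          exact hnoise t h _ hθ
      _ = Δ * ∫ θ, |inner ℝ θ (u - x)| ∂(unifSphere n) := integral_const_mul _ _
      _ ≤ Δ * (D / √n) := by
          gcongr
          refine (integral_abs_inner_unifSphere_le _).trans ?_
          gcongr
  have hsq : n / τ * (Δ * (D / √n)) = Δ * √n / τ * D := by
    have h5 : √(n : ℝ) * √n = n := Real.mul_self_sqrt hn0.le
    have h6 : √(n : ℝ) ≠ 0 := (Real.sqrt_pos.2 hn0).ne'
    field_simp
    rw [sq, h5]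
    ring
  rw [hval, ← hsq]
  have h7 := hf.integral_sphere_inner_le hτ hB hc hx hu
  have h8 : n / τ * ∫ θ, A.noise t h (x + τ • θ) * inner ℝ θ (u - x) ∂(unifSphere n) ≤
      n / τ * (Δ * (D / √n)) := by gcongr
  linarith

/-- The loss at `x` cancels between the sphere mean and the bias bound, each of which contributes
one `b`. The bound on the absolute value is uniform in the history, which later gives integrability
over random pasts. -/
lemma integral_roundExcess_le (hn : 2 ≤ n) {q : ℝ≥0∞} (hq : 2 ≤ q) (hα0 : 0 < α) (hα1 : α ≤ 1)
    (hB : 0 < B) (hΔ : 0 ≤ Δ) (hτ : 0 < τ) (hc : IsCompact S) (hbdd : A.BoundedLoss 𝒟 S τ α B)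
    (hnoise : A.BoundedNoise S τ Δ) (t : ℕ) (h : History n Ξ t)
    (hf : IsRoundLoss S τ B b (A.meanLoss 𝒟 t h)) {x u : Vec n} (hx : x ∈ S)
    (hu : u ∈ S) {D : ℝ} (hD : ‖u - x‖ ≤ D) {κ : ℝ} (hκ : 0 ≤ κ) :
    Integrable (roundExcess A 𝒟 q τ α κ u t h x) ((unifSphere n).prod 𝒟) ∧
      ∫ a, |roundExcess A 𝒟 q τ α κ u t h x a| ∂((unifSphere n).prod 𝒟) ≤
        2 * B + n / τ * (B + Δ) * D + κ * sigmaConst n q α B Δ τ ^ (α + 1) ∧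
      ∫ a, roundExcess A 𝒟 q τ α κ u t h x a ∂((unifSphere n).prod 𝒟) ≤
        2 * b + Δ * √n / τ * D + κ * sigmaConst n q α B Δ τ ^ (α + 1) := by
  have : NeZero n := ⟨by omega⟩
  have hq1 : 1 ≤ q := le_trans (by norm_num) hq
  obtain ⟨hG1, hG2⟩ := integral_lpNormVec_roundGrad_le hn hq hα0 hα1 hB hΔ hτ hbdd hnoise t h hx
  obtain ⟨hI1, hI2, hI3⟩ := integral_inner_roundGrad hn hα0.le hB.le hΔ hτ hc hbdd hnoise t h hf
    hx hu hD
  set Q := (unifSphere n).prod 𝒟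
  have hz : ∀ᵐ a ∂Q, x + τ • a.1 ∈ enlarge S τ :=
    (Measure.quasiMeasurePreserving_fst (μ := unifSphere n) (ν := 𝒟)).ae
      (IsRoundLoss.ae_add_smul_mem hτ.le hx)
  have hfi : Integrable (fun a : Vec n × Ξ => A.meanLoss 𝒟 t h (x + τ • a.1)) Q :=
    (hf.integrable_sphere hτ.le hx).comp_fst 𝒟
  have hfa : ∫ a : Vec n × Ξ, |A.meanLoss 𝒟 t h (x + τ • a.1)| ∂Q ≤ B := by
    calc _ ≤ ∫ _a : Vec n × Ξ, B ∂Q := by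
          refine integral_mono_ae hfi.abs (integrable_const _) ?_
          filter_upwards [hz] with a ha
          exact hf.abs_le _ ha
      _ = B := by simp
  have hfu : |A.meanLoss 𝒟 t h u| ≤ B := hf.abs_le u (mem_enlarge hτ.le hu)
  have hfm : ∫ a : Vec n × Ξ, A.meanLoss 𝒟 t h (x + τ • a.1) ∂Q ≤ A.meanLoss 𝒟 t h x + b := by
    have := integral_fun_fst (μ := unifSphere n) (ν := 𝒟) (fun θ => A.meanLoss 𝒟 t h (x + τ • θ))
    simp only [probReal_univ, one_smul] at this
    rw [this]
    exact hf.integral_sphere_le hτ.le hx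
  have hfi' : Integrable
      (fun a : Vec n × Ξ => A.meanLoss 𝒟 t h (x + τ • a.1) - A.meanLoss 𝒟 t h u) Q :=
    hfi.sub (integrable_const _)
  have hfi'' : Integrable (fun a : Vec n × Ξ => A.meanLoss 𝒟 t h (x + τ • a.1) -
      A.meanLoss 𝒟 t h u - inner ℝ (roundGrad A τ t h x a) (x - u)) Q := hfi'.sub hI1
  have hint : Integrable (roundExcess A 𝒟 q τ α κ u t h x) Q := hfi''.add (hG1.const_mul κ)
  refine ⟨hint, ?_, ?_⟩
  · have hbi : Integrable (fun a : Vec n × Ξ => |A.meanLoss 𝒟 t h (x + τ • a.1)| + B) Q :=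
      hfi.abs.add (integrable_const _)
    have hbi' : Integrable (fun a : Vec n × Ξ => |A.meanLoss 𝒟 t h (x + τ • a.1)| + B +
        |inner ℝ (roundGrad A τ t h x a) (x - u)|) Q := hbi.add hI1.abs
    calc _ ≤ ∫ a : Vec n × Ξ, (|A.meanLoss 𝒟 t h (x + τ • a.1)| + B +
          |inner ℝ (roundGrad A τ t h x a) (x - u)| +
          κ * lpNormVec q (roundGrad A τ t h x a) ^ (α + 1)) ∂Q := by
          refine integral_mono hint.abs (hbi'.add (hG1.const_mul κ)) fun a => ?_
          have h0 : 0 ≤ κ * lpNormVec q (roundGrad A τ t h x a) ^ (α + 1) :=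
            mul_nonneg hκ (Real.rpow_nonneg (lpNormVec_nonneg hq1 _) _)
          refine (abs_add_le _ _).trans ?_
          rw [abs_of_nonneg h0]
          gcongr
          refine (abs_sub _ _).trans ?_
          gcongr
          exact (abs_sub _ _).trans (by gcongr)
      _ = (∫ a : Vec n × Ξ, |A.meanLoss 𝒟 t h (x + τ • a.1)| ∂Q) + B +
          (∫ a, |inner ℝ (roundGrad A τ t h x a) (x - u)| ∂Q) +
          κ * ∫ a, lpNormVec q (roundGrad A τ t h x a) ^ (α + 1) ∂Q := by
          rw [integral_add hbi' (hG1.const_mul κ), integral_add hbi hI1.abs,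
            integral_add hfi.abs (integrable_const _), integral_const_mul]
          simp
      _ ≤ _ := by
          have := mul_le_mul_of_nonneg_left hG2 hκ
          linarith
  · have hval : ∫ a, roundExcess A 𝒟 q τ α κ u t h x a ∂Q =
        (∫ a : Vec n × Ξ, A.meanLoss 𝒟 t h (x + τ • a.1) ∂Q) - A.meanLoss 𝒟 t h u -
          (∫ a, inner ℝ (roundGrad A τ t h x a) (x - u) ∂Q) +
          κ * ∫ a, lpNormVec q (roundGrad A τ t h x a) ^ (α + 1) ∂Q := by
      unfold roundExcess
      rw [integral_add hfi'' (hG1.const_mul κ), integral_sub hfi' hI1,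
        integral_sub hfi (integrable_const _), integral_const_mul]
      simp
    rw [hval]
    have := mul_le_mul_of_nonneg_left hG2 hκ
    linarith

end Round

/-! ### The run of the algorithm -/

section Run

variable {n : ℕ} {Ξ : Type*} [MeasurableSpace Ξ] {A : Environment n Ξ} {ψ : Vec n → ℝ}
  {S : Set (Vec n)} {p q : ℝ≥0∞} {τ μ : ℝ} {lam : ℝ≥0∞}

lemma gradEst_eq_roundGrad (A : Environment n Ξ) (τ : ℝ) (w : ℕ → Vec n × Ξ) (t : ℕ) (x : Vec n) :
    gradEst A τ w t x = roundGrad A τ t (pastOf w t) x (w t) := rfl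

lemma measurable_pastOf (t : ℕ) : Measurable fun w : ℕ → Vec n × Ξ => pastOf w t :=
  measurable_pi_lambda _ fun _ => measurable_pi_apply _

lemma measurable_clipVec (hq : 1 ≤ q) (lam : ℝ≥0∞) :
    Measurable (clipVec q lam : Vec n → Vec n) := by
  have h := (continuous_lpNormVec (n := n) hq).measurable
  unfold clipVec
  exact (((h.ennreal_ofReal.min measurable_const).ennreal_toReal).div h).smul measurable_id

lemma iterX_mem (hψ : IsProx p ψ) (hp : 1 ≤ p) (hp2 : p ≤ 2) (hS : S.Nonempty) (hc : IsCompact S)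
    (hconv : Convex ℝ S) (w : ℕ → Vec n × Ξ) (t : ℕ) : iterX A ψ S q τ μ lam w t ∈ S := by
  cases t with
  | zero => exact hψ.startPoint_mem hS hc
  | succ t => exact (hψ.mirrorStep_spec hp hp2 hS hc hconv _ _ _).1

lemma measurable_iterX (hψ : IsProx p ψ) (hp : 1 ≤ p) (hp2 : p ≤ 2) (hq : 1 ≤ q)
    (hS : S.Nonempty) (hc : IsCompact S) (hconv : Convex ℝ S) (t : ℕ) :
    Measurable fun w : ℕ → Vec n × Ξ => iterX A ψ S q τ μ lam w t := by
  induction t with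
  | zero => exact measurable_const
  | succ t ih =>
    have hg : Measurable fun w : ℕ → Vec n × Ξ =>
        roundGrad A τ t (pastOf w t) (iterX A ψ S q τ μ lam w t) (w t) :=
      (measurable_roundGrad A τ t).comp
        (((measurable_pastOf t).prodMk ih).prodMk (measurable_pi_apply t))
    have hclip := (measurable_clipVec hq lam).comp hg
    have h := (hψ.continuous_mirrorStep hp hp2 hS hc hconv μ).measurable.comp (ih.prodMk hclip)
    simpa only [iterX, gradEst_eq_roundGrad, Function.comp_def] using h

/-- Nonanticipation: the iterate is a function of the history alone, hence independent of the
current draw. -/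
lemma iterX_congr {w w' : ℕ → Vec n × Ξ} (t : ℕ) (h : ∀ i < t, w i = w' i) :
    iterX A ψ S q τ μ lam w t = iterX A ψ S q τ μ lam w' t := by
  induction t with
  | zero => rfl
  | succ t ih =>
    have h1 := ih fun i hi => h i (by omega)
    have h2 : pastOf w t = pastOf w' t := funext fun i => h i (by omega)
    simp only [iterX, gradEst_eq_roundGrad, h1, h2, h t (by omega)]

/-- A path with a given beginning. -/
def extendHistory (a : Vec n × Ξ) (t : ℕ) (h : History n Ξ t) : ℕ → Vec n × Ξ :=
  fun i => if hi : i < t then h ⟨i, hi⟩ else a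

lemma measurable_extendHistory (a : Vec n × Ξ) (t : ℕ) : Measurable (extendHistory a t) := by
  refine measurable_pi_lambda _ fun i => ?_
  by_cases hi : i < t
  · simpa [extendHistory, hi] using measurable_pi_apply _
  · simp [extendHistory, hi]

lemma iterX_extendHistory (a : Vec n × Ξ) (w : ℕ → Vec n × Ξ) (t : ℕ) :
    iterX A ψ S q τ μ lam (extendHistory a t (pastOf w t)) t = iterX A ψ S q τ μ lam w t :=
  iterX_congr t fun i hi => by simp [extendHistory, hi, pastOf]

/-- The regret of mirror descent along a path. -/
lemma sum_inner_clipVec_le (hψ : IsProx p ψ) (hpq : p.HolderConjugate q) (hp : 1 ≤ p)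
    (hp2 : p ≤ 2) (hS : S.Nonempty) (hc : IsCompact S) (hconv : Convex ℝ S) (hμ : 0 < μ)
    {u : Vec n} (hu : u ∈ S) (w : ℕ → Vec n × Ξ) (T : ℕ) :
    ∑ t ∈ Finset.range T,
      (inner ℝ (clipVec q lam (gradEst A τ w t (iterX A ψ S q τ μ lam w t)))
        (iterX A ψ S q τ μ lam w t - u) -
      μ / 2 * lpNormVec q (clipVec q lam (gradEst A τ w t (iterX A ψ S q τ μ lam w t))) ^ 2) ≤
      proxDist ψ S u ^ 2 / (2 * μ) := by
  set x := iterX A ψ S q τ μ lam w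
  set g := fun t => clipVec q lam (gradEst A τ w t (x t))
  have hstep : ∀ t, inner ℝ (g t) (x t - u) - μ / 2 * lpNormVec q (g t) ^ 2 ≤
      bregman ψ u (x t) / μ - bregman ψ u (x (t + 1)) / μ := by
    intro t
    have h := hψ.inner_le_of_mirrorStep hpq hp hp2 hS hc hconv hμ.le (x t) (g t) hu
    have e : mirrorStep ψ S μ (x t) (g t) = x (t + 1) := rfl
    rw [e] at h
    rw [← sub_div, le_div_iff₀ hμ]
    linarith
  calc _ ≤ ∑ t ∈ Finset.range T, (bregman ψ u (x t) / μ - bregman ψ u (x (t + 1)) / μ) :=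
        Finset.sum_le_sum fun t _ => hstep t
    _ = bregman ψ u (x 0) / μ - bregman ψ u (x T) / μ := Finset.sum_range_sub' _ _
    _ ≤ bregman ψ u (x 0) / μ := by
        have := div_nonneg (hψ.bregman_nonneg u (x T)) hμ.le
        linarith
    _ = _ := by
        have e : x 0 = startPoint ψ S := rfl
        rw [hψ.proxDist_sq, e]
        field_simp

variable {Ω : Type*} [MeasurableSpace Ω] {P : Measure Ω} {𝒟 : Measure Ξ}
  {e : ℕ → Ω → Vec n} {ξ : ℕ → Ω → Ξ}

namespace IsSampling

lemma measurable_path (hs : IsSampling P 𝒟 e ξ) :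
    Measurable fun ω => fun t : ℕ => (e t ω, ξ t ω) :=
  measurable_pi_lambda _ fun t => (hs.measurable_e t).prodMk (hs.measurable_ξ t)

/-- The current randomness is independent of the past. -/
lemma map_pastOf_prod [IsProbabilityMeasure P] (hs : IsSampling P 𝒟 e ξ) (t : ℕ) :
    P.map (fun ω => (pastOf (fun t : ℕ => (e t ω, ξ t ω)) t, (e t ω, ξ t ω))) =
      (P.map fun ω => pastOf (fun t : ℕ => (e t ω, ξ t ω)) t).prod ((unifSphere n).prod 𝒟) := by
  have hm : ∀ t, Measurable fun ω => (e t ω, ξ t ω) := fun t =>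
    (hs.measurable_e t).prodMk (hs.measurable_ξ t)
  -- Rounds `0, …, t-1` and round `t` are disjoint blocks of an independent family.
  have hind := hs.indep.indepFun_finset (Finset.range t) {t} (by simp) hm
  have h1 : Measurable fun (f : Finset.range t → Vec n × Ξ) (i : Fin t) =>
      f ⟨i, Finset.mem_range.2 i.2⟩ :=
    measurable_pi_lambda _ fun _ => measurable_pi_apply _
  have h2 : Measurable fun f : ({t} : Finset ℕ) → Vec n × Ξ => f ⟨t, Finset.mem_singleton_self t⟩ :=
    measurable_pi_apply _
  have hind2 := hind.comp h1 h2
  have h3 := (indepFun_iff_map_prod_eq_prod_map_map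
    ((measurable_pastOf t).comp hs.measurable_path).aemeasurable (hm t).aemeasurable).1 hind2
  rw [hs.law t] at h3
  exact h3

lemma ae_norm_eq_one (hs : IsSampling P 𝒟 e ξ) [IsProbabilityMeasure 𝒟] (t : ℕ) :
    ∀ᵐ ω ∂P, ‖e t ω‖ = 1 := by
  have hm : Measurable fun ω => (e t ω, ξ t ω) :=
    (hs.measurable_e t).prodMk (hs.measurable_ξ t)
  have h1 : ∀ᵐ a ∂((unifSphere n).prod 𝒟), ‖a.1‖ = 1 :=
    (Measure.quasiMeasurePreserving_fst (μ := unifSphere n) (ν := 𝒟)).ae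
      (ae_norm_eq_one_unifSphere n)
  rw [← hs.law t] at h1
  exact ae_of_ae_map hm.aemeasurable h1

end IsSampling

/-- Where `u` minimises the total loss, the infimum over `S` is its value at `u`. The pseudo-regret
then agrees almost surely with the regret against `u`. -/
lemma AvgRegretLE.of_bound {A : Environment n Ξ} {T : ℕ}
    {w : Ω → ℕ → Vec n × Ξ} {z : Ω → ℕ → Vec n} {u : Vec n} {b : ℝ} (hu : u ∈ S)
    (h1 : Integrable (fun ω => sequenceLoss A 𝒟 T (w ω) (z ω) - totalLoss A 𝒟 T (w ω) u) P)
    (h2 : 1 / (T : ℝ) * ∫ ω, (sequenceLoss A 𝒟 T (w ω) (z ω) - totalLoss A 𝒟 T (w ω) u) ∂P ≤ b) :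
    AvgRegretLE P A 𝒟 S T w z u b := by
  refine ⟨⟨h1, h2⟩, fun hmin => ?_⟩
  have heq : (fun ω => pseudoRegret A 𝒟 S T (w ω) (z ω)) =ᵐ[P]
      fun ω => sequenceLoss A 𝒟 T (w ω) (z ω) - totalLoss A 𝒟 T (w ω) u := by
    filter_upwards [hmin] with ω hω
    have hleast : IsLeast (totalLoss A 𝒟 T (w ω) '' S) (totalLoss A 𝒟 T (w ω) u) := by
      refine ⟨⟨u, hu, rfl⟩, ?_⟩
      rintro _ ⟨y, hy, rfl⟩
      exact hω hy
    rw [pseudoRegret, hleast.csInf_eq]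
  refine ⟨h1.congr heq.symm, ?_⟩
  rwa [integral_congr_ae heq]

lemma AvgRegretLE.mono {A : Environment n Ξ} {T : ℕ}
    {w : Ω → ℕ → Vec n × Ξ} {z : Ω → ℕ → Vec n} {u : Vec n} {b b' : ℝ}
    (h : AvgRegretLE P A 𝒟 S T w z u b) (hb : b ≤ b') : AvgRegretLE P A 𝒟 S T w z u b' :=
  ⟨⟨h.1.1, h.1.2.trans hb⟩, fun hm => ⟨(h.2 hm).1, (h.2 hm).2.trans hb⟩⟩

variable [IsProbabilityMeasure P] [IsProbabilityMeasure 𝒟] {α B Δ b : ℝ}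

/-- The expected excess of a round of the algorithm. -/
lemma integral_roundExcess_iterX_le (hs : IsSampling P 𝒟 e ξ) (hn : 2 ≤ n) (hψ : IsProx p ψ)
    (hp : 1 ≤ p) (hp2 : p ≤ 2) (hq : 2 ≤ q) (hS : S.Nonempty) (hc : IsCompact S)
    (hconv : Convex ℝ S) (hα0 : 0 < α) (hα1 : α ≤ 1)
    (hB : 0 < B) (hΔ : 0 ≤ Δ) (hτ : 0 < τ) (hbdd : A.BoundedLoss 𝒟 S τ α B)
    (hnoise : A.BoundedNoise S τ Δ) (hf : ∀ t h, IsRoundLoss S τ B b (A.meanLoss 𝒟 t h))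
    {u : Vec n} (hu : u ∈ S) {κ : ℝ} (hκ : 0 ≤ κ) (t : ℕ) :
    Integrable (fun ω => roundExcess A 𝒟 q τ α κ u t (pastOf (fun t : ℕ => (e t ω, ξ t ω)) t)
        (iterX A ψ S q τ μ lam (fun t : ℕ => (e t ω, ξ t ω)) t) (e t ω, ξ t ω)) P ∧
      ∫ ω, roundExcess A 𝒟 q τ α κ u t (pastOf (fun t : ℕ => (e t ω, ξ t ω)) t)
        (iterX A ψ S q τ μ lam (fun t : ℕ => (e t ω, ξ t ω)) t) (e t ω, ξ t ω) ∂P ≤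
        2 * b + Δ * √n / τ * proxDiam ψ S + κ * sigmaConst n q α B Δ τ ^ (α + 1) := by
  have : NeZero n := ⟨by omega⟩
  have hq1 : 1 ≤ q := le_trans (by norm_num) hq
  obtain ⟨s₀⟩ : Nonempty Ξ := nonempty_of_isProbabilityMeasure 𝒟
  -- An arbitrary filler for the entries from `t` on, which the iterate does not read.
  set a₀ : Vec n × Ξ := (0, s₀)
  set X : History n Ξ t → Vec n := fun h => iterX A ψ S q τ μ lam (extendHistory a₀ t h) t
  have hXm : Measurable X :=
    (measurable_iterX hψ hp hp2 hq1 hS hc hconv t).comp (measurable_extendHistory a₀ t)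
  have hXS : ∀ h, X h ∈ S := fun h => iterX_mem hψ hp hp2 hS hc hconv _ t
  set F : History n Ξ t × (Vec n × Ξ) → ℝ := fun b =>
    roundExcess A 𝒟 q τ α κ u t b.1 (X b.1) b.2
  have hFm : Measurable F := (measurable_roundExcess A 𝒟 hq1 τ α κ u t).comp
    ((measurable_fst.prodMk (hXm.comp measurable_fst)).prodMk measurable_snd)
  have hD : ∀ h, ‖u - X h‖ ≤ proxDiam ψ S := fun h =>
    (norm_le_lpNormVec hp hp2 _).trans (hψ.lpNormVec_sub_le_proxDiam hc hu (hXS h))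
  have hround := fun h => integral_roundExcess_le hn hq hα0 hα1 hB hΔ hτ hc hbdd hnoise t h (hf t h)
    (hXS h) hu (hD h) hκ
  have hmp : Measurable fun ω => pastOf (fun t : ℕ => (e t ω, ξ t ω)) t :=
    (measurable_pastOf t).comp hs.measurable_path
  set ν := P.map fun ω => pastOf (fun t : ℕ => (e t ω, ξ t ω)) t with hν
  have : IsProbabilityMeasure ν := Measure.isProbabilityMeasure_map hmp.aemeasurable
  obtain ⟨hFi, -⟩ := integrable_prod_of_forall_integral_abs_le (μ := ν)
    (ν := (unifSphere n).prod 𝒟) hFm (integrable_const _)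
    (Filter.Eventually.of_forall fun h => (hround h).1)
    (Filter.Eventually.of_forall fun h => (hround h).2.1)
  have hFle : ∫ a, F a ∂(ν.prod ((unifSphere n).prod 𝒟)) ≤
      2 * b + Δ * √n / τ * proxDiam ψ S + κ * sigmaConst n q α B Δ τ ^ (α + 1) := by
    rw [integral_prod _ hFi]
    calc _ ≤ ∫ _h, (2 * b + Δ * √n / τ * proxDiam ψ S +
          κ * sigmaConst n q α B Δ τ ^ (α + 1)) ∂ν :=
          integral_mono hFi.integral_prod_left (integrable_const _) fun h => (hround h).2.2
      _ = _ := by simp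
  have hmpair : Measurable fun ω =>
      (pastOf (fun t : ℕ => (e t ω, ξ t ω)) t, (e t ω, ξ t ω)) :=
    hmp.prodMk ((hs.measurable_e t).prodMk (hs.measurable_ξ t))
  have hFω : ∀ ω, F (pastOf (fun t : ℕ => (e t ω, ξ t ω)) t, (e t ω, ξ t ω)) =
      roundExcess A 𝒟 q τ α κ u t (pastOf (fun t : ℕ => (e t ω, ξ t ω)) t)
        (iterX A ψ S q τ μ lam (fun t : ℕ => (e t ω, ξ t ω)) t) (e t ω, ξ t ω) := by
    intro ω
    simp only [F, X, iterX_extendHistory]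
  rw [← hs.map_pastOf_prod t] at hFi hFle
  rw [integral_map hmpair.aemeasurable hFm.aestronglyMeasurable] at hFle
  have hFi' := (integrable_map_measure hFm.aestronglyMeasurable hmpair.aemeasurable).1 hFi
  simp only [Function.comp_def, hFω] at hFi' hFle
  exact ⟨hFi', hFle⟩

lemma integrable_regret (hs : IsSampling P 𝒟 e ξ) (hψ : IsProx p ψ)
    (hp : 1 ≤ p) (hp2 : p ≤ 2) (hq : 1 ≤ q) (hS : S.Nonempty) (hc : IsCompact S)
    (hconv : Convex ℝ S) (hτ : 0 ≤ τ) (hf : ∀ t h, IsRoundLoss S τ B b (A.meanLoss 𝒟 t h))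
    {u : Vec n} (hu : u ∈ S) (T : ℕ) :
    Integrable (fun ω => sequenceLoss A 𝒟 T (fun t : ℕ => (e t ω, ξ t ω))
        (iterZ A ψ S q τ μ lam (fun t : ℕ => (e t ω, ξ t ω))) -
      totalLoss A 𝒟 T (fun t : ℕ => (e t ω, ξ t ω)) u) P := by
  have hX : ∀ t, Measurable fun ω => iterX A ψ S q τ μ lam (fun t : ℕ => (e t ω, ξ t ω)) t :=
    fun t => (measurable_iterX hψ hp hp2 hq hS hc hconv t).comp hs.measurable_path
  have hZ : ∀ t, Measurable fun ω => iterZ A ψ S q τ μ lam (fun t : ℕ => (e t ω, ξ t ω)) t :=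
    fun t => (hX t).add ((hs.measurable_e t).const_smul τ)
  have hmp : ∀ t, Measurable fun ω => pastOf (fun t : ℕ => (e t ω, ξ t ω)) t := fun t =>
    (measurable_pastOf t).comp hs.measurable_path
  unfold sequenceLoss totalLoss
  refine Integrable.sub (integrable_finsetSum _ fun t _ => ?_)
    (integrable_finsetSum _ fun t _ => ?_)
  · refine Integrable.of_bound (C := B)
      ((A.measurable_meanLoss t).comp ((hmp t).prodMk (hZ t))).aestronglyMeasurable ?_
    filter_upwards [hs.ae_norm_eq_one t] with ω hω
    exact (hf t _).abs_le _ (add_smul_mem_enlarge (iterX_mem hψ hp hp2 hS hc hconv _ t) hω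
      ⟨hτ, le_rfl⟩)
  · refine Integrable.of_bound (C := B)
      ((A.measurable_meanLoss t).comp ((hmp t).prodMk measurable_const)).aestronglyMeasurable
      (Filter.Eventually.of_forall fun ω => ?_)
    exact (hf t _).abs_le _ (mem_enlarge hτ hu)

/-- The expected regret is controlled by the excesses and a pathwise bound. -/
lemma avgRegretLE_of_pathwise (hs : IsSampling P 𝒟 e ξ) (hn : 2 ≤ n) (hψ : IsProx p ψ)
    (hp : 1 ≤ p) (hp2 : p ≤ 2) (hq : 2 ≤ q) (hS : S.Nonempty) (hc : IsCompact S)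
    (hconv : Convex ℝ S) (hα0 : 0 < α) (hα1 : α ≤ 1)
    (hB : 0 < B) (hΔ : 0 ≤ Δ) (hτ : 0 < τ) (hbdd : A.BoundedLoss 𝒟 S τ α B)
    (hnoise : A.BoundedNoise S τ Δ) (hf : ∀ t h, IsRoundLoss S τ B b (A.meanLoss 𝒟 t h))
    {u : Vec n} (hu : u ∈ S) {κ c₀ : ℝ} (hκ : 0 ≤ κ) {T : ℕ} (hT : 1 ≤ T)
    (hpath : ∀ w : ℕ → Vec n × Ξ,
      sequenceLoss A 𝒟 T w (iterZ A ψ S q τ μ lam w) - totalLoss A 𝒟 T w u ≤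
        (∑ t ∈ Finset.range T, roundExcess A 𝒟 q τ α κ u t (pastOf w t)
          (iterX A ψ S q τ μ lam w t) (w t)) + c₀) :
    AvgRegretLE P A 𝒟 S T (fun ω t => (e t ω, ξ t ω))
      (fun ω => iterZ A ψ S q τ μ lam fun t : ℕ => (e t ω, ξ t ω)) u
      (2 * b + Δ * √n / τ * proxDiam ψ S + κ * sigmaConst n q α B Δ τ ^ (α + 1) +
        1 / (T : ℝ) * c₀) := by
  have hT' : (0 : ℝ) < T := by exact_mod_cast hT
  have hq1 : 1 ≤ q := le_trans (by norm_num) hq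
  have hint := integrable_regret (μ := μ) (lam := lam) hs hψ hp hp2 hq1 hS hc hconv hτ.le hf hu T
  refine AvgRegretLE.of_bound hu hint ?_
  have hr := integral_roundExcess_iterX_le (μ := μ) (lam := lam) hs hn hψ hp hp2 hq hS hc hconv
    hα0 hα1 hB hΔ hτ hbdd hnoise hf hu hκ
  set c := 2 * b + Δ * √n / τ * proxDiam ψ S + κ * sigmaConst n q α B Δ τ ^ (α + 1)
  have hsum : Integrable (fun ω => ∑ t ∈ Finset.range T, roundExcess A 𝒟 q τ α κ u t
      (pastOf (fun t : ℕ => (e t ω, ξ t ω)) t)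
      (iterX A ψ S q τ μ lam (fun t : ℕ => (e t ω, ξ t ω)) t) (e t ω, ξ t ω)) P :=
    integrable_finsetSum _ fun t _ => (hr t).1
  have hle : ∫ ω, (sequenceLoss A 𝒟 T (fun t : ℕ => (e t ω, ξ t ω))
        (iterZ A ψ S q τ μ lam (fun t : ℕ => (e t ω, ξ t ω))) -
      totalLoss A 𝒟 T (fun t : ℕ => (e t ω, ξ t ω)) u) ∂P ≤ T * c + c₀ := by
    calc _ ≤ ∫ ω, ((∑ t ∈ Finset.range T, roundExcess A 𝒟 q τ α κ u t
          (pastOf (fun t : ℕ => (e t ω, ξ t ω)) t)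
          (iterX A ψ S q τ μ lam (fun t : ℕ => (e t ω, ξ t ω)) t) (e t ω, ξ t ω)) + c₀) ∂P :=
          integral_mono hint (hsum.add (integrable_const c₀)) fun ω => hpath _
      _ = (∑ t ∈ Finset.range T, ∫ ω, roundExcess A 𝒟 q τ α κ u t
          (pastOf (fun t : ℕ => (e t ω, ξ t ω)) t)
          (iterX A ψ S q τ μ lam (fun t : ℕ => (e t ω, ξ t ω)) t) (e t ω, ξ t ω) ∂P) + c₀ := by
          rw [integral_add hsum (integrable_const c₀), integral_finsetSum _ fun t _ => (hr t).1]
          simp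
      _ ≤ (∑ _t ∈ Finset.range T, c) + c₀ := by
          gcongr with t
          exact (hr t).2
      _ = _ := by simp
  calc _ ≤ 1 / (T : ℝ) * (T * c + c₀) := by gcongr
    _ = _ := by field_simp

/-- The regret bound for the clipping algorithm, with the bias `b` of the losses. -/
lemma avgRegretLE_playedPoint (hs : IsSampling P 𝒟 e ξ) (hn : 2 ≤ n) (hψ : IsProx p ψ)
    (hpq : p.HolderConjugate q)
    (hp : 1 ≤ p) (hp2 : p ≤ 2) (hq : 2 ≤ q) (hS : S.Nonempty) (hc : IsCompact S)
    (hconv : Convex ℝ S) (hα0 : 0 < α) (hα1 : α ≤ 1)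
    (hB : 0 < B) (hΔ : 0 ≤ Δ) (hτ : 0 < τ) (hbdd : A.BoundedLoss 𝒟 S τ α B)
    (hnoise : A.BoundedNoise S τ Δ) (hf : ∀ t h, IsRoundLoss S τ B b (A.meanLoss 𝒟 t h))
    {u : Vec n} (hu : u ∈ S) {T : ℕ} (hT : 1 ≤ T) :
    AvgRegretLE P A 𝒟 S T (fun ω t => (e t ω, ξ t ω))
      (fun ω => playedPoint A ψ S q α B Δ τ T u fun t : ℕ => (e t ω, ξ t ω)) u
      (2 * b + Δ * √n / τ * proxDiam ψ S +
        3 * (proxDist ψ S u ^ (2 * α / (α + 1)) * proxDiam ψ S ^ ((1 - α) / (α + 1)) * n *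
          aConst n q * (Δ + B)) / (τ * (T : ℝ) ^ (α / (α + 1)))) := by
  have hq1 : 1 ≤ q := le_trans (by norm_num) hq
  have hT' : (0 : ℝ) < T := by exact_mod_cast hT
  have ha := aConst_pos hn hq
  have hRD := hψ.proxDist_le_proxDiam hS hc hu
  rcases (proxDist_nonneg ψ S u).eq_or_lt with hR | hR
  · -- the starting point is the comparison point, and the algorithm stays there
    have hμ : stepSize α T (proxDist ψ S u) (proxDiam ψ S) (sigmaConst n q α B Δ τ) = 0 := by
      rw [stepSize, ← hR, zero_pow two_ne_zero, zero_div,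
        Real.zero_rpow (one_div_ne_zero (by linarith))]
    have hx : ∀ (lam : ℝ≥0∞) (w : ℕ → Vec n × Ξ) t, iterX A ψ S q τ 0 lam w t = u := by
      intro lam w t
      induction t with
      | zero => exact hψ.startPoint_eq_of_proxDist_eq_zero hp hp2 hR.symm
      | succ t ih => rw [iterX, ih, hψ.mirrorStep_zero hp hp2 hS hc hconv hu]
    -- At `x = u` the inner product in the excess vanishes, so no moment term or mirror descent term
    -- is needed.
    have hbase := avgRegretLE_of_pathwise (μ := 0) (lam := clipLevel α (proxDiam ψ S) 0) (κ := 0)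
      (c₀ := 0) hs hn hψ hp hp2 hq hS hc hconv hα0 hα1 hB hΔ hτ hbdd hnoise hf hu le_rfl hT (by
        intro w
        rw [sequenceLoss, totalLoss, ← Finset.sum_sub_distrib, add_zero]
        refine Finset.sum_le_sum fun t _ => ?_
        simp [roundExcess, iterZ, hx])
    unfold playedPoint
    rw [hμ]
    refine hbase.mono ?_
    rw [zero_mul, mul_zero, add_zero, add_zero]
    have : 0 ≤ proxDist ψ S u := hR.le
    have : 0 ≤ proxDiam ψ S := this.trans hRD
    have : 0 ≤ 3 * (proxDist ψ S u ^ (2 * α / (α + 1)) * proxDiam ψ S ^ ((1 - α) / (α + 1)) * n *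
      aConst n q * (Δ + B)) / (τ * (T : ℝ) ^ (α / (α + 1))) := by positivity
    linarith
  have hD : 0 < proxDiam ψ S := hR.trans_le hRD
  have hσ := sigmaConst_pos (α := α) (n := n) (by omega) ha hB hΔ hτ
  have hμ := stepSize_pos (α := α) hT hR hD hσ
  have hbal := stepSize_balance hα0 hT hR hD hσ
  have hreg := mirror_regret_le (n := n) (by omega) hα0 hT ha hB hΔ hτ hR hD
  unfold playedPoint
  set R := proxDist ψ S u
  set D := proxDiam ψ S
  set σ := sigmaConst n q α B Δ τ
  set μ := stepSize α T R D σ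
  -- `κ` is the coefficient from `clip_tradeoff` and `c₀` the telescoped mirror descent bound.
  -- Pathwise, `g` is split into its clipped part and the clipping bias.
  have hbase := avgRegretLE_of_pathwise (μ := μ) (lam := clipLevel α D μ)
    (κ := D ^ (1 - α) * μ ^ α) (c₀ := R ^ 2 / (2 * μ)) hs hn hψ hp hp2 hq hS hc hconv hα0 hα1 hB hΔ
    hτ hbdd hnoise hf hu (by positivity) hT (by
      intro w
      have hmd := sum_inner_clipVec_le (A := A) (τ := τ) (lam := clipLevel α D μ) hψ hpq hp hp2
        hS hc hconv hμ hu w T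
      rw [sequenceLoss, totalLoss, ← Finset.sum_sub_distrib]
      refine le_trans ?_ (add_le_add_right hmd _)
      rw [← Finset.sum_add_distrib]
      refine Finset.sum_le_sum fun t _ => ?_
      have hxS := iterX_mem (A := A) (q := q) (τ := τ) (μ := μ) (lam := clipLevel α D μ) hψ hp hp2
        hS hc hconv w t
      have hcl := inner_sub_clipVec_add_le hpq hq1 hα0 hα1 hμ hD
        (gradEst A τ w t (iterX A ψ S q τ μ (clipLevel α D μ) w t))
        (iterX A ψ S q τ μ (clipLevel α D μ) w t - u) (hψ.lpNormVec_sub_le_proxDiam hc hxS hu)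
      rw [inner_sub_left] at hcl
      rw [roundExcess, ← gradEst_eq_roundGrad, iterZ]
      linarith)
  refine hbase.mono ?_
  -- By the balance, the shares `1/4` and `1/2` of `R²/μ` add up to `3/4`.
  have h1 : D ^ (1 - α) * μ ^ α * σ ^ (α + 1) + 1 / (T : ℝ) * (R ^ 2 / (2 * μ)) =
      1 / (T : ℝ) * (3 / 4 * (R ^ 2 / μ)) := by
    have h2 : D ^ (1 - α) * μ ^ α * σ ^ (α + 1) = 1 / (T : ℝ) * (R ^ 2 / (4 * μ)) := by
      rw [← hbal]
      field_simp
    rw [h2]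
    field_simp
    norm_num
  linarith

end Run

/-! ### The number of rounds -/

lemma le_two_of_holderConjugate {p q : ℝ≥0∞} (hpq : p.HolderConjugate q) (hq : 2 ≤ q) : p ≤ 2 := by
  have h := hpq.inv_add_inv_eq_one
  have hq' : q⁻¹ ≤ 2⁻¹ := ENNReal.inv_le_inv.2 hq
  rw [← ENNReal.inv_le_inv]
  by_contra! hlt
  have h1 := ENNReal.add_lt_add_of_lt_of_le (ne_top_of_le_ne_top (by simp) hq') hlt hq'
  rw [h, ENNReal.inv_two_add_inv_two] at h1
  exact lt_irrefl _ h1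

/-- The interpolated distance is at most the diameter. -/
lemma rpow_mul_rpow_le_of_le {α R D : ℝ} (hα0 : 0 < α) (hα1 : α ≤ 1) (hR : 0 ≤ R) (hRD : R ≤ D) :
    R ^ (2 * α / (α + 1)) * D ^ ((1 - α) / (α + 1)) ≤ D := by
  have hα : 0 < α + 1 := by linarith
  have hsum : 2 * α / (α + 1) + (1 - α) / (α + 1) = 1 := by field_simp; ring
  calc R ^ (2 * α / (α + 1)) * D ^ ((1 - α) / (α + 1))
      ≤ D ^ (2 * α / (α + 1)) * D ^ ((1 - α) / (α + 1)) := by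
        have := hR.trans hRD
        gcongr
    _ = D := by
        rw [← Real.rpow_add_of_nonneg (hR.trans hRD) (by positivity)
          (div_nonneg (by linarith) hα.le), hsum, Real.rpow_one]

lemma le_rpow_of_rpow_le {α X T : ℝ} (hα0 : 0 < α) (hX : 0 ≤ X) (h : X ^ ((α + 1) / α) ≤ T) :
    X ≤ T ^ (α / (α + 1)) := by
  have h1 := Real.rpow_le_rpow (by positivity) h (show 0 ≤ α / (α + 1) by positivity)
  rwa [← Real.rpow_mul hX, show (α + 1) / α * (α / (α + 1)) = 1 by field_simp, Real.rpow_one] at h1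

lemma div_mul_le_of_le_mul {K τ s ε : ℝ} (hτ : 0 < τ) (hs : 0 < s) (h : K ≤ ε * τ * s) :
    K / (τ * s) ≤ ε := by
  rw [div_le_iff₀ (by positivity)]
  linarith

lemma sqrt_four_mul (L : ℝ) : √(4 * L) = 2 * √L := by
  rw [Real.sqrt_mul (by norm_num), show (4 : ℝ) = 2 ^ 2 by norm_num, Real.sqrt_sq (by norm_num)]

lemma rpow_three_halves {ε : ℝ} (hε : 0 < ε) : ε ^ (3 / 2 : ℝ) = ε * √ε := by
  rw [Real.sqrt_eq_rpow, ← Real.rpow_one_add' hε.le (by norm_num)]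
  norm_num

end

/-! ### The explicit rates and iteration counts. -/

theorem theorem2 {n : ℕ} (hn : 2 ≤ n) {Ξ Ω : Type*} [MeasurableSpace Ξ] [MeasurableSpace Ω]
    (P : Measure Ω) [IsProbabilityMeasure P] (𝒟 : Measure Ξ) [IsProbabilityMeasure 𝒟]
    (e : ℕ → Ω → Vec n) (ξ : ℕ → Ω → Ξ) (hsample : IsSampling P 𝒟 e ξ)
    (S : Set (Vec n)) (hSne : S.Nonempty) (hScpt : IsCompact S) (hSconv : Convex ℝ S)
    (p q : ℝ≥0∞) (hpq : p.HolderConjugate q) (hq : 2 ≤ q)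
    (ψ : Vec n → ℝ) (hψ : IsProx p ψ)
    (α B Δ τ : ℝ) (hα0 : 0 < α) (hα1 : α ≤ 1) (hB : 0 < B) (hΔ : 0 ≤ Δ) (hτ : 0 < τ)
    (A : Environment n Ξ) (hconv : A.ConvexLoss S τ) (hbdd : A.BoundedLoss 𝒟 S τ α B)
    (hnoise : A.BoundedNoise S τ Δ)
    (T : ℕ) (hT : 1 ≤ T) (u : Vec n) (hu : u ∈ S)
    (w : Ω → ℕ → Vec n × Ξ) (hw : w = fun ω t => (e t ω, ξ t ω))
    (z : Ω → ℕ → Vec n) (hz : z = fun ω => playedPoint A ψ S q α B Δ τ T u (w ω))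
    (R D : ℝ) (hR : R = proxDist ψ S u) (hD : D = proxDiam ψ S) :
    -- Lipschitz losses
    (∀ M : ℝ, 0 ≤ M → A.LipschitzLoss 𝒟 S τ α M →
      AvgRegretLE P A 𝒟 S T w z u
        (4 * M * τ + Δ * √n / τ * D
          + 4 * (R ^ (2 * α / (α + 1)) * D ^ ((1 - α) / (α + 1)) * n * aConst n q * (Δ + B))
            / (τ * (T : ℝ) ^ (α / (α + 1)))) ∧
      ∀ ε T_M : ℝ, 0 < ε → 0 < M → Δ = 0 → τ = ε / (8 * M) →
        T_M = (8 * M * (4 * R ^ (2 * α / (α + 1)) * D ^ ((1 - α) / (α + 1)) * n * aConst n q * B)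
          / ε ^ 2) ^ ((α + 1) / α) →
        (T_M ≤ T → AvgRegretLE P A 𝒟 S T w z u ε) ∧
        T_M ≤ (32 : ℝ) ^ ((α + 1) / α) *
          (M * B * n * aConst n q * D / ε ^ 2) ^ ((α + 1) / α)) ∧
    -- smooth losses
    (∀ L : ℝ, 0 ≤ L → A.SmoothLoss 𝒟 S τ α L →
      AvgRegretLE P A 𝒟 S T w z u
        (2 * L * τ ^ 2 + Δ * √n / τ * D
          + 4 * (R ^ (2 * α / (α + 1)) * D ^ ((1 - α) / (α + 1)) * n * aConst n q * (Δ + B))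
            / (τ * (T : ℝ) ^ (α / (α + 1)))) ∧
      ∀ ε T_L : ℝ, 0 < ε → 0 < L → Δ = 0 → τ = √(ε / (4 * L)) →
        T_L = (√(4 * L) *
          (4 * R ^ (2 * α / (α + 1)) * D ^ ((1 - α) / (α + 1)) * n * aConst n q * B)
          / ε ^ (3 / 2 : ℝ)) ^ ((α + 1) / α) →
        (T_L ≤ T → AvgRegretLE P A 𝒟 S T w z u ε) ∧
        T_L ≤ (8 : ℝ) ^ ((α + 1) / α) *
          (√L * B * n * aConst n q * D / ε ^ (3 / 2 : ℝ)) ^ ((α + 1) / α)) := by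
  subst hw hz hR hD
  have hp : 1 ≤ p := ENNReal.HolderConjugate.one_le p q
  have hp2 := le_two_of_holderConjugate hpq hq
  have hT' : (0 : ℝ) < T := by exact_mod_cast hT
  have ha := aConst_pos hn hq
  have hR := proxDist_nonneg ψ S u
  have hRD := hψ.proxDist_le_proxDiam hSne hScpt hu
  have hD := hR.trans hRD
  have hle := rpow_mul_rpow_le_of_le hα0 hα1 hR hRD
  set R := proxDist ψ S u
  set D := proxDiam ψ S
  set K := R ^ (2 * α / (α + 1)) * D ^ ((1 - α) / (α + 1)) with hK
  have hK0 : 0 ≤ K := by positivity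
  have hs : 0 < (T : ℝ) ^ (α / (α + 1)) := Real.rpow_pos_of_pos hT' _
  set s := (T : ℝ) ^ (α / (α + 1))
  have hE : 0 ≤ K * n * aConst n q * (Δ + B) / (τ * s) := by positivity
  -- The constants `2b` and `3` are kept because the stated constants would overshoot `ε` at the
  -- prescribed `τ` and `T`.
  have key {b : ℝ} (hf : ∀ t h, IsRoundLoss S τ B b (A.meanLoss 𝒟 t h)) :
      AvgRegretLE P A 𝒟 S T (fun ω t => (e t ω, ξ t ω))
        (fun ω => playedPoint A ψ S q α B Δ τ T u fun t => (e t ω, ξ t ω)) u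
        (2 * b + Δ * √n / τ * D + 3 * (K * n * aConst n q * (Δ + B)) / (τ * s)) :=
    avgRegretLE_playedPoint hsample hn hψ hpq hp hp2 hq hSne hScpt hSconv hα0 hα1 hB hΔ hτ hbdd
      hnoise hf hu hT
  have hcoef : 0 ≤ K * n * aConst n q * B := by positivity
  have hexp : 0 ≤ (α + 1) / α := by positivity
  constructor
  · intro M hM hLip
    have hreg := key
      (Environment.LipschitzLoss.isRoundLoss hconv hbdd hα0.le hB.le hSconv hτ.le hM hLip)
    refine ⟨hreg.mono ?_, ?_⟩
    · have : 0 ≤ M * τ := by positivity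
      rw [mul_div_assoc 3, mul_div_assoc 4]
      linarith
    intro ε T_M hε hM0 hΔ0 hτε hTM
    subst hΔ0
    have hX : 8 * M * (4 * R ^ (2 * α / (α + 1)) * D ^ ((1 - α) / (α + 1)) * n * aConst n q * B) /
        ε ^ 2 = 32 * (M * (K * n * aConst n q * B) / ε ^ 2) := by
      rw [hK]; ring
    rw [hX] at hTM
    subst hTM
    refine ⟨fun hTT => hreg.mono ?_, ?_⟩
    · have h := le_rpow_of_rpow_le hα0 (by positivity) hTT
      change _ ≤ s at h
      have hMτ : M * τ = ε / 8 := by rw [hτε]; field_simp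
      -- The budget is `2Mτ = ε/4` plus `3 · ε/4`.
      have h3 : K * n * aConst n q * (0 + B) / (τ * s) ≤ ε / 4 := by
        refine div_mul_le_of_le_mul hτ hs ?_
        calc K * n * aConst n q * (0 + B)
            = ε / 4 * τ * (32 * (M * (K * n * aConst n q * B) / ε ^ 2)) := by
              rw [hτε]; field_simp; ring
          _ ≤ _ := by gcongr
      rw [mul_div_assoc 3, hMτ, zero_mul, zero_div, zero_mul]
      linarith
    · rw [← Real.mul_rpow (by norm_num) (by positivity)]
      refine Real.rpow_le_rpow (by positivity) ?_ hexp
      rw [show M * B * n * aConst n q * D = M * (D * n * aConst n q * B) by ring]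
      gcongr
  · intro L hL hsm
    have hreg := key (Environment.SmoothLoss.isRoundLoss hconv hbdd hα0.le hB.le hSconv hτ hL hsm)
    refine ⟨hreg.mono ?_, ?_⟩
    · have : 0 ≤ L * τ ^ 2 := by positivity
      rw [mul_div_assoc 3, mul_div_assoc 4]
      linarith
    intro ε T_L hε hL0 hΔ0 hτε hTL
    subst hΔ0
    have hX : √(4 * L) *
        (4 * R ^ (2 * α / (α + 1)) * D ^ ((1 - α) / (α + 1)) * n * aConst n q * B) /
        ε ^ (3 / 2 : ℝ) = 8 * (√L * (K * n * aConst n q * B) / ε ^ (3 / 2 : ℝ)) := by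
      rw [hK, sqrt_four_mul]; ring
    rw [hX] at hTL
    subst hTL
    refine ⟨fun hTT => hreg.mono ?_, ?_⟩
    · have h := le_rpow_of_rpow_le hα0 (by positivity) hTT
      change _ ≤ s at h
      have hLτ : L * τ ^ 2 = ε / 4 := by
        rw [hτε, Real.sq_sqrt (by positivity)]; field_simp
      have hτ' : τ = √ε / (2 * √L) := by
        rw [hτε, Real.sqrt_div hε.le, sqrt_four_mul]
      -- The budget is `Lτ² = ε/4` plus `3 · ε/4`.
      have h3 : K * n * aConst n q * (0 + B) / (τ * s) ≤ ε / 4 := by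
        refine div_mul_le_of_le_mul hτ hs ?_
        calc K * n * aConst n q * (0 + B)
            = ε / 4 * τ * (8 * (√L * (K * n * aConst n q * B) / ε ^ (3 / 2 : ℝ))) := by
              rw [hτ', rpow_three_halves hε]; field_simp; ring
          _ ≤ _ := by gcongr
      rw [mul_div_assoc 3, mul_div_cancel₀ _ two_ne_zero, hLτ, zero_mul, zero_div, zero_mul]
      linarith
    · rw [← Real.mul_rpow (by norm_num) (by positivity)]
      refine Real.rpow_le_rpow (by positivity) ?_ hexp
      rw [show √L * B * n * aConst n q * D = √L * (D * n * aConst n q * B) by ring]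
      gcongr
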